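/- Strings are over a ternary alphabet; $s[i,j)$ denotes the substring of $s$ on the positions $i,\dots,j-1$ (counted from $0$). A square is a string $ww$ with $w$ non-empty, of half-length $|w|$; a string is square-free if none of its substrings is a square; a minimal square is a square that contains no smaller square as a substring; $M_\ell$ is the set of minimal squares with half-length at most $\ell$. Let $n\ge 0$ and $k\ge 4$ be integers. A string is $k$-promising if it has no square substring with half-length at most $\lfloor n/k\rfloor$. A batch (for length $n$) is a tuple $(L,R,T,U)$ of integers $0\le L\le R$, $T\ge 1$ with $R+T-1\le n$ and a square-free string $U$ of length $(R-L)/2$. A string $s$ of length $n$ contains this batch if $s[L,L+|U|)=U$, the substrings $s[L+j,R+j)$ are minimal squares for all $0\le j<T$, either $L=0$ or $s[L-1,R-1)$ is not a minimal square, and either $R+T>n$ or $s[L+T,R+T)$ is not a minimal square. For a finite set $S$ of batches let $h(S)$ be the number of $k$-promising strings of length $n$ that contain all batches from $S$. Time is the number of steps of a random access machine whose words have $\mathrm{poly}(n)+O(\log k)$ bits, and memory is the number of words. $O^*(X)$ means at most $C(n+1)^C\cdot\max(X,1)$, where all constants are independent of $n$, $k$ and $S$. Then there are a precomputation program, which is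 given $n$, $k$ and (a list of the elements of) $M_{\lfloor n/k\rfloor}$ and uses $O^*(|M_{\lfloor n/k\rfloor}|^3)$ time and $O^*(|M_{\lfloor n/k\rfloor}|^2)$ memory, and a query program, which, started from the memory contents left by the precomputation and given any set $S$ of batches, computes $h(S)$ in $O^*(2^{O(k)})$ time. Moreover, for $k=4$ there are two such programs for which the precomputation uses $O^*(|M_{\lfloor n/4\rfloor}|)$ time and memory and each query takes $O^*(1)$ time. -/

import Mathlib

namespace SquareCount

/-! ### Strings, squares, batches -/

/-- Strings over the ternary alphabet. -/
abbrev Str : Type := List (Fin 3)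

/-- A square is a string of the form `ww` with `w` non-empty. -/
def Square (s : Str) : Prop := ∃ w : Str, w ≠ [] ∧ s = w ++ w

/-- No substring (contiguous, `<:+:`) is a square. -/
def SquareFree (s : Str) : Prop := ∀ t : Str, t <:+: s → ¬ Square t

/-- A square that contains no smaller square as a substring. -/
def MinimalSquare (s : Str) : Prop :=
  Square s ∧ ∀ t : Str, t <:+: s → Square t → ¬ t.length < s.length

/-- The set `M_l` of all minimal squares with half-length at most `l`. -/
def minSquares (l : ℕ) : Set Str := {s | MinimalSquare s ∧ s.length ≤ 2 * l}

/-- A square with half-length at most `⌊n/k⌋`. -/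
def KShort (n k : ℕ) (s : Str) : Prop := ∃ w : Str, w ≠ [] ∧ s = w ++ w ∧ w.length ≤ n / k

/-- A string without `k`-short square substrings. -/
def KPromising (n k : ℕ) (s : Str) : Prop := ∀ t : Str, t <:+: s → ¬ KShort n k t

/-- The substring `s[i, j)`. -/
def slice (s : Str) (i j : ℕ) : Str := (s.drop i).take (j - i)

/-- The data `(L, R, T, U)` of a batch. -/
structure Batch where
  L : ℕ
  R : ℕ
  T : ℕ
  U : Str

/-- `(L, R, T, U)` is a batch for strings of length `n`: the `T ≥ 1` intervals `[L + j, R + j)`,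
`j < T`, lie within `[0, n)`, and `U` is a square-free string of length `(R - L) / 2`. -/
def Batch.Valid (n : ℕ) (b : Batch) : Prop :=
  1 ≤ b.T ∧ b.R = b.L + 2 * b.U.length ∧ b.R + b.T ≤ n + 1 ∧ SquareFree b.U

/-- The string `s` of length `n` contains the batch `b`. -/
def Batch.ContainedIn (n : ℕ) (b : Batch) (s : Str) : Prop :=
  slice s b.L (b.L + b.U.length) = b.U ∧
  (∀ j < b.T, MinimalSquare (slice s (b.L + j) (b.R + j))) ∧
  (b.L = 0 ∨ ¬ MinimalSquare (slice s (b.L - 1) (b.R - 1))) ∧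
  (n < b.R + b.T ∨ ¬ MinimalSquare (slice s (b.L + b.T) (b.R + b.T)))

/-- `h(S)`: the number of `k`-promising strings of length `n` that contain all batches of `S`. -/
noncomputable def h (n k : ℕ) (S : Finset Batch) : ℕ :=
  Set.ncard {s : Str | s.length = n ∧ KPromising n k s ∧ ∀ b ∈ S, b.ContainedIn n s}

/-! ### A word RAM

Programs are structured, over scalar variables and arrays, both named by numerals that are fixed in
the program; so a program uses a constant number of variables and arrays. The machine has word
length `w` (every value is less than `2 ^ w`), arrays with `A` cells of one word each, and a
read-only random-access input. A run that would leave these bounds has no result. Every evaluated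
operation takes one step. -/

/-- The arithmetic operations and comparisons on words. -/
inductive Op where
  | add | sub | mul | div | mod | lt | eq

/-- The value of an operation on natural numbers; subtraction is truncated at `0`. -/
def Op.apply : Op → ℕ → ℕ → ℕ
  | .add, x, y => x + y
  | .sub, x, y => x - y
  | .mul, x, y => x * y
  | .div, x, y => x / y
  | .mod, x, y => x % y
  | .lt, x, y => if x < y then 1 else 0
  | .eq, x, y => if x = y then 1 else 0

/-- Expressions: constants, variables, array cells, input cells, operations. -/
inductive Exp where
  | const (c : ℕ)
  | var (x : ℕ)
  | get (a : ℕ) (i : Exp)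
  | input (i : Exp)
  | op (o : Op) (e₁ e₂ : Exp)

/-- Commands. A condition holds if its value is not `0`. -/
inductive Com where
  | skip
  | assign (x : ℕ) (e : Exp)
  | store (a : ℕ) (i e : Exp)
  | seq (c₁ c₂ : Com)
  | ite (e : Exp) (c₁ c₂ : Com)
  | while (e : Exp) (c : Com)

/-- The contents of all variables and arrays. -/
structure State where
  var : ℕ → ℕ
  arr : ℕ → ℕ → ℕ

/-- The state in which everything is `0`. -/
def State.init : State := ⟨fun _ => 0, fun _ _ => 0⟩

/-- Write `v` to the variable `x`. -/
def State.setVar (σ : State) (x v : ℕ) : State := ⟨Function.update σ.var x v, σ.arr⟩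

/-- Write `v` to cell `i` of the array `a`. -/
def State.setArr (σ : State) (a i v : ℕ) : State :=
  ⟨σ.var, Function.update σ.arr a (Function.update (σ.arr a) i v)⟩

/-- A value that has to fit into a word of `w` bits. -/
def word (w v : ℕ) : Option ℕ := if v < 2 ^ w then some v else none

/-- The value of an expression; `none` on overflow and on an access out of bounds. -/
def Exp.eval (w A : ℕ) (inp : List ℕ) (σ : State) : Exp → Option ℕ
  | .const c => word w c
  | .var x => word w (σ.var x)
  | .get a i => (i.eval w A inp σ).bind fun j => if j < A then word w (σ.arr a j) else none
  | .input i => (i.eval w A inp σ).bind fun j => (inp[j]?).bind (word w)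
  | .op o e₁ e₂ => (e₁.eval w A inp σ).bind fun x =>
      (e₂.eval w A inp σ).bind fun y => word w (o.apply x y)

/-- The number of steps needed to evaluate an expression: one for each of its nodes. -/
def Exp.cost : Exp → ℕ
  | .const _ => 1
  | .var _ => 1
  | .get _ i => i.cost + 1
  | .input i => i.cost + 1
  | .op _ e₁ e₂ => e₁.cost + e₂.cost + 1

/-- `Exec w A inp c σ τ t`: on the machine with word length `w`, array size `A` and input `inp`,
the program `c`, started in the state `σ`, halts in the state `τ` after exactly `t` steps. -/
inductive Exec (w A : ℕ) (inp : List ℕ) : Com → State → State → ℕ → Prop where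
  | skip (σ : State) : Exec w A inp .skip σ σ 1
  | assign (σ : State) (x : ℕ) (e : Exp) (v : ℕ) (he : e.eval w A inp σ = some v) :
      Exec w A inp (.assign x e) σ (σ.setVar x v) (e.cost + 1)
  | store (σ : State) (a : ℕ) (i e : Exp) (j v : ℕ) (hi : i.eval w A inp σ = some j)
      (hj : j < A) (he : e.eval w A inp σ = some v) :
      Exec w A inp (.store a i e) σ (σ.setArr a j v) (i.cost + e.cost + 1)
  | seq (σ₁ σ₂ σ₃ : State) (c₁ c₂ : Com) (t₁ t₂ : ℕ) (h₁ : Exec w A inp c₁ σ₁ σ₂ t₁)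
      (h₂ : Exec w A inp c₂ σ₂ σ₃ t₂) : Exec w A inp (.seq c₁ c₂) σ₁ σ₃ (t₁ + t₂ + 1)
  | ite_true (σ τ : State) (e : Exp) (c₁ c₂ : Com) (v t : ℕ)
      (he : e.eval w A inp σ = some v) (hv : v ≠ 0) (hc : Exec w A inp c₁ σ τ t) :
      Exec w A inp (.ite e c₁ c₂) σ τ (e.cost + t + 1)
  | ite_false (σ τ : State) (e : Exp) (c₁ c₂ : Com) (t : ℕ)
      (he : e.eval w A inp σ = some 0) (hc : Exec w A inp c₂ σ τ t) :
      Exec w A inp (.ite e c₁ c₂) σ τ (e.cost + t + 1)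
  | while_true (σ₁ σ₂ σ₃ : State) (e : Exp) (c : Com) (v t₁ t₂ : ℕ)
      (he : e.eval w A inp σ₁ = some v) (hv : v ≠ 0) (h₁ : Exec w A inp c σ₁ σ₂ t₁)
      (h₂ : Exec w A inp (.while e c) σ₂ σ₃ t₂) :
      Exec w A inp (.while e c) σ₁ σ₃ (e.cost + t₁ + t₂ + 1)
  | while_false (σ : State) (e : Exp) (c : Com) (he : e.eval w A inp σ = some 0) :
      Exec w A inp (.while e c) σ σ (e.cost + 1)

/-! ### Inputs and the two-phase computation -/

/-- A string as its length followed by its letters. -/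
def encStr (s : Str) : List ℕ := s.length :: s.map Fin.val

/-- A batch as `L, R, T` followed by the string `U`. -/
def encBatch (b : Batch) : List ℕ := b.L :: b.R :: b.T :: encStr b.U

/-- The input of the precomputation: `n`, `k` and a list of strings, preceded by its length. -/
def encPre (n k : ℕ) (l : List Str) : List ℕ := n :: k :: l.length :: l.flatMap encStr

/-- The input of a query: `n`, `k` and a list of batches, preceded by its length. -/
def encQuery (n k : ℕ) (l : List Batch) : List ℕ := n :: k :: l.length :: l.flatMap encBatch

/-- With word length `w`, the program `pre`, given `n`, `k` and the set `M_{⌊n/k⌋}` (listed in any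
order), halts within `preTime` steps, with arrays of `preMem` words; and from the memory contents
that it leaves behind the program `query`, given any set `S` of batches (listed in any order),
computes `h(S)` within `queryTime` steps, the result being in variable `0`. -/
def Computes (pre query : Com) (n k w preTime preMem queryTime : ℕ) : Prop :=
  ∀ ms : List Str, ms.Nodup → (∀ s : Str, s ∈ ms ↔ s ∈ minSquares (n / k)) →
    ∃ (σ : State) (t : ℕ), Exec w preMem (encPre n k ms) pre State.init σ t ∧ t ≤ preTime ∧
      ∀ S : Finset Batch, (∀ b ∈ S, b.Valid n) →
        ∀ bs : List Batch, bs.Nodup → (∀ b : Batch, b ∈ bs ↔ b ∈ S) →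
          ∃ (τ : State) (u : ℕ), Exec w (2 ^ w) (encQuery n k bs) query σ τ u ∧
            u ≤ queryTime ∧ τ.var 0 = h n k S

/-- The polynomial `C (n + 1) ^ C`, for factors that `O*` suppresses. -/
def poly (C n : ℕ) : ℕ := C * (n + 1) ^ C

/-- `|M_l|`, and `1` if there is no minimal square of half-length at most `l` (that is, `l = 0`). -/
noncomputable def numMin (l : ℕ) : ℕ := max 1 (minSquares l).ncard

end SquareCount

open SquareCount

/-!
Call a square short if its half-length is at most `m = ⌊n/k⌋`. If a short square arises when a string
without short squares is extended, so does a minimal one, and the part of it within the old string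
is a prefix of a square in `M_m`. So what may follow a string without short squares depends only on
its longest suffix among these prefixes (`free_append_iff`), and symmetrically for right contexts.
The precomputation puts these prefixes into a trie and tabulates, for every length `g ≤ n` and every
pair of nodes, the number `fill` of strings of length `g` between the two contexts that create no
short square. The trie has `O*(|M_m|)` nodes, which gives `O*(|M_m|^2)` cells, computed by
`fill_succ` in `O*(1)` each.

A batch with half-length `p` says that the string has a prescribed `p`-periodic run on an interval,
that this run has no square of half-length below `p`, and that the two letters next to the run do
not prolong the batch (`Batch.containedIn_iff`). So a set of batches amounts to a set of allowed
letters for each position (`h_eq`). A batch with `p ≤ m` makes the count 0; hence the fixed positions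
form blocks of more than `2m` positions, which no short square can reach over
(`free_append_append_iff`), and only the first and the last letter of a gap between blocks are
constrained. The count is therefore a product (`rest_fixed`, `rest_gap`), in which the factor of a
gap is a sum of at most 9 entries of the table (`gap_one`, `gap_add_two`). This takes polynomial
time: the factor `2^{O(k)}` is not needed.

For `k = 4` two blocks with a gap between them do not fit into `n < 4m + 4` positions, so one of the
two contexts of a gap has length at most 1. By the symmetry `fill_comm` it may be taken to be the
right one, and the table shrinks to `O*(|M_m|)` cells. One pair of programs thus serves both parts.

For the word RAM, strings are numbers in base 3. A Hoare calculus with time bounds (`Does`) derives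
absence of overflow from a bound for the contents of all cells, and time from a bound for the
iterations of each loop.
-/

namespace SquareCount

/-! ### A total-correctness calculus for the word RAM -/

/-- The parameters of a run, with a bound `N` on the number of iterations of the innermost loops
and a bound `B` on the contents of variables and cells. Expressions of at most 24 nodes over values
below `B` cannot overflow. -/
structure Machine where
  w : ℕ
  A : ℕ
  N : ℕ
  B : ℕ
  inp : List ℕ
  hB : 16 ≤ B
  hw : B ^ 24 ≤ 2 ^ w

/-- The value of an expression, ignoring all bounds. -/
def Exp.val (inp : List ℕ) (σ : State) : Exp → ℕ
  | .const c => c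
  | .var x => σ.var x
  | .get a i => σ.arr a (i.val inp σ)
  | .input i => inp.getD (i.val inp σ) 0
  | .op o e₁ e₂ => o.apply (e₁.val inp σ) (e₂.val inp σ)

/-- All array and input accesses of an expression are within bounds. -/
def Exp.Safe (M : Machine) (σ : State) : Exp → Prop
  | .const c => c < 16
  | .var _ => True
  | .get _ i => i.Safe M σ ∧ i.val M.inp σ < M.A
  | .input i => i.Safe M σ ∧ i.val M.inp σ < M.inp.length ∧ M.inp.getD (i.val M.inp σ) 0 < M.B
  | .op _ e₁ e₂ => e₁.Safe M σ ∧ e₂.Safe M σ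

/-- All variables and array cells are below `B`. -/
structure State.Bd (B : ℕ) (σ : State) : Prop where
  var : ∀ x, σ.var x < B
  arr : ∀ a i, σ.arr a i < B

instance : Add Exp := ⟨.op .add⟩
instance : Sub Exp := ⟨.op .sub⟩
instance : Mul Exp := ⟨.op .mul⟩
instance : Div Exp := ⟨.op .div⟩
instance : Mod Exp := ⟨.op .mod⟩
instance (c : ℕ) : OfNat Exp c := ⟨.const c⟩

infix:50 " ≺ " => Exp.op Op.lt
infix:50 " ≐ " => Exp.op Op.eq
infixr:20 " ;; " => Com.seq
infix:30 " ≔ " => Com.assign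

section
variable (inp : List ℕ) (M : Machine) (σ : State) (e f : Exp) (x a c : ℕ)

@[simp] lemma Exp.val_add : (e + f).val inp σ = e.val inp σ + f.val inp σ := rfl
@[simp] lemma Exp.val_sub : (e - f).val inp σ = e.val inp σ - f.val inp σ := rfl
@[simp] lemma Exp.val_mul : (e * f).val inp σ = e.val inp σ * f.val inp σ := rfl
@[simp] lemma Exp.val_div : (e / f).val inp σ = e.val inp σ / f.val inp σ := rfl
@[simp] lemma Exp.val_mod : (e % f).val inp σ = e.val inp σ % f.val inp σ := rfl
@[simp] lemma Exp.val_ofNat (c : ℕ) [c.AtLeastTwo] :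
    (no_index (OfNat.ofNat c) : Exp).val inp σ = OfNat.ofNat c := rfl
@[simp] lemma Exp.val_zero : (0 : Exp).val inp σ = 0 := rfl
@[simp] lemma Exp.val_one : (1 : Exp).val inp σ = 1 := rfl
@[simp] lemma Exp.val_var : (Exp.var x).val inp σ = σ.var x := rfl
@[simp] lemma Exp.val_get : (Exp.get a e).val inp σ = σ.arr a (e.val inp σ) := rfl
@[simp] lemma Exp.val_input : (Exp.input e).val inp σ = inp.getD (e.val inp σ) 0 := rfl
@[simp] lemma Exp.val_lt :
    (e ≺ f).val inp σ = if e.val inp σ < f.val inp σ then 1 else 0 := rfl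
@[simp] lemma Exp.val_eq :
    (e ≐ f).val inp σ = if e.val inp σ = f.val inp σ then 1 else 0 := rfl

@[simp] lemma Exp.safe_add : (e + f).Safe M σ ↔ e.Safe M σ ∧ f.Safe M σ := Iff.rfl
@[simp] lemma Exp.safe_sub : (e - f).Safe M σ ↔ e.Safe M σ ∧ f.Safe M σ := Iff.rfl
@[simp] lemma Exp.safe_mul : (e * f).Safe M σ ↔ e.Safe M σ ∧ f.Safe M σ := Iff.rfl
@[simp] lemma Exp.safe_div : (e / f).Safe M σ ↔ e.Safe M σ ∧ f.Safe M σ := Iff.rfl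
@[simp] lemma Exp.safe_mod : (e % f).Safe M σ ↔ e.Safe M σ ∧ f.Safe M σ := Iff.rfl
@[simp] lemma Exp.safe_lt : (e ≺ f).Safe M σ ↔ e.Safe M σ ∧ f.Safe M σ := Iff.rfl
@[simp] lemma Exp.safe_eq : (e ≐ f).Safe M σ ↔ e.Safe M σ ∧ f.Safe M σ := Iff.rfl
@[simp] lemma Exp.safe_ofNat (c : ℕ) [c.AtLeastTwo] :
    (no_index (OfNat.ofNat c) : Exp).Safe M σ ↔ OfNat.ofNat c < 16 := Iff.rfl
@[simp] lemma Exp.safe_zero : (0 : Exp).Safe M σ ↔ True := by simp [OfNat.ofNat, Exp.Safe]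
@[simp] lemma Exp.safe_one : (1 : Exp).Safe M σ ↔ True := by simp [OfNat.ofNat, Exp.Safe]
@[simp] lemma Exp.safe_var : (Exp.var x).Safe M σ ↔ True := Iff.rfl
@[simp] lemma Exp.safe_get :
    (Exp.get a e).Safe M σ ↔ e.Safe M σ ∧ e.val M.inp σ < M.A := Iff.rfl
@[simp] lemma Exp.safe_input : (Exp.input e).Safe M σ ↔ e.Safe M σ ∧
    e.val M.inp σ < M.inp.length ∧ M.inp.getD (e.val M.inp σ) 0 < M.B := Iff.rfl

end

@[simp] lemma State.setVar_var (σ : State) (x v y : ℕ) :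
    (σ.setVar x v).var y = if y = x then v else σ.var y := by
  simp [State.setVar, Function.update_apply]

@[simp] lemma State.setVar_arr (σ : State) (x v : ℕ) : (σ.setVar x v).arr = σ.arr := rfl

@[simp] lemma State.setArr_var (σ : State) (a i v : ℕ) : (σ.setArr a i v).var = σ.var := rfl

@[simp] lemma State.setArr_arr (σ : State) (a i v b : ℕ) :
    (σ.setArr a i v).arr b = if b = a then Function.update (σ.arr a) i v else σ.arr b := by
  simp [State.setArr, Function.update_apply]

lemma State.Bd.setVar {B : ℕ} {σ : State} (h : σ.Bd B) (x : ℕ) {v : ℕ} (hv : v < B) :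
    (σ.setVar x v).Bd B :=
  ⟨fun y => by simp only [State.setVar_var]; split_ifs; exacts [hv, h.var y], h.arr⟩

lemma State.Bd.setArr {B : ℕ} {σ : State} (h : σ.Bd B) (a i : ℕ) {v : ℕ} (hv : v < B) :
    (σ.setArr a i v).Bd B := by
  refine ⟨h.var, fun b j => ?_⟩
  simp only [State.setArr_arr]
  split_ifs with h1
  · rw [Function.update_apply]; split_ifs; exacts [hv, h.arr a j]
  · exact h.arr b j

lemma Op.apply_lt {B s t x y : ℕ} (hB : 16 ≤ B) (hx : x < B ^ s) (hy : y < B ^ t) (o : Op) :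
    o.apply x y < B ^ (s + t + 1) := by
  have hB1 : 1 ≤ B := by omega
  have h1 : B ^ s ≤ B ^ (s + t) := Nat.pow_le_pow_right hB1 (by omega)
  have h2 : B ^ t ≤ B ^ (s + t) := Nat.pow_le_pow_right hB1 (by omega)
  have h3 : 16 * B ^ (s + t) ≤ B ^ (s + t + 1) := by
    rw [pow_succ, Nat.mul_comm]; exact Nat.mul_le_mul_left _ hB
  have h4 : 1 ≤ B ^ (s + t) := Nat.one_le_pow _ _ hB1
  cases o <;> simp only [Op.apply]
  · omega
  · omega
  · have : x * y < B ^ s * B ^ t := Nat.mul_lt_mul'' hx hy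
    rw [← pow_add] at this; omega
  · exact lt_of_le_of_lt (Nat.div_le_self _ _) (by omega)
  · exact lt_of_le_of_lt (Nat.mod_le _ _) (by omega)
  · split_ifs <;> omega
  · split_ifs <;> omega

/-- An expression with at most 24 nodes whose accesses are within bounds evaluates without
overflow, as each node multiplies the exponent of the bound `B` at most by the size. -/
lemma Exp.eval_of_safe (M : Machine) {σ : State} (hσ : σ.Bd M.B) (e : Exp) (hc : e.cost ≤ 24)
    (hs : e.Safe M σ) :
    e.eval M.w M.A M.inp σ = some (e.val M.inp σ) ∧ e.val M.inp σ < M.B ^ e.cost := by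
  have hB := M.hB
  have hw : ∀ d, d ≤ 24 → ∀ v, v < M.B ^ d → word M.w v = some v := by
    intro d hd v hv
    have : M.B ^ d ≤ M.B ^ 24 := Nat.pow_le_pow_right (by omega) hd
    have := M.hw
    simp only [word]; rw [if_pos (by omega)]
  have hpow : ∀ v d, v < M.B → 1 ≤ d → v < M.B ^ d := fun v d h1 h2 =>
    lt_of_lt_of_le h1 (Nat.le_self_pow (by omega) _)
  induction e with
  | const c =>
    simp only [Exp.Safe] at hs
    exact ⟨hw 1 (by norm_num) _ (by simp only [pow_one]; omega),
      by simp only [Exp.cost, Exp.val, pow_one]; omega⟩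
  | var x =>
    exact ⟨hw 1 (by norm_num) _ (by simpa using hσ.var x), by simpa [Exp.cost] using hσ.var x⟩
  | get a i ih =>
    simp only [Exp.cost] at hc
    obtain ⟨h1, h2⟩ := ih (by omega) hs.1
    refine ⟨?_, hpow _ _ (hσ.arr _ _) (by simp [Exp.cost])⟩
    simp only [Exp.eval, h1, Option.bind_some, hs.2, if_true, Exp.val]
    exact hw 1 (by norm_num) _ (by simpa using hσ.arr _ _)
  | input i ih =>
    simp only [Exp.cost] at hc
    obtain ⟨h1, h2⟩ := ih (by omega) hs.1
    refine ⟨?_, hpow _ _ hs.2.2 (by simp [Exp.cost])⟩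
    have h3 : M.inp[i.val M.inp σ]? = some (M.inp.getD (i.val M.inp σ) 0) := by
      have hs' := hs.2.1
      simp [List.getElem?_eq_getElem hs']
    simp only [Exp.eval, h1, Option.bind_some, Exp.val, h3]
    exact hw 1 (by norm_num) _ (by simpa using hs.2.2)
  | op o e₁ e₂ ih₁ ih₂ =>
    simp only [Exp.cost] at hc
    obtain ⟨h1, h2⟩ := ih₁ (by omega) hs.1
    obtain ⟨h3, h4⟩ := ih₂ (by omega) hs.2
    have h5 := Op.apply_lt hB h2 h4 o
    refine ⟨?_, h5⟩
    simp only [Exp.eval, h1, h3, Option.bind_some, Exp.val]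
    exact hw _ hc _ h5

/-- All expressions of a program have at most 24 nodes. -/
def Com.wf : Com → Bool
  | .skip => true
  | .assign _ e => e.cost ≤ 24
  | .store _ i e => i.cost ≤ 24 && e.cost ≤ 24
  | .seq c₁ c₂ => c₁.wf && c₂.wf
  | .ite e c₁ c₂ => e.cost ≤ 24 && c₁.wf && c₂.wf
  | .while e c => e.cost ≤ 24 && c.wf

/-- The variables a program assigns to. -/
def Com.wv : Com → List ℕ
  | .skip => []
  | .assign x _ => [x]
  | .store _ _ _ => []
  | .seq c₁ c₂ => c₁.wv ++ c₂.wv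
  | .ite _ c₁ c₂ => c₁.wv ++ c₂.wv
  | .while _ c => c.wv

/-- The arrays a program writes to. -/
def Com.wa : Com → List ℕ
  | .skip => []
  | .assign _ _ => []
  | .store a _ _ => [a]
  | .seq c₁ c₂ => c₁.wa ++ c₂.wa
  | .ite _ c₁ c₂ => c₁.wa ++ c₂.wa
  | .while _ c => c.wa

/-- The time of a program each of whose loops is iterated at most `N` times when entered. -/
def Com.tb (N : ℕ) : Com → ℕ
  | .skip => 1
  | .assign _ e => e.cost + 1
  | .store _ i e => i.cost + e.cost + 1
  | .seq c₁ c₂ => c₁.tb N + c₂.tb N + 1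
  | .ite e c₁ c₂ => e.cost + (c₁.tb N + c₂.tb N) + 1
  | .while e c => N * (e.cost + c.tb N + 1) + e.cost + 1

/-- `τ` agrees with `σ` except for the variables and arrays that `c` writes to. -/
structure Frame (c : Com) (σ τ : State) : Prop where
  var : ∀ x, x ∉ c.wv → τ.var x = σ.var x
  arr : ∀ a, a ∉ c.wa → τ.arr a = σ.arr a

lemma Frame.refl (c : Com) (σ : State) : Frame c σ σ := ⟨fun _ _ => rfl, fun _ _ => rfl⟩

lemma Frame.trans {c : Com} {σ τ ρ : State} (h₁ : Frame c σ τ) (h₂ : Frame c τ ρ) :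
    Frame c σ ρ :=
  ⟨fun x hx => (h₂.var x hx).trans (h₁.var x hx), fun a ha => (h₂.arr a ha).trans (h₁.arr a ha)⟩

lemma Frame.mono {c c' : Com} {σ τ : State} (h : Frame c σ τ) (hv : c.wv ⊆ c'.wv)
    (ha : c.wa ⊆ c'.wa) : Frame c' σ τ :=
  ⟨fun x hx => h.var x fun h' => hx (hv h'), fun a hx => h.arr a fun h' => hx (ha h')⟩

lemma Exec.frame {w A : ℕ} {inp : List ℕ} {c : Com} {σ τ : State} {t : ℕ}
    (h : Exec w A inp c σ τ t) : Frame c σ τ := by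
  induction h with
  | skip => exact .refl _ _
  | assign σ x e v he =>
    exact ⟨fun y hy => by simp_all [Com.wv], fun _ _ => rfl⟩
  | store σ a i e j v hi hj he =>
    exact ⟨fun _ _ => rfl, fun b hb => by simp_all [Com.wa]⟩
  | seq σ₁ σ₂ σ₃ c₁ c₂ t₁ t₂ h₁ h₂ ih₁ ih₂ =>
    exact (ih₁.mono (by simp [Com.wv]) (by simp [Com.wa])).trans
      (ih₂.mono (by simp [Com.wv]) (by simp [Com.wa]))
  | ite_true σ τ e c₁ c₂ v t he hv hc ih => exact ih.mono (by simp [Com.wv]) (by simp [Com.wa])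
  | ite_false σ τ e c₁ c₂ t he hc ih => exact ih.mono (by simp [Com.wv]) (by simp [Com.wa])
  | while_true σ₁ σ₂ σ₃ e c v t₁ t₂ he hv h₁ h₂ ih₁ ih₂ =>
    exact (ih₁.mono (by simp [Com.wv]) (by simp [Com.wa])).trans ih₂
  | while_false => exact .refl _ _

/-- Started in `σ`, the program `c` halts within `T` steps in a state with `Q`; this may presuppose
that all contents of `σ` are below the bound of the machine, which is maintained. -/
def Runs (M : Machine) (c : Com) (σ : State) (T : ℕ) (Q : State → Prop) : Prop :=
  c.wf = true → σ.Bd M.B →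
    ∃ τ t, Exec M.w M.A M.inp c σ τ t ∧ t ≤ T ∧ τ.Bd M.B ∧ Q τ

/-- `Runs` with the time for loops of at most `M.N` iterations each. -/
def Does (M : Machine) (c : Com) (σ : State) (Q : State → Prop) : Prop :=
  Runs M c σ (c.tb M.N) Q

section Rules
variable {M : Machine} {c c₁ c₂ : Com} {σ : State} {T T₁ T₂ : ℕ} {P Q : State → Prop} {e : Exp}

lemma Runs.mono (h : Runs M c σ T P) (hT : T ≤ T₁) (hQ : ∀ τ, Frame c σ τ → P τ → Q τ) :
    Runs M c σ T₁ Q := by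
  intro hw hσ
  obtain ⟨τ, t, h1, h2, h3, h4⟩ := h hw hσ
  exact ⟨τ, t, h1, h2.trans hT, h3, hQ τ h1.frame h4⟩

lemma Does.mono (h : Does M c σ P) (hQ : ∀ τ, Frame c σ τ → P τ → Q τ) : Does M c σ Q :=
  Runs.mono h le_rfl hQ

lemma Does.skip (h : Q σ) : Does M .skip σ Q :=
  fun _ hσ => ⟨σ, 1, .skip σ, le_rfl, hσ, h⟩

lemma Does.assign_of_eval {x v : ℕ} (he : e.eval M.w M.A M.inp σ = some v) (hv : v < M.B)
    (h : Q (σ.setVar x v)) : Does M (x ≔ e) σ Q :=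
  fun _ hσ => ⟨_, _, .assign σ x e v he, le_rfl, hσ.setVar x hv, h⟩

lemma Does.assign {x : ℕ} (hs : e.Safe M σ) (hv : e.val M.inp σ < M.B)
    (h : Q (σ.setVar x (e.val M.inp σ))) : Does M (x ≔ e) σ Q :=
  fun hw hσ => Does.assign_of_eval (e.eval_of_safe M hσ (by simpa [Com.wf] using hw) hs).1 hv h hw hσ

lemma Does.store {a : ℕ} {i : Exp} (hi : i.Safe M σ) (hA : i.val M.inp σ < M.A)
    (hs : e.Safe M σ) (hv : e.val M.inp σ < M.B)
    (h : Q (σ.setArr a (i.val M.inp σ) (e.val M.inp σ))) : Does M (.store a i e) σ Q := by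
  intro hw hσ
  simp only [Com.wf, Bool.and_eq_true, decide_eq_true_eq] at hw
  exact ⟨_, _, .store σ a i e _ _ (i.eval_of_safe M hσ hw.1 hi).1 hA
    (e.eval_of_safe M hσ hw.2 hs).1, le_rfl, hσ.setArr _ _ hv, h⟩

lemma Runs.seq (h₁ : Runs M c₁ σ T₁ P) (h₂ : ∀ τ, Frame c₁ σ τ → P τ → Runs M c₂ τ T₂ Q) :
    Runs M (c₁ ;; c₂) σ (T₁ + T₂ + 1) Q := by
  intro hw hσ
  simp only [Com.wf, Bool.and_eq_true] at hw
  obtain ⟨τ, t, h1, h2, h3, h4⟩ := h₁ hw.1 hσ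
  obtain ⟨ρ, u, h5, h6, h7, h8⟩ := h₂ τ h1.frame h4 hw.2 h3
  exact ⟨ρ, t + u + 1, .seq _ _ _ _ _ _ _ h1 h5, by omega, h7, h8⟩

lemma Does.seq (h₁ : Does M c₁ σ P) (h₂ : ∀ τ, Frame c₁ σ τ → P τ → Does M c₂ τ Q) :
    Does M (c₁ ;; c₂) σ Q :=
  Runs.seq h₁ h₂

lemma Does.assign_seq {x : ℕ} (hs : e.Safe M σ) (hv : e.val M.inp σ < M.B)
    (h : Does M c (σ.setVar x (e.val M.inp σ)) Q) : Does M (x ≔ e ;; c) σ Q :=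
  Does.seq (P := fun τ => τ = σ.setVar x (e.val M.inp σ)) (.assign hs hv rfl)
    (by rintro _ - rfl; exact h)

lemma Does.store_seq {a : ℕ} {i : Exp} (hi : i.Safe M σ) (hA : i.val M.inp σ < M.A)
    (hs : e.Safe M σ) (hv : e.val M.inp σ < M.B)
    (h : Does M c (σ.setArr a (i.val M.inp σ) (e.val M.inp σ)) Q) :
    Does M (.store a i e ;; c) σ Q :=
  Does.seq (P := fun τ => τ = σ.setArr a (i.val M.inp σ) (e.val M.inp σ))
    (.store hi hA hs hv rfl) (by rintro _ - rfl; exact h)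

lemma Does.ite (hs : e.Safe M σ) (h₁ : e.val M.inp σ ≠ 0 → Does M c₁ σ Q)
    (h₂ : e.val M.inp σ = 0 → Does M c₂ σ Q) : Does M (.ite e c₁ c₂) σ Q := by
  intro hw hσ
  simp only [Com.wf, Bool.and_eq_true, decide_eq_true_eq] at hw
  have he := (e.eval_of_safe M hσ hw.1.1 hs).1
  by_cases h : e.val M.inp σ = 0
  · obtain ⟨τ, t, h1, h2, h3⟩ := h₂ h hw.2 hσ
    exact ⟨τ, _, .ite_false _ _ _ _ _ _ (h ▸ he) h1, by simp only [Com.tb]; omega, h3⟩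
  · obtain ⟨τ, t, h1, h2, h3⟩ := h₁ h hw.1.2 hσ
    exact ⟨τ, _, .ite_true _ _ _ _ _ _ _ he h h1, by simp only [Com.tb]; omega, h3⟩

/-- A loop with an invariant that counts the iterations, of which there are at most `K`. -/
lemma Runs.while {K : ℕ} (I : ℕ → State → Prop)
    (hs : ∀ j τ, Frame c σ τ → I j τ → e.Safe M τ)
    (hc : ∀ j τ, Frame c σ τ → I j τ → e.val M.inp τ ≠ 0 → j < K ∧ Runs M c τ T (I (j + 1)))
    (hQ : ∀ j τ, Frame c σ τ → I j τ → e.val M.inp τ = 0 → Q τ) (h0 : I 0 σ) :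
    Runs M (.while e c) σ (K * (e.cost + T + 1) + e.cost + 1) Q := by
  intro hw hσ
  simp only [Com.wf, Bool.and_eq_true, decide_eq_true_eq] at hw
  suffices H : ∀ r j τ, j + r = K + 1 → Frame c σ τ → τ.Bd M.B → I j τ → j ≤ K →
      ∃ ρ t, Exec M.w M.A M.inp (.while e c) τ ρ t ∧ t ≤ (K - j) * (e.cost + T + 1) + e.cost + 1 ∧
        ρ.Bd M.B ∧ Q ρ by
    simpa using H (K + 1) 0 σ (by omega) (.refl _ _) hσ h0 (by omega)
  intro r
  induction r with
  | zero => intros; omega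
  | succ r ih =>
    intro j τ hr hf hb hI hj
    have he := (e.eval_of_safe M hb hw.1 (hs j τ hf hI)).1
    by_cases h : e.val M.inp τ = 0
    · exact ⟨τ, _, .while_false _ _ _ (h ▸ he), by omega, hb, hQ j τ hf hI h⟩
    · obtain ⟨h1, h2⟩ := hc j τ hf hI h
      obtain ⟨ρ, t, h3, h4, h5, h6⟩ := h2 hw.2 hb
      obtain ⟨ρ', t', h7, h8, h9, h10⟩ := ih (j + 1) ρ (by omega) (hf.trans h3.frame) h5 h6 (by omega)
      refine ⟨ρ', _, .while_true _ _ _ _ _ _ _ _ he h h3 h7, ?_, h9, h10⟩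
      obtain ⟨d, hd⟩ : ∃ d, K - j = d + 1 := ⟨K - j - 1, by omega⟩
      have : K - (j + 1) = d := by omega
      rw [this] at h8; rw [hd, Nat.add_mul]; omega

lemma Does.while (I : ℕ → State → Prop)
    (hs : ∀ j τ, Frame c σ τ → I j τ → e.Safe M τ)
    (hc : ∀ j τ, Frame c σ τ → I j τ → e.val M.inp τ ≠ 0 → j < M.N ∧ Does M c τ (I (j + 1)))
    (hQ : ∀ j τ, Frame c σ τ → I j τ → e.val M.inp τ = 0 → Q τ) (h0 : I 0 σ) :
    Does M (.while e c) σ Q :=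
  Runs.while I hs hc hQ h0

end Rules

/-- `for i < e do c`; the program `c` must neither assign to `i` nor change the value of `e`. -/
def Com.for (i : ℕ) (e : Exp) (c : Com) : Com :=
  i ≔ 0 ;; .while (.var i ≺ e) (c ;; i ≔ .var i + 1)

section For
variable {M : Machine} {c : Com} {σ : State} {T : ℕ} {Q : State → Prop} {e : Exp} {i : ℕ}

lemma Com.for_wv : (Com.for i e c).wv = i :: (c.wv ++ [i]) := rfl
lemma Com.for_wa : (Com.for i e c).wa = c.wa ++ [] := by simp [Com.for, Com.wa]

lemma Runs.for {K : ℕ} (I : ℕ → State → Prop) (hi : i ∉ c.wv) (hK : K < M.B)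
    (hs : ∀ j τ, Frame (.for i e c) σ τ → τ.var i = j → I j τ → e.Safe M τ ∧ e.val M.inp τ = K)
    (hc : ∀ j τ, j < K → Frame (.for i e c) σ τ → τ.var i = j → I j τ →
      Runs M c τ T (fun ρ => ∀ v, I (j + 1) (ρ.setVar i v)))
    (hQ : ∀ τ, Frame (.for i e c) σ τ → I K τ → Q τ) (h0 : I 0 (σ.setVar i 0)) :
    Runs M (.for i e c) σ (2 + (K * (e.cost + T + 8) + (e.cost + 3)) + 1) Q := by
  have hB := M.hB
  have hfr : ∀ τ, Frame (c ;; i ≔ .var i + 1) (σ.setVar i 0) τ → Frame (.for i e c) σ τ :=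
    fun τ h => ⟨fun x hx => by
      rw [h.var x (by simp_all [Com.for_wv, Com.wv])]; simp_all [Com.for_wv],
      fun a ha => by rw [h.arr a (by simpa [Com.for_wa, Com.wa] using ha)]; simp⟩
  refine Runs.seq (P := fun τ => τ = σ.setVar i 0)
    (Does.assign (by simp) (by simp; omega) (by simp)) ?_
  rintro _ - rfl
  refine Runs.mono (Runs.while (K := K) (T := T + 5) (Q := Q)
    (fun j τ => τ.var i = j ∧ j ≤ K ∧ I j τ) ?_ ?_ ?_ ?_) ?_ (fun _ _ h => h)
  · rintro j τ hf ⟨h1, h2, h3⟩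
    simpa using (hs j τ (hfr _ hf) h1 h3).1
  · rintro j τ hf ⟨h1, h2, h3⟩ h
    have hKe := (hs j τ (hfr _ hf) h1 h3).2
    have hj : j < K := by
      by_contra hj; simp [h1, hKe, hj] at h
    refine ⟨hj, Runs.mono (Runs.seq (hc j τ hj (hfr _ hf) h1 h3)
      (T₂ := 4) (Q := fun ρ => ρ.var i = j + 1 ∧ j + 1 ≤ K ∧ I (j + 1) ρ) ?_) (by omega)
      (fun _ _ h => h)⟩
    intro ρ hfρ hI
    have h4 : ρ.var i = j := by rw [hfρ.var i hi, h1]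
    exact Does.assign (by simp) (by simp [h4]; omega) (by simp [h4, hI]; omega)
  · rintro j τ hf ⟨h1, h2, h3⟩ h
    have hKe := (hs j τ (hfr _ hf) h1 h3).2
    have hj : j = K := by
      by_contra hj
      have : j < K := by omega
      simp [h1, hKe, this] at h
    subst hj
    exact hQ τ (hfr _ hf) h3
  · exact ⟨by simp, by omega, h0⟩
  · have : (Exp.var i ≺ e).cost = e.cost + 2 := by simp [Exp.cost]; omega
    rw [this]
    have : e.cost + 2 + (T + 5) + 1 = e.cost + T + 8 := by omega
    rw [this]; omega

lemma Does.for {K : ℕ} (I : ℕ → State → Prop) (hi : i ∉ c.wv) (hK : K < M.B) (hN : K ≤ M.N)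
    (hs : ∀ j τ, Frame (.for i e c) σ τ → τ.var i = j → I j τ → e.Safe M τ ∧ e.val M.inp τ = K)
    (hc : ∀ j τ, j < K → Frame (.for i e c) σ τ → τ.var i = j → I j τ →
      Does M c τ (fun ρ => ∀ v, I (j + 1) (ρ.setVar i v)))
    (hQ : ∀ τ, Frame (.for i e c) σ τ → I K τ → Q τ) (h0 : I 0 (σ.setVar i 0)) :
    Does M (.for i e c) σ Q := by
  refine Runs.mono (Runs.for I hi hK hs hc hQ h0) ?_ (fun _ _ h => h)
  have h1 : (Com.for i e c).tb M.N = 2 + (M.N * (e.cost + c.tb M.N + 8) + (e.cost + 3)) + 1 := by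
    have h2 : (Exp.var i ≺ e).cost = e.cost + 2 := by simp [Exp.cost]; omega
    have h3 : (0 : Exp).cost = 1 := rfl
    have h4 : (Exp.var i + 1).cost = 3 := rfl
    simp only [Com.for, Com.tb, h2, h3, h4]
    have : e.cost + 2 + (c.tb M.N + (3 + 1) + 1) + 1 = e.cost + c.tb M.N + 8 := by omega
    rw [this]; omega
  rw [h1]
  have := Nat.mul_le_mul_right (e.cost + c.tb M.N + 8) hN
  omega

end For

/-! ### Strings as numbers -/

/-- The number with the base-3 digits `s`, least significant digit first. -/
def num : Str → ℕ
  | [] => 0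
  | a :: s => a.val + 3 * num s

@[simp] lemma num_nil : num [] = 0 := rfl

lemma num_cons (a : Fin 3) (s : Str) : num (a :: s) = a.val + 3 * num s := rfl

lemma num_append (s t : Str) : num (s ++ t) = num s + num t * 3 ^ s.length := by
  induction s with
  | nil => simp
  | cons a s ih => simp only [List.cons_append, num_cons, ih, List.length_cons, pow_succ]; ring

lemma num_concat (s : Str) (a : Fin 3) : num (s ++ [a]) = num s + a.val * 3 ^ s.length := by
  simp [num_append, num_cons]

lemma num_lt (s : Str) : num s < 3 ^ s.length := by
  induction s with
  | nil => simp
  | cons a s ih => simp only [num_cons, List.length_cons, pow_succ]; omega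

lemma num_lt_of_le {s : Str} {l : ℕ} (h : s.length ≤ l) : num s < 3 ^ l :=
  (num_lt s).trans_le (Nat.pow_le_pow_right (by norm_num) h)

lemma num_drop (s : Str) (i : ℕ) : num (s.drop i) = num s / 3 ^ i := by
  induction i generalizing s with
  | zero => simp
  | succ i ih =>
    cases s with
    | nil => simp
    | cons a s =>
      rw [List.drop_succ_cons, ih, num_cons, pow_succ', ← Nat.div_div_eq_div_mul]
      congr 1; omega

lemma num_take (s : Str) (i : ℕ) : num (s.take i) = num s % 3 ^ i := by
  by_cases h : s.length ≤ i
  · rw [List.take_of_length_le h, Nat.mod_eq_of_lt (num_lt_of_le h)]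
  · conv_rhs => rw [← List.take_append_drop i s, num_append]
    have : (s.take i).length = i := by simp; omega
    rw [this, Nat.add_mul_mod_self_right, Nat.mod_eq_of_lt (num_lt_of_le this.le)]

lemma num_inj {s t : Str} (hl : s.length = t.length) (h : num s = num t) : s = t := by
  induction s generalizing t with
  | nil => cases t <;> simp_all
  | cons a s ih =>
    cases t with
    | nil => simp at hl
    | cons b t =>
      simp only [num_cons] at h
      have h1 : a = b := by ext; omega
      have h2 := ih (by simpa using hl) (t := t) (by omega)
      rw [h1, h2]

lemma num_slice_eq_iff {s : Str} {i j p : ℕ} (hi : i + p ≤ s.length) (hj : j + p ≤ s.length) :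
    num s / 3 ^ i % 3 ^ p = num s / 3 ^ j % 3 ^ p ↔ (s.drop i).take p = (s.drop j).take p := by
  rw [← num_drop, ← num_drop, ← num_take, ← num_take]
  exact ⟨num_inj (by simp; omega), fun h => by rw [h]⟩

lemma num_digit (s : Str) {i : ℕ} : num s / 3 ^ i % 3 = (s.getD i 0).val := by
  rw [← num_drop]
  by_cases h : i < s.length
  · rw [List.drop_eq_getElem_cons h, num_cons, List.getD_eq_getElem _ _ h]; omega
  · rw [List.drop_eq_nil_of_le (by omega), List.getD_eq_default _ _ (by omega)]; simp

/-! ### Strings without short squares -/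

/-- No square of half-length at most `m` is a substring of `s`. -/
def Free (m : ℕ) (s : Str) : Prop := ∀ w : Str, w ≠ [] → w.length ≤ m → ¬ w ++ w <:+: s

lemma kPromising_iff {n k : ℕ} {s : Str} : KPromising n k s ↔ Free (n / k) s := by
  constructor
  · intro h w hw hl hi
    exact h _ hi ⟨w, hw, rfl, hl⟩
  · rintro h _ hi ⟨w, hw, rfl, hl⟩
    exact h w hw hl hi

lemma Free.infix {m : ℕ} {s t : Str} (h : Free m s) (ht : t <:+: s) : Free m t :=
  fun w hw hl hi => h w hw hl (hi.trans ht)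

lemma free_nil (m : ℕ) : Free m [] := by
  intro w hw _ h; simp_all

lemma Free.reverse {m : ℕ} {s : Str} (h : Free m s) : Free m s.reverse := by
  intro w hw hl hi
  refine h w.reverse (by simpa) (by simpa) ?_
  rw [← List.reverse_append, ← List.reverse_infix]
  simpa using hi

lemma free_reverse {m : ℕ} {s : Str} : Free m s.reverse ↔ Free m s :=
  ⟨fun h => by simpa using h.reverse, Free.reverse⟩

lemma append_self_infix_iff {w s : Str} : w ++ w <:+: s ↔
    ∃ i, i + 2 * w.length ≤ s.length ∧ (s.drop i).take w.length = w ∧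
      (s.drop (i + w.length)).take w.length = w := by
  constructor
  · rintro ⟨a, b, rfl⟩
    refine ⟨a.length, by simp; omega, ?_, ?_⟩
    · simp
    · rw [← List.drop_drop]; simp
  · rintro ⟨i, hi, h1, h2⟩
    refine ⟨s.take i, s.drop (i + w.length + w.length), ?_⟩
    rw [← List.drop_drop, ← List.drop_drop, List.append_assoc, List.append_assoc]
    rw [← List.drop_drop] at h2
    nth_rw 2 [← h2]
    rw [List.take_append_drop]
    nth_rw 1 [← h1]
    rw [List.take_append_drop, List.take_append_drop]

lemma free_iff_slices {m : ℕ} {s : Str} : Free m s ↔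
    ∀ p < m, ∀ i < s.length - (2 * p + 1),
      (s.drop i).take (p + 1) ≠ (s.drop (i + (p + 1))).take (p + 1) := by
  constructor
  · intro h p hp i hi heq
    have hl : ((s.drop i).take (p + 1)).length = p + 1 := by simp; omega
    refine h ((s.drop i).take (p + 1)) (by rw [← List.length_pos_iff]; omega) (by omega) ?_
    rw [append_self_infix_iff]
    exact ⟨i, by omega, by rw [hl], by rw [hl, heq]⟩
  · intro h w hw hl hi
    obtain ⟨i, h1, h2, h3⟩ := append_self_infix_iff.1 hi
    have := List.length_pos_iff.2 hw
    refine h (w.length - 1) (by omega) i (by omega) ?_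
    rw [show w.length - 1 + 1 = w.length by omega, h2, h3]

lemma exists_minSquares_of_not_free {m : ℕ} {s : Str} (h : ¬ Free m s) :
    ∃ t ∈ minSquares m, t <:+: s := by
  have H : ∃ l, ∃ t : Str, t.length = l ∧ Square t ∧ t <:+: s := by
    simp only [Free, not_forall, not_not] at h
    obtain ⟨w, hw, _, h3⟩ := h
    exact ⟨_, _, rfl, ⟨w, hw, rfl⟩, h3⟩
  classical
  obtain ⟨t, h1, h2, h3⟩ := Nat.find_spec H
  refine ⟨t, ⟨⟨h2, fun t' ht' hs hl => ?_⟩, ?_⟩, h3⟩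
  · exact Nat.find_min H (h1 ▸ hl) ⟨t', rfl, hs, ht'.trans h3⟩
  · simp only [Free, not_forall, not_not] at h
    obtain ⟨w, hw, h4, h5⟩ := h
    rw [h1]
    exact (Nat.find_min' H ⟨w ++ w, rfl, ⟨w, hw, rfl⟩, h5⟩).trans (by simp; omega)

lemma not_free_of_minSquares {m : ℕ} {s t : Str} (ht : t ∈ minSquares m) (h : t <:+: s) :
    ¬ Free m s := by
  obtain ⟨⟨⟨w, hw, rfl⟩, _⟩, hl⟩ := ht
  exact fun hf => hf w hw (by simp at hl; omega) h

/-- A square of half-length `p` is minimal iff it has no square of half-length below `p`. -/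
lemma minimalSquare_iff {p : ℕ} {s : Str} (hp : 1 ≤ p) (hl : s.length = 2 * p) :
    MinimalSquare s ↔ s.take p = s.drop p ∧ Free (p - 1) s := by
  constructor
  · rintro ⟨⟨w, hw, rfl⟩, h⟩
    have hwl : w.length = p := by simp at hl; omega
    refine ⟨by simp [← hwl], fun v hv hvl hi => h _ hi ⟨v, hv, rfl⟩ ?_⟩
    simp; omega
  · rintro ⟨h1, h2⟩
    refine ⟨⟨s.take p, ?_, ?_⟩, ?_⟩
    · rw [← List.length_pos_iff]; simp; omega
    · conv_lhs => rw [← List.take_append_drop p s, ← h1]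
    · rintro _ hi ⟨w, hw, rfl⟩ hl'
      exact h2 w hw (by simp at hl'; omega) hi

/-- The set `P` contains all prefixes of minimal squares of half-length at most `m`. -/
def CoversPrefixes (m : ℕ) (P : Str → Prop) : Prop := ∀ t ∈ minSquares m, ∀ s, s <+: t → P s

/-- `u'` is the longest suffix of `u` with the property `P`. -/
structure LongestSuffix (P : Str → Prop) (u u' : Str) : Prop where
  mem : P u'
  suffix : u' <:+ u
  max : ∀ s, P s → s <:+ u → s.length ≤ u'.length

/-- A square that starts within the left context `u` starts within the longest suffix of `u` that
is a prefix of some minimal square. -/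
lemma free_append_iff {m : ℕ} {P : Str → Prop} (hP : CoversPrefixes m P) {u u' y : Str}
    (hu : Free m u) (h : LongestSuffix P u u') : Free m (u ++ y) ↔ Free m (u' ++ y) := by
  constructor
  · intro hf
    obtain ⟨a, rfl⟩ := h.suffix
    exact hf.infix ⟨a, [], by simp⟩
  · intro hf
    by_contra hn
    obtain ⟨t, ht, hi⟩ := exists_minSquares_of_not_free hn
    rw [List.infix_append_iff] at hi
    rcases hi with hi | hi | ⟨a, b, rfl, h1, h2⟩
    · exact not_free_of_minSquares ht hi hu
    · exact not_free_of_minSquares ht (hi.trans ⟨u', [], by simp⟩) hf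
    · have h3 := h.max a (hP _ ht _ ⟨b, rfl⟩) h1
      obtain ⟨c, rfl⟩ := List.suffix_of_suffix_length_le h1 h.suffix h3
      obtain ⟨d, rfl⟩ := h2
      exact not_free_of_minSquares ht ⟨c, d, by simp⟩ hf

lemma free_append_reverse_iff {m : ℕ} {P : Str → Prop} (hP : CoversPrefixes m P) {r r' y : Str}
    (hu : Free m r) (h : LongestSuffix P r r') :
    Free m (y ++ r.reverse) ↔ Free m (y ++ r'.reverse) := by
  rw [← free_reverse (s := y ++ r.reverse), ← free_reverse (s := y ++ r'.reverse)]
  simpa using free_append_iff hP (y := y.reverse) hu h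

/-- A short square cannot reach over a block of twice its maximal half-length. -/
lemma free_append_append_iff {m : ℕ} {x v y : Str} (hv : 2 * m ≤ v.length) :
    Free m (x ++ v ++ y) ↔ Free m (x ++ v) ∧ Free m (v ++ y) := by
  constructor
  · exact fun h => ⟨h.infix ⟨[], y, by simp⟩, h.infix ⟨x, [], by simp⟩⟩
  · rintro ⟨h1, h2⟩ w hw hl hi
    rw [List.append_assoc, List.infix_append_iff] at hi
    rcases hi with hi | hi | ⟨a, b, hab, h3, h4⟩
    · exact h1 w hw hl (hi.trans ⟨[], v, by simp⟩)
    · exact h2 w hw hl hi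
    · have hb : b.length ≤ v.length := by
        have := congrArg List.length hab
        simp at this; omega
      have h5 : b <+: v := List.prefix_of_prefix_length_le h4 (List.prefix_append v y) hb
      obtain ⟨c, rfl⟩ := h3
      obtain ⟨d, rfl⟩ := h5
      refine h1 w hw hl ⟨c, d, ?_⟩
      rw [hab]; simp

/-! ### Counting strings -/

open Classical in
/-- The indicator of a proposition. -/
noncomputable def ind (p : Prop) : ℕ := if p then 1 else 0

lemma ind_true {p : Prop} (h : p) : ind p = 1 := by simp [ind, h]
lemma ind_false {p : Prop} (h : ¬ p) : ind p = 0 := by simp [ind, h]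
lemma ind_le (p : Prop) : ind p ≤ 1 := by unfold ind; split_ifs <;> omega
lemma ind_congr {p q : Prop} (h : p ↔ q) : ind p = ind q := by rw [propext h]
lemma ind_and (p q : Prop) : ind (p ∧ q) = ind p * ind q := by
  by_cases hp : p <;> by_cases hq : q <;> simp [ind, hp, hq]
@[simp] lemma ind_eq_zero {p : Prop} : ind p = 0 ↔ ¬ p := by
  by_cases hp : p <;> simp [ind, hp]

/-- The number of strings of length `g` with the property `p`. -/
noncomputable def count : ℕ → (Str → Prop) → ℕ
  | 0, p => ind (p [])
  | g + 1, p => ∑ a : Fin 3, count g fun x => p (a :: x)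

lemma count_congr {g : ℕ} {p q : Str → Prop} (h : ∀ x, x.length = g → (p x ↔ q x)) :
    count g p = count g q := by
  induction g generalizing p q with
  | zero => exact ind_congr (h [] rfl)
  | succ g ih => exact Finset.sum_congr rfl fun a _ => ih fun x hx => h _ (by simp [hx])

lemma count_false (g : ℕ) {p : Str → Prop} (h : ∀ x, x.length = g → ¬ p x) : count g p = 0 := by
  induction g generalizing p with
  | zero => exact ind_false (h [] rfl)
  | succ g ih => exact Finset.sum_eq_zero fun a _ => ih fun x hx => h _ (by simp [hx])

lemma count_and_left (g : ℕ) (c : Prop) (p : Str → Prop) :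
    count g (fun x => c ∧ p x) = ind c * count g p := by
  by_cases hc : c
  · simp [hc, ind]
  · rw [count_false _ (by simp [hc])]; simp [hc, ind]

lemma count_le (g : ℕ) (p : Str → Prop) : count g p ≤ 3 ^ g := by
  induction g generalizing p with
  | zero => simpa [count] using ind_le _
  | succ g ih =>
    refine (Finset.sum_le_sum fun a _ => ih _).trans ?_
    simp [pow_succ, mul_comm]

lemma count_append (g g' : ℕ) (p q : Str → Prop) :
    count (g + g') (fun x => p (x.take g) ∧ q (x.drop g)) = count g p * count g' q := by
  induction g generalizing p with
  | zero => simp [count, count_and_left]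
  | succ g ih =>
    rw [Nat.add_right_comm]
    simp only [count, List.take_succ_cons, List.drop_succ_cons, Finset.sum_mul]
    exact Finset.sum_congr rfl fun a _ => ih fun x => p (a :: x)

lemma count_concat (g : ℕ) (p : Str → Prop) :
    count (g + 1) p = ∑ a : Fin 3, count g fun x => p (x ++ [a]) := by
  induction g generalizing p with
  | zero => simp [count]
  | succ g ih =>
    calc count (g + 1 + 1) p = ∑ a : Fin 3, ∑ b : Fin 3, count g fun x => p (a :: (x ++ [b])) :=
          Finset.sum_congr rfl fun a _ => ih _
      _ = _ := Finset.sum_comm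

lemma count_reverse (g : ℕ) (p : Str → Prop) : count g p = count g fun x => p x.reverse := by
  induction g generalizing p with
  | zero => simp [count]
  | succ g ih =>
    rw [count_concat, count]
    refine Finset.sum_congr rfl fun a _ => ?_
    rw [ih]; simp

lemma count_eq_ncard (g : ℕ) (p : Str → Prop) :
    count g p = Set.ncard {x : Str | x.length = g ∧ p x} := by
  have hfin : ∀ (g : ℕ) (p : Str → Prop), {x : Str | x.length = g ∧ p x}.Finite := fun g p =>
    (List.finite_length_eq (Fin 3) g).subset fun x hx => hx.1
  induction g generalizing p with
  | zero =>
    by_cases h : p []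
    · rw [show {x : Str | x.length = 0 ∧ p x} = {[]} by ext x; simp; grind]
      simp [count, ind_true h]
    · rw [show {x : Str | x.length = 0 ∧ p x} = ∅ by ext x; simp; grind]
      simp [count, ind_false h]
  | succ g ih =>
    have h1 : {x : Str | x.length = g + 1 ∧ p x} =
        ⋃ a : Fin 3, (fun x => a :: x) '' {x : Str | x.length = g ∧ p (a :: x)} := by
      ext x
      simp only [Set.mem_ofPred_eq, Set.mem_iUnion, Set.mem_image]
      constructor
      · rintro ⟨h1, h2⟩
        obtain ⟨a, y, rfl⟩ := List.exists_cons_of_length_eq_add_one h1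
        exact ⟨a, y, ⟨by simpa using h1, h2⟩, rfl⟩
      · rintro ⟨a, y, ⟨h1, h2⟩, rfl⟩
        exact ⟨by simp [h1], h2⟩
    rw [h1, Set.ncard_iUnion_of_finite, finsum_eq_sum_of_fintype, count]
    · refine Finset.sum_congr rfl fun a _ => ?_
      rw [Set.ncard_image_of_injective _ (List.cons_injective), ih]
    · exact fun a => (hfin _ _).image _
    · intro a b hab
      rw [Function.onFun, Set.disjoint_left]
      rintro _ ⟨x, _, rfl⟩ ⟨y, _, hy⟩
      exact hab (List.cons_eq_cons.1 hy).1.symm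

/-- The number of strings of length `g` that can be put between the left context `q` and the right
context `r`, given in reverse, without creating a square of half-length at most `m`. -/
noncomputable def fill (m g : ℕ) (q r : Str) : ℕ := count g fun x => Free m (q ++ x ++ r.reverse)

lemma fill_zero (m : ℕ) (q r : Str) : fill m 0 q r = ind (Free m (q ++ r.reverse)) := by
  simp [fill, count]

/-- Reversal of the fillings exchanges the contexts. -/
lemma fill_comm (m g : ℕ) (q r : Str) : fill m g q r = fill m g r q := by
  rw [fill, count_reverse]
  refine count_congr fun x _ => ?_
  rw [← free_reverse]; simp

/-- The number of fillings only depends on the nodes of the two contexts. -/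
lemma fill_congr {m : ℕ} {P : Str → Prop} (hP : CoversPrefixes m P) (g : ℕ) {q q' r r' : Str}
    (hq : Free m q) (hr : Free m r) (h : LongestSuffix P q q') (h' : LongestSuffix P r r') :
    fill m g q r = fill m g q' r' := by
  refine count_congr fun x _ => ?_
  rw [free_append_reverse_iff hP hr h', List.append_assoc, free_append_iff hP hq h,
    List.append_assoc]

lemma fill_eq_zero {m g : ℕ} {q r : Str} (h : ¬ Free m q) : fill m g q r = 0 :=
  count_false _ fun x _ hf => h (hf.infix ⟨[], x ++ r.reverse, by simp⟩)

lemma fill_congr_left {m : ℕ} {P : Str → Prop} (hP : CoversPrefixes m P) (g : ℕ) {q q' r : Str}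
    (hq : Free m q) (h : LongestSuffix P q q') :
    fill m g q r = fill m g q' r := by
  refine count_congr fun x _ => ?_
  rw [List.append_assoc, free_append_iff hP hq h, List.append_assoc]

lemma fill_succ (m g : ℕ) (q r : Str) :
    fill m (g + 1) q r = ∑ a : Fin 3, fill m g (q ++ [a]) r := by
  simp only [fill, count]
  refine Finset.sum_congr rfl fun a _ => count_congr fun x _ => by simp

/-! ### Programs on strings

Variables are written `x…` and arrays `a…`. That a program preserves the variables and arrays it does
not write to is the content of `Frame`, whose side conditions on the numerals are decidable. -/

prefix:max "𝐯" => Exp.var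

notation "xRes" => 0
notation "xN" => 1
notation "xM" => 2
notation "xV" => 3
notation "xV2" => 4
notation "xStr" => 10
notation "xLen" => 11
notation "xMax" => 12
notation "xFree" => 13
notation "xHalf" => 14
notation "xPos" => 15
notation "xNode" => 16
notation "xSuf" => 17
notation "xDepth" => 18
notation "xRest" => 19
notation "xCur" => 20
notation "xOk" => 21

notation "aChild" => 0
notation "aCode" => 1
notation "aLen" => 2
notation "aTable" => 3
notation "aPow" => 4
notation "aFixed" => 5
notation "aBad" => 6
notation "aRev" => 7
notation "aLetter" => 8

/-- The powers of 3 up to exponent `d` are tabulated, and the machine is large enough for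
computing with strings of length `d`. -/
structure Powers (M : Machine) (d : ℕ) (σ : State) : Prop where
  eq : ∀ i ≤ d, σ.arr aPow i = 3 ^ i
  hA : d < M.A
  hN : d < M.N
  hB : 3 ^ (d + 3) ≤ M.B

lemma Powers.congr {M : Machine} {d : ℕ} {σ τ : State} (h : Powers M d σ)
    (h' : τ.arr aPow = σ.arr aPow) : Powers M d τ :=
  ⟨fun i hi => by rw [h', h.eq i hi], h.hA, h.hN, h.hB⟩

lemma Powers.pow_lt {M : Machine} {d : ℕ} {σ : State} (h : Powers M d σ) {i : ℕ} (hi : i ≤ d) :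
    3 ^ i < M.B :=
  (Nat.pow_lt_pow_right (by norm_num) (by omega)).trans_le h.hB

lemma Powers.lt {M : Machine} {d : ℕ} {σ : State} (h : Powers M d σ) : 27 * d + 27 ≤ M.B := by
  have h1 : d < 3 ^ d := Nat.lt_pow_self (by norm_num)
  have := h.hB
  rw [pow_add] at this
  omega

lemma Powers.num_lt {M : Machine} {d : ℕ} {σ : State} (h : Powers M d σ) {s : Str}
    (hs : s.length ≤ d) : num s < M.B :=
  (num_lt_of_le hs).trans (h.pow_lt le_rfl)

/-- Tests whether the string `xStr` of length `xLen` has no square of half-length at most `xMax`. -/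
def freeProg : Com :=
  xFree ≔ 1 ;;
  .for xHalf (𝐯 xMax) (
    .for xPos (𝐯 xLen - (2 * 𝐯 xHalf + 1)) (
      .ite (𝐯 xStr / .get aPow (𝐯 xPos) % .get aPow (𝐯 xHalf + 1) ≐
          𝐯 xStr / .get aPow (𝐯 xPos + (𝐯 xHalf + 1)) % .get aPow (𝐯 xHalf + 1))
        (xFree ≔ 0) .skip))

lemma freeProg_does {M : Machine} {σ : State} {d m : ℕ} {s : Str} (hp : Powers M d σ)
    (hx : σ.var xStr = num s) (hl : σ.var xLen = s.length) (hm : σ.var xMax = m)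
    (hs : s.length ≤ d) (hmd : m ≤ d) :
    Does M freeProg σ fun τ => τ.var xFree = ind (Free m s) := by
  have hB := hp.lt
  have hA := hp.hA
  have hN := hp.hN
  refine Does.assign_seq (by simp) (by simp; omega) ?_
  refine Does.for (K := m) (fun j τ => τ.var xFree = ind (∀ p < j, ∀ i < s.length - (2 * p + 1),
      (s.drop i).take (p + 1) ≠ (s.drop (i + (p + 1))).take (p + 1)))
    (by decide) (by omega) (by omega) ?_ ?_ ?_ ?_
  · intro j τ hf _ _
    simp [hf.var xMax (by decide), hm]
  · intro j τ hj hf hjv hI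
    refine Does.for (K := s.length - (2 * j + 1))
      (fun i ρ => ρ.var xFree = ind ((∀ p < j, ∀ i < s.length - (2 * p + 1),
      (s.drop i).take (p + 1) ≠ (s.drop (i + (p + 1))).take (p + 1)) ∧
        ∀ i' < i, (s.drop i').take (j + 1) ≠ (s.drop (i' + (j + 1))).take (j + 1)))
      (by decide) (by omega) (by omega) ?_ ?_ ?_ ?_
    · intro i ρ hf' _ _
      simp [hf'.var xLen (by decide), hf'.var xHalf (by decide), hf.var xLen (by decide), hl, hjv]
    · intro i ρ hi hf' hiv hI'
      have e1 : ρ.arr aPow = σ.arr aPow := by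
        rw [hf'.arr _ (by decide), hf.arr _ (by decide)]; simp
      have e2 : ρ.var xHalf = j := by rw [hf'.var _ (by decide), hjv]
      have e3 : ρ.var xStr = num s := by
        rw [hf'.var _ (by decide), hf.var _ (by decide)]; simpa using hx
      have hiff := num_slice_eq_iff (s := s) (i := i) (j := i + (j + 1)) (p := j + 1)
        (by omega) (by omega)
      refine Does.ite ?_ ?_ ?_
      · simp only [Exp.safe_eq, Exp.safe_mod, Exp.safe_div, Exp.safe_get, Exp.safe_var,
          Exp.safe_add, Exp.safe_one, Exp.val_var, Exp.val_add, Exp.val_one, e2, hiv, true_and]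
        omega
      · intro h
        simp only [Exp.val_eq, Exp.val_mod, Exp.val_div, Exp.val_get, Exp.val_var, Exp.val_add,
          Exp.val_one, e1, e2, e3, hiv, hp.eq i (by omega), hp.eq (j + 1) (by omega),
          hp.eq (i + (j + 1)) (by omega), hiff, ne_eq, ite_eq_right_iff, one_ne_zero, imp_false,
          not_not] at h
        refine Does.assign (by simp) (by simp; omega) fun v => ?_
        simp only [State.setVar_var, Exp.val_zero]
        rw [ind_false]
        · rfl
        · exact fun h' => h'.2 i (by omega) h
      · intro h
        simp only [Exp.val_eq, Exp.val_mod, Exp.val_div, Exp.val_get, Exp.val_var, Exp.val_add,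
          Exp.val_one, e1, e2, e3, hiv, hp.eq i (by omega), hp.eq (j + 1) (by omega),
          hp.eq (i + (j + 1)) (by omega), hiff, ite_eq_right_iff, one_ne_zero, imp_false] at h
        refine Does.skip fun v => ?_
        simp only [State.setVar_var]
        rw [if_neg (by decide), hI']
        refine ind_congr (and_congr_right fun _ => ?_)
        simp only [Nat.lt_succ_iff_lt_or_eq, or_imp, forall_and, forall_eq]
        tauto
    · intro ρ _ hI' v
      simp only [State.setVar_var]
      rw [if_neg (by decide), hI']
      refine ind_congr ?_
      simp only [Nat.lt_succ_iff_lt_or_eq, or_imp, forall_and, forall_eq]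
    · simp [hI]
  · intro τ _ hI
    rw [hI]
    exact ind_congr free_iff_slices.symm
  · simp [ind_true]

/-! ### Dictionaries -/

/-- The position of `s` in the list `P`, and `0` if it does not occur. -/
def index (P : List Str) (s : Str) : ℕ := if s ∈ P then P.idxOf s else 0

/-- The string at position `v` of the list `P`. -/
def node (P : List Str) (v : ℕ) : Str := P.getD v []

lemma node_eq {P : List Str} {v : ℕ} (h : v < P.length) : node P v = P[v] :=
  List.getD_eq_getElem _ _ h

lemma node_mem {P : List Str} {v : ℕ} (h : v < P.length) : node P v ∈ P := by
  rw [node_eq h]; exact List.getElem_mem _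

/-- The arrays hold a trie whose nodes are the strings in `P`. -/
structure Trie (P : List Str) (σ : State) : Prop where
  root : node P 0 = []
  pos : 0 < P.length
  nodup : P.Nodup
  closed : ∀ s a, s ++ [a] ∈ P → s ∈ P
  child : ∀ v < P.length, ∀ a : Fin 3,
    σ.arr aChild (v * 3 + a.val) = index P (node P v ++ [a])

lemma index_of_mem {P : List Str} {s : Str} (h : s ∈ P) :
    index P s < P.length ∧ node P (index P s) = s := by
  rw [index, if_pos h]
  have := List.idxOf_lt_length_iff.2 h
  exact ⟨this, by rw [node_eq this]; simp⟩

lemma index_lt {P : List Str} (hP : 0 < P.length) (s : Str) : index P s < P.length := by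
  by_cases h : s ∈ P
  · exact (index_of_mem h).1
  · rwa [index, if_neg h]

lemma Trie.congr {P : List Str} {σ τ : State} (h : Trie P σ)
    (h' : τ.arr aChild = σ.arr aChild) : Trie P τ :=
  ⟨h.root, h.pos, h.nodup, h.closed, by rw [h']; exact h.child⟩

lemma Trie.index_eq_zero {P : List Str} {σ : State} (h : Trie P σ) {s : Str} (hs : s ≠ []) :
    index P s = 0 ↔ s ∉ P := by
  constructor
  · intro h0 hm
    have := (index_of_mem hm).2
    rw [h0, h.root] at this
    exact hs this.symm
  · intro hm
    rw [index, if_neg hm]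

/-- Finds the node of the longest suffix, of the string `xStr` of length `xLen`, that is in the
trie. -/
def findProg : Com :=
  xNode ≔ 0 ;;
  .for xSuf (𝐯 xLen + 1) (
    xRest ≔ 𝐯 xStr / .get aPow (𝐯 xLen - 𝐯 xSuf) ;;
    xCur ≔ 0 ;;
    xOk ≔ 1 ;;
    .for xDepth (𝐯 xSuf) (
      xCur ≔ .get aChild (𝐯 xCur * 3 + 𝐯 xRest % 3) ;;
      .ite (𝐯 xCur ≐ 0) (xOk ≔ 0) .skip ;;
      xRest ≔ 𝐯 xRest / 3) ;;
    .ite (𝐯 xOk) (xNode ≔ 𝐯 xCur) .skip)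

lemma findProg_does {M : Machine} {σ : State} {d : ℕ} {P : List Str} {s : Str}
    (hp : Powers M d σ) (ht : Trie P σ) (hPA : 3 * P.length ≤ M.A) (hPB : P.length < M.B)
    (hx : σ.var xStr = num s) (hl : σ.var xLen = s.length) (hs : s.length ≤ d) :
    Does M findProg σ fun τ =>
      τ.var xNode < P.length ∧ LongestSuffix (· ∈ P) s (node P (τ.var xNode)) := by
  have hB := hp.lt
  have hA := hp.hA
  have hN := hp.hN
  have hsB := hp.num_lt hs
  have hnil : [] ∈ P := by
    have := node_mem ht.pos
    rwa [ht.root] at this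
  refine Does.assign_seq (by simp) (by simp; omega) ?_
  refine Does.for (K := s.length + 1) (fun j τ => τ.var xNode < P.length ∧
      node P (τ.var xNode) <:+ s ∧ (node P (τ.var xNode)).length ≤ j ∧
      ∀ t ∈ P, t <:+ s → t.length < j → t.length ≤ (node P (τ.var xNode)).length)
    (by decide) (by omega) (by omega) ?_ ?_ ?_ ?_
  · intro j τ hf _ _
    simp [hf.var xLen (by decide), hl]
  · intro j τ hj hf hjv hI
    have e1 : τ.arr aPow = σ.arr aPow := by rw [hf.arr _ (by decide)]; simp
    have e2 : τ.var xLen = s.length := by rw [hf.var _ (by decide)]; simpa using hl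
    have e3 : τ.var xStr = num s := by rw [hf.var _ (by decide)]; simpa using hx
    have e4 : τ.arr aChild = σ.arr aChild := by rw [hf.arr _ (by decide)]; simp
    obtain ⟨t, ht'⟩ : ∃ t, t = s.drop (s.length - j) := ⟨_, rfl⟩
    have htl : t.length = j := by rw [ht', List.length_drop]; omega
    have hval : num s / 3 ^ (s.length - j) = num t := by rw [ht', num_drop]
    have htB : num t < M.B := hp.num_lt (by omega)
    refine Does.assign_seq ?_ ?_ ?_
    · simp [hjv, e2]; omega
    · simp [hjv, e2, e3, e1, hp.eq _ (show s.length - j ≤ d by omega), hval, htB]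
    refine Does.assign_seq (by simp) (by simp; omega) ?_
    refine Does.assign_seq (by simp) (by simp; omega) ?_
    refine Does.seq (P := fun ρ => ρ.var xCur < P.length ∧ ρ.var xOk = ind (t ∈ P) ∧
      (t ∈ P → node P (ρ.var xCur) = t)) ?_ ?_
    · refine Does.for (K := j) (fun i ρ => ρ.var xCur < P.length ∧
        ρ.var xOk = ind (t.take i ∈ P) ∧ ρ.var xRest = num (t.drop i) ∧
        (t.take i ∈ P → node P (ρ.var xCur) = t.take i))
        (by decide) (by omega) (by omega) ?_ ?_ ?_ ?_
      · intro i ρ hf' _ _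
        simp [hf'.var xSuf (by decide), hjv]
      · rintro i ρ hi hf' hiv ⟨h1, h2, h3, h4⟩
        have hi' : i < t.length := by omega
        have hd : t.drop i = t[i] :: t.drop (i + 1) := List.drop_eq_getElem_cons hi'
        have htk : t.take (i + 1) = t.take i ++ [t[i]] := by simp
        have e5 : ρ.arr aChild = σ.arr aChild := by
          rw [hf'.arr _ (by decide)]; simpa using e4
        have hdig : num (t.drop i) % 3 = t[i].val := by rw [hd, num_cons]; omega
        have hdig' : num (t.drop i) / 3 = num (t.drop (i + 1)) := by rw [hd, num_cons]; omega
        have hc : ρ.arr aChild (ρ.var xCur * 3 + t[i].val) =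
          index P (node P (ρ.var xCur) ++ [t[i]]) := by rw [e5]; exact ht.child _ h1 _
        have hlt := index_lt ht.pos (node P (ρ.var xCur) ++ [t[i]])
        have h0 := ht.index_eq_zero (s := node P (ρ.var xCur) ++ [t[i]]) (by simp)
        have htB' : num (t.drop (i + 1)) < M.B := hp.num_lt (by simp; omega)
        refine Does.assign_seq ?_ ?_ ?_
        · simp [h3, hdig]; omega
        · simp [h3, hdig, hc]; omega
        refine Does.seq (P := fun θ => θ.var xCur = index P (node P (ρ.var xCur) ++ [t[i]]) ∧
          θ.var xOk = ind (t.take (i + 1) ∈ P) ∧ θ.var xRest = num (t.drop i)) ?_ ?_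
        · refine Does.ite (by simp) ?_ ?_
          · intro h
            simp only [Exp.val_eq, Exp.val_var, State.setVar_var, if_true, Exp.val_get,
              Exp.val_add, Exp.val_mul, Exp.val_mod, Exp.val_ofNat, h3, hdig, hc, Exp.val_zero,
              ne_eq, ite_eq_right_iff, one_ne_zero, imp_false, not_not] at h
            refine Does.assign (by simp) (by simp; omega) ⟨?_, ?_, ?_⟩
            · simp [h3, hdig, hc]
            · simp only [State.setVar_var, if_true, Exp.val_zero]
              rw [ind_false]
              intro hm
              rw [htk] at hm
              have h5 := h4 (ht.closed _ _ hm)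
              rw [h5] at h0 h
              exact h0.1 h hm
            · simp [h3]
          · intro h
            simp only [Exp.val_eq, Exp.val_var, State.setVar_var, if_true, Exp.val_get,
              Exp.val_add, Exp.val_mul, Exp.val_mod, Exp.val_ofNat, h3, hdig, hc, Exp.val_zero,
              ite_eq_right_iff, one_ne_zero, imp_false] at h
            refine Does.skip ⟨?_, ?_, ?_⟩
            · simp [h3, hdig, hc]
            · simp only [State.setVar_var, Nat.reduceEqDiff, if_false, h2]
              refine ind_congr ⟨fun hm => ?_, fun hm => ?_⟩
              · rw [h4 hm] at h0 h
                rw [htk]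
                by_contra hn
                exact h (h0.2 hn)
              · rw [htk] at hm
                exact ht.closed _ _ hm
            · simp [h3]
        · rintro θ - ⟨h5, h6, h7⟩
          refine Does.assign (by simp) ?_ fun v => ⟨?_, ?_, ?_, ?_⟩
          · simp [h7, hdig', htB']
          · simpa [h5] using hlt
          · simpa using h6
          · simp [h7, hdig']
          · intro hm
            rw [htk] at hm ⊢
            simp only [State.setVar_var, Nat.reduceEqDiff, if_false, h5]
            have h8 := h4 (ht.closed _ _ hm)
            rw [h8]
            exact (index_of_mem hm).2
      · rintro ρ - ⟨h1, h2, h3, h4⟩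
        rw [List.take_of_length_le (by omega)] at h2 h4
        exact ⟨h1, h2, h4⟩
      · simp [hjv, e2, e3, e1, hp.eq _ (show s.length - j ≤ d by omega), hval, ht.pos, hnil,
          ind_true, ht.root]
    · rintro ρ hf' ⟨h1, h2, h3⟩
      have e6 : ρ.var xNode = τ.var xNode := by rw [hf'.var _ (by decide)]; simp
      obtain ⟨i1, i2, i3, i4⟩ := hI
      have hsuf : ∀ t', t' <:+ s → t'.length = j → t' = t := by
        rintro t' ⟨a, rfl⟩ hl'
        rw [ht']; simp [hl']
      refine Does.ite (by simp) ?_ ?_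
      · intro h
        have htP : t ∈ P := by by_contra hn; simp [h2, ind_false hn] at h
        refine Does.assign (by simp) (by simp; omega) fun v => ?_
        simp only [State.setVar_var, Exp.val_var, if_true, Nat.reduceEqDiff,
          if_false, h3 htP]
        refine ⟨h1, by rw [ht']; exact List.drop_suffix _ _, by omega, fun t' _ _ h => by omega⟩
      · intro h
        have htP : t ∉ P := by intro hn; simp [h2, ind_true hn] at h
        refine Does.skip fun v => ?_
        simp only [State.setVar_var, Nat.reduceEqDiff,
          if_false, e6]
        refine ⟨i1, i2, by omega, fun t' h5 h6 h7 => ?_⟩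
        rcases Nat.lt_succ_iff_lt_or_eq.1 h7 with h8 | h8
        · exact i4 t' h5 h6 h8
        · exact absurd (hsuf t' h6 h8 ▸ h5) htP
  · rintro τ - ⟨h1, h2, h3, h4⟩
    refine ⟨h1, ?_, h2, fun t h5 h6 => h4 t h5 h6 ?_⟩
    · exact node_mem h1
    · have := h6.length_le; omega
  · simp [ht.root, ht.pos]

/-! ### Building the dictionary -/

notation "xFour" => 5
notation "xPow" => 30
notation "xExp" => 31
notation "xIn" => 32
notation "xWord" => 33
notation "xWordLen" => 34
notation "xChar" => 35
notation "xLetter" => 36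
notation "xEdge" => 37

lemma node_append_left {P Q : List Str} {v : ℕ} (h : v < P.length) :
    node (P ++ Q) v = node P v := by
  simp [node, List.getD, List.getElem?_append_left h]

lemma node_append_self {P : List Str} {x : Str} : node (P ++ [x]) P.length = x := by
  simp [node]

lemma index_append {P : List Str} {x s : Str} :
    index (P ++ [x]) s = if s ∈ P then index P s else if s = x then P.length else 0 := by
  by_cases h : s ∈ P
  · simp [index, h, List.idxOf_append_of_mem h]
  · by_cases h' : s = x
    · subst h'
      simp [index, h, List.idxOf_append_of_notMem h]
    · simp [index, h, h']

/-- The arrays hold the trie with nodes `P`, which starts with the empty string and the three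
letters, and the strings of the nodes, their reversals and their lengths. -/
structure Dict (P : List Str) (σ : State) : Prop where
  trie : Trie P σ
  four : 4 ≤ P.length
  letters : ∀ a : Fin 3, node P (a.val + 1) = [a]
  size : σ.var xV = P.length
  code : ∀ v < P.length, σ.arr aCode v = num (node P v)
  len : ∀ v < P.length, σ.arr aLen v = (node P v).length
  rev : ∀ v < P.length, σ.arr aRev v = num (node P v).reverse
  fresh : ∀ i, 3 * P.length ≤ i → σ.arr aChild i = 0

lemma Dict.congr {P : List Str} {σ τ : State} (h : Dict P σ) (hV : τ.var xV = σ.var xV)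
    (h0 : τ.arr aChild = σ.arr aChild) (h1 : τ.arr aCode = σ.arr aCode)
    (h2 : τ.arr aLen = σ.arr aLen) (h7 : τ.arr aRev = σ.arr aRev) : Dict P τ :=
  ⟨h.trie.congr h0, h.four, h.letters, hV.trans h.size, by rw [h1]; exact h.code,
    by rw [h2]; exact h.len, by rw [h7]; exact h.rev, by rw [h0]; exact h.fresh⟩

lemma Trie.node_inj {P : List Str} {σ : State} (h : Trie P σ) {u v : ℕ} (hu : u < P.length)
    (hv : v < P.length) (he : node P u = node P v) : u = v := by
  rw [node_eq hu, node_eq hv] at he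
  exact (h.nodup.getElem_inj_iff).1 he

lemma Dict.insert {P : List Str} {σ τ : State} (h : Dict P σ) {v : ℕ} {a : Fin 3}
    (hv : v < P.length) (hn : node P v ++ [a] ∉ P) (hV : τ.var xV = P.length + 1)
    (h0 : τ.arr aChild = Function.update (σ.arr aChild) (v * 3 + a.val) P.length)
    (h1 : τ.arr aCode = Function.update (σ.arr aCode) P.length (num (node P v ++ [a])))
    (h2 : τ.arr aLen = Function.update (σ.arr aLen) P.length (node P v ++ [a]).length)
    (h7 : τ.arr aRev = Function.update (σ.arr aRev) P.length (num (node P v ++ [a]).reverse)) :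
    Dict (P ++ [node P v ++ [a]]) τ := by
  have hl : (P ++ [node P v ++ [a]]).length = P.length + 1 := by simp
  have hP := h.four
  have arr : ∀ {A A' : ℕ → ℕ} {f : Str → ℕ}, (∀ u < P.length, A u = f (node P u)) →
      A' = Function.update A P.length (f (node P v ++ [a])) →
      ∀ u < (P ++ [node P v ++ [a]]).length, A' u = f (node (P ++ [node P v ++ [a]]) u) := by
    intro A A' f hA hA' u hu
    rw [hA', Function.update_apply]
    split_ifs with h
    · rw [h, node_append_self]
    · have : u < P.length := by omega
      rw [node_append_left this, hA u this]
  refine ⟨⟨?_, by omega, ?_, ?_, ?_⟩, by omega, ?_, by omega, arr h.code h1,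
    arr (f := List.length) h.len h2, arr (f := fun s => num s.reverse) h.rev h7, ?_⟩
  · rw [node_append_left (by omega), h.trie.root]
  · rw [List.nodup_append]
    exact ⟨h.trie.nodup, by simp, fun x hx y hy => by
      rw [List.mem_singleton] at hy; rintro rfl; exact hn (hy ▸ hx)⟩
  · intro s b hs
    rw [List.mem_append, List.mem_singleton] at hs ⊢
    rcases hs with hs | hs
    · exact Or.inl (h.trie.closed s b hs)
    · left
      rw [(List.append_inj' hs rfl).1]
      exact node_mem hv
  · intro u hu b
    rw [h0, Function.update_apply, index_append]
    rcases Nat.lt_or_ge u P.length with hu' | hu'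
    · rw [node_append_left hu']
      split_ifs with e1 e2 e3 e4 e5
      · exfalso
        have : u = v ∧ b = a := ⟨by omega, by ext; omega⟩
        rw [this.1, this.2] at e2; exact hn e2
      · rfl
      · exfalso
        have : u = v ∧ b = a := ⟨by omega, by ext; omega⟩
        rw [this.1, this.2] at e3; exact e3 rfl
      · exact h.trie.child u hu' b
      · exfalso
        obtain ⟨e6, e7⟩ := List.append_inj' e5 rfl
        have := h.trie.node_inj hu' hv e6
        simp at e7
        rw [this, e7] at e1; exact e1 rfl
      · rw [h.trie.child u hu' b, index, if_neg e4]
    · have : u = P.length := by omega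
      subst this
      rw [node_append_self, if_neg (by omega), if_neg, if_neg (by simp)]
      · exact h.fresh _ (by omega)
      · exact fun h' => hn (h.trie.closed _ _ h')
  · intro b
    rw [node_append_left (by omega)]
    exact h.letters b
  · intro i hi
    rw [h0, Function.update_apply, if_neg (by omega)]
    exact h.fresh _ (by omega)

/-- Reading off the head of the rest of the input. -/
lemma drop_eq_cons {l : List ℕ} {x c : ℕ} {r : List ℕ} (h : l.drop x = c :: r) :
    x < l.length ∧ l.getD x 0 = c ∧ l.drop (x + 1) = r := by
  have hx : x < l.length := by
    by_contra hx
    rw [List.drop_eq_nil_of_le (by omega)] at h; simp at h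
  rw [List.drop_eq_getElem_cons hx, List.cons.injEq] at h
  exact ⟨hx, by rw [List.getD_eq_getElem _ _ hx, h.1], h.2⟩

/-- Tabulates the powers of 3 with exponents at most `n + 4`. -/
def powProg : Com :=
  xPow ≔ 1 ;;
  .for xExp (𝐯 xN + 5) (.store aPow (𝐯 xExp) (𝐯 xPow) ;; xPow ≔ 𝐯 xPow * 3)

lemma powProg_does {M : Machine} {σ : State} {n : ℕ} (hn : σ.var xN = n) (hA : n + 4 < M.A)
    (hN : n + 4 < M.N) (hB : 3 ^ (n + 7) ≤ M.B) : Does M powProg σ (Powers M (n + 4)) := by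
  have hlt : ∀ i ≤ n + 6, 3 ^ i < M.B := fun i hi =>
    (Nat.pow_lt_pow_right (by norm_num) (by omega)).trans_le hB
  have h5 : n + 5 < M.B := (Nat.lt_pow_self (by norm_num)).trans (hlt (n + 5) (by omega))
  refine Does.assign_seq (by simp) (by simpa using hlt 0 (by omega)) ?_
  refine Does.for (K := n + 5) (fun j τ => τ.var xPow = 3 ^ j ∧ ∀ i < j, τ.arr aPow i = 3 ^ i)
    (by decide) (by omega) (by omega) ?_ ?_ ?_ ?_
  · intro j τ hf _ _
    simp [hf.var xN (by decide), hn]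
  · rintro j τ hj hf hjv ⟨h1, h2⟩
    refine Does.store_seq (by simp) (by simp; omega) (by simp)
      (by simpa [h1] using hlt j (by omega)) ?_
    refine Does.assign (by simp) (by simpa [h1, ← pow_succ] using hlt (j + 1) (by omega)) ?_
    intro v
    simp only [Exp.val_var, hjv, h1, Exp.val_mul, Exp.val_ofNat]
    refine ⟨by simp [h1, pow_succ], fun i hi => ?_⟩
    simp only [State.setVar_arr, State.setArr_arr, if_true, Function.update_apply]
    split_ifs with h
    · rw [h]
    · exact h2 i (by omega)
  · rintro τ - ⟨-, h2⟩
    exact ⟨fun i hi => h2 i (by omega), hA, hN, hB⟩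
  · simp

/-- Sets up the dictionary of the strings of length at most 1. -/
def initProg : Com :=
  .for xLetter 3 (
    .store aChild (𝐯 xLetter) (𝐯 xLetter + 1) ;;
    .store aCode (𝐯 xLetter + 1) (𝐯 xLetter) ;;
    .store aRev (𝐯 xLetter + 1) (𝐯 xLetter) ;;
    .store aLen (𝐯 xLetter + 1) 1) ;;
  xV ≔ 4

/-- The strings of length at most 1. -/
def smallStrings : List Str := [[], [0], [1], [2]]

lemma initProg_does {M : Machine} {σ : State} (hA : 12 ≤ M.A) (hN : 3 ≤ M.N)
    (hσ : ∀ a i, a ≠ aPow → σ.arr a i = 0) : Does M initProg σ (Dict smallStrings) := by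
  have hB := M.hB
  refine Does.seq (P := fun τ =>
      (∀ i, τ.arr aChild i = if i < 3 then i + 1 else 0) ∧
      (∀ i < 4, τ.arr aCode i = i - 1) ∧ (∀ i < 4, τ.arr aRev i = i - 1) ∧
      (∀ i < 4, τ.arr aLen i = min i 1)) ?_ ?_
  · refine Does.for (K := 3) (fun j τ =>
      (∀ i, τ.arr aChild i = if i < j then i + 1 else 0) ∧
      (∀ i < j + 1, τ.arr aCode i = i - 1) ∧ (∀ i < j + 1, τ.arr aRev i = i - 1) ∧
      (∀ i < j + 1, τ.arr aLen i = min i 1)) (by decide) (by omega) (by omega) ?_ ?_ ?_ ?_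
    · simp
    · rintro j τ hj hf hjv ⟨h1, h2, h3, h4⟩
      refine Does.store_seq (by simp) (by simp; omega) (by simp) (by simp; omega) ?_
      refine Does.store_seq (by simp) (by simp; omega) (by simp) (by simp; omega) ?_
      refine Does.store_seq (by simp) (by simp; omega) (by simp) (by simp; omega) ?_
      refine Does.store (by simp) (by simp; omega) (by simp) (by simp; omega) ?_
      intro v
      simp only [Exp.val_var, State.setArr_var, hjv, Exp.val_add, Exp.val_one, State.setVar_arr,
        State.setArr_arr, Nat.reduceEqDiff, if_false, if_true, Function.update_apply,
        OfNat.ofNat_ne_zero, OfNat.zero_ne_ofNat, OfNat.ofNat_ne_one, OfNat.one_ne_ofNat,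
        zero_ne_one, one_ne_zero]
      refine ⟨fun i => ?_, fun i hi => ?_, fun i hi => ?_, fun i hi => ?_⟩
      · rw [h1]; split_ifs <;> omega
      · split_ifs
        · omega
        · exact h2 i (by omega)
      · split_ifs
        · omega
        · exact h3 i (by omega)
      · split_ifs
        · omega
        · exact h4 i (by omega)
    · exact fun τ _ h => h
    · refine ⟨fun i => ?_, fun i hi => ?_, fun i hi => ?_, fun i hi => ?_⟩
      · simp [hσ aChild i (by decide)]
      · simp [hσ aCode i (by decide)]; omega
      · simp [hσ aRev i (by decide)]; omega
      · simp [hσ aLen i (by decide)]; omega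
  · rintro τ - ⟨h1, h2, h3, h4⟩
    refine Does.assign (by simp) (by simp; omega) ?_
    refine ⟨⟨rfl, by decide, by decide, ?_, ?_⟩, by decide, by decide, by simp; rfl, ?_, ?_, ?_, ?_⟩
    · intro s a hs
      have : s = [] := by
        have h5 : (s ++ [a]).length ≤ 1 := by
          simp only [smallStrings, List.mem_cons, List.not_mem_nil, or_false] at hs
          rcases hs with hs | hs | hs | hs <;> rw [hs] <;> simp
        simpa using h5
      rw [this]; decide
    · intro v hv a
      have hv' : v < 4 := hv
      simp only [State.setVar_arr, h1]
      revert a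
      interval_cases v <;> decide
    · intro v hv
      have hv' : v < 4 := hv
      simp only [State.setVar_arr, h2 v hv']
      interval_cases v <;> decide
    · intro v hv
      have hv' : v < 4 := hv
      simp only [State.setVar_arr, h4 v hv']
      interval_cases v <;> decide
    · intro v hv
      have hv' : v < 4 := hv
      simp only [State.setVar_arr, h3 v hv']
      interval_cases v <;> decide
    · intro i hi
      have : 12 ≤ i := hi
      simp only [State.setVar_arr, h1]
      rw [if_neg (by omega)]

/-- Appends a new node for the letter `xLetter` after the node `xCur`. -/
def newNodeProg : Com :=
  .store aChild (𝐯 xEdge) (𝐯 xV) ;;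
  .store aCode (𝐯 xV) (.get aCode (𝐯 xCur) + 𝐯 xLetter * .get aPow (.get aLen (𝐯 xCur))) ;;
  .store aRev (𝐯 xV) (𝐯 xLetter + 3 * .get aRev (𝐯 xCur)) ;;
  .store aLen (𝐯 xV) (.get aLen (𝐯 xCur) + 1) ;;
  xV ≔ 𝐯 xV + 1

lemma newNodeProg_does {M : Machine} {σ : State} {d : ℕ} {P : List Str} {v : ℕ} {a : Fin 3}
    (hp : Powers M d σ) (hd : Dict P σ) (hv : v < P.length) (hA : 3 * P.length ≤ M.A)
    (hB : P.length + 1 < M.B) (hl : (node P v).length < d)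
    (hn : node P v ++ [a] ∉ P) (hcur : σ.var xCur = v) (ha : σ.var xLetter = a.val)
    (he : σ.var xEdge = v * 3 + a.val) :
    Does M newNodeProg σ (Dict (P ++ [node P v ++ [a]])) := by
  have ha3 := a.isLt
  have hP := hd.four
  have hV := hd.size
  have h1 := hd.code v hv
  have h2 := hd.len v hv
  have h3 := hd.rev v hv
  have hl' : (node P v ++ [a]).length ≤ d := by simp; omega
  have hb1 := hp.num_lt hl'
  have hb2 := hp.num_lt (s := (node P v ++ [a]).reverse) (by simpa using hl')
  have hb3 := hp.lt
  have hdA := hp.hA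
  have hpw := hp.eq (node P v).length (by omega)
  have e1 : num (node P v) + a.val * 3 ^ (node P v).length = num (node P v ++ [a]) := by
    rw [num_concat]
  have e2 : a.val + 3 * num (node P v).reverse = num (node P v ++ [a]).reverse := by
    rw [List.reverse_append]; rfl
  refine Does.store_seq (by simp) (by simp [he]; omega) (by simp) (by simp [hV]; omega) ?_
  refine Does.store_seq (by simp) (by simp [hV]; omega) (by simp [hcur, h2]; omega)
    (by simpa [hcur, h1, h2, ha, hpw, e1] using hb1) ?_
  refine Does.store_seq (by simp) (by simp [hV]; omega) (by simp [hcur]; omega)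
    (by simpa [hcur, h3, ha, e2] using hb2) ?_
  refine Does.store_seq (by simp) (by simp [hV]; omega) (by simp [hcur]; omega)
    (by simp [hcur, h2]; omega) ?_
  refine Does.assign (by simp) (by simp [hV]; omega) ?_
  refine hd.insert hv hn (by simp [hV]) ?_ ?_ ?_ ?_
  · simp [he, hV]
  · simp [hcur, h1, h2, ha, hpw, e1, hV]
  · simp [hcur, h2, hV]
  · have e2' := e2
    simp at e2'
    simp [hcur, h3, ha, hV, e2']

lemma Trie.prefix_mem {P : List Str} {σ : State} (h : Trie P σ) {s t : Str} (ht : t ∈ P)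
    (hs : s <+: t) : s ∈ P := by
  obtain ⟨r, rfl⟩ := hs
  induction r using List.reverseRecOn with
  | nil => simpa using ht
  | append_singleton r a ih =>
    rw [← List.append_assoc] at ht
    exact ih (h.closed _ _ ht)

/-- Reads one letter and follows the edge for it, which is created if necessary. -/
def stepProg : Com :=
  xLetter ≔ .input (𝐯 xIn) ;;
  xIn ≔ 𝐯 xIn + 1 ;;
  xEdge ≔ 𝐯 xCur * 3 + 𝐯 xLetter ;;
  .ite (.get aChild (𝐯 xEdge) ≐ 0) newNodeProg .skip ;;
  xCur ≔ .get aChild (𝐯 xEdge)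

/-- Reads a word of the input and inserts it into the dictionary. -/
def wordProg : Com :=
  xWordLen ≔ .input (𝐯 xIn) ;;
  xIn ≔ 𝐯 xIn + 1 ;;
  xCur ≔ 0 ;;
  .for xChar (𝐯 xWordLen) stepProg

lemma stepProg_does {M : Machine} {σ : State} {d : ℕ} {P : List Str} {v : ℕ} {a : Fin 3}
    {rest : List ℕ}
    (hp : Powers M d σ) (hd : Dict P σ) (hv : v < P.length) (hA : 3 * P.length ≤ M.A)
    (hB : 3 * P.length + 3 < M.B) (hl : (node P v).length < d)
    (hcur : σ.var xCur = v) (hin : M.inp.drop (σ.var xIn) = a.val :: rest)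
    (hiB : M.inp.length < M.B) :
    Does M stepProg σ fun τ => ∃ P', P <+: P' ∧ P'.length ≤ P.length + 1 ∧
      (∀ s ∈ P', s.length ≤ (node P v).length + 1 ∨ s ∈ P) ∧ Dict P' τ ∧
      τ.var xCur < P'.length ∧ node P' (τ.var xCur) = node P v ++ [a] ∧
      M.inp.drop (τ.var xIn) = rest := by
  have ha3 := a.isLt
  have hP := hd.four
  obtain ⟨i1, i2, i3⟩ := drop_eq_cons hin
  have hc := hd.trie.child v hv a
  have h0 := hd.trie.index_eq_zero (s := node P v ++ [a]) (by simp)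
  refine Does.assign_seq (by simp; rw [List.getD_eq_getElem?_getD] at i2; omega)
    (by simp; rw [List.getD_eq_getElem?_getD] at i2; omega) ?_
  simp only [Exp.val_input, Exp.val_var, i2]
  refine Does.assign_seq (by simp) (by simp; omega) ?_
  refine Does.assign_seq (by simp) (by simp [hcur]; omega) ?_
  simp only [Exp.val_add, Exp.val_var, State.setVar_var, Nat.reduceEqDiff, if_false, if_true,
    Exp.val_one, Exp.val_mul, Exp.val_ofNat, hcur]
  have hP' : ∀ x y z, Dict P (((σ.setVar xLetter x).setVar xIn y).setVar xEdge z) :=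
    fun x y z => hd.congr (by simp) rfl rfl rfl rfl
  refine Does.seq (P := fun τ => ∃ P', P <+: P' ∧ P'.length ≤ P.length + 1 ∧
      (∀ s ∈ P', s.length ≤ (node P v).length + 1 ∨ s ∈ P) ∧ Dict P' τ ∧
      node P v ++ [a] ∈ P') ?_ ?_
  · refine Does.ite (by simp; omega) ?_ ?_
    · intro h
      simp only [Exp.val_eq, Exp.val_get, Exp.val_var, State.setVar_arr, State.setVar_var, if_true,
        hc, Exp.val_zero, ne_eq, ite_eq_right_iff, one_ne_zero, imp_false, not_not] at h
      refine Does.mono (newNodeProg_does (hp.congr rfl) (hP' _ _ _) hv hA (by omega) hl (h0.1 h)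
        (by simp [hcur]) (by simp) (by simp)) fun τ _ hτ => ⟨_, ?_, ?_, ?_, hτ, by simp⟩
      · simp
      · simp
      · intro s hs
        rw [List.mem_append, List.mem_singleton] at hs
        rcases hs with hs | hs
        · exact Or.inr hs
        · left; rw [hs]; simp
    · intro h
      simp only [Exp.val_eq, Exp.val_get, Exp.val_var, State.setVar_arr, State.setVar_var, if_true,
        hc, Exp.val_zero, ite_eq_right_iff, one_ne_zero, imp_false] at h
      refine Does.skip ⟨P, List.prefix_rfl, by omega, fun s hs => Or.inr hs, hP' _ _ _, ?_⟩
      by_contra hn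
      exact h (h0.2 hn)
  · rintro τ hf ⟨P', h1, h2, h3, h4, h5⟩
    have e1 : τ.var xEdge = v * 3 + a.val := by rw [hf.var _ (by decide)]; simp
    have e2 : τ.var xIn = σ.var xIn + 1 := by rw [hf.var _ (by decide)]; simp
    have hv' : v < P'.length := hv.trans_le h1.length_le
    have hn : node P' v = node P v := by
      obtain ⟨Q, rfl⟩ := h1
      exact node_append_left hv
    have hc' := h4.trie.child v hv' a
    rw [hn] at hc'
    obtain ⟨h6, h7⟩ := index_of_mem h5
    refine Does.assign (by simp [e1]; omega) (by simp [e1, hc']; omega) ?_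
    refine ⟨P', h1, h2, h3, h4.congr (by simp) rfl rfl rfl rfl, by simpa [e1, hc'] using h6,
      by simpa [e1, hc'] using h7, ?_⟩
    simpa [e2] using i3

/-- The state of the machine after reading the words `ts` of length at most `D`, with the encodings
of the words in `us` still to come. -/
structure Reading (M : Machine) (D : ℕ) (P : List Str) (ts us : List Str) (σ : State) : Prop where
  dict : Dict P σ
  size : P.length ≤ 4 + ts.length * D
  len : ∀ s ∈ P, s.length ≤ D
  mem : ∀ t ∈ ts, t ∈ P
  inp : M.inp.drop (σ.var xIn) = us.flatMap encStr

lemma wordProg_does {M : Machine} {σ : State} {d D c : ℕ} {P : List Str} {t : Str} {ts us : List Str}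
    (hp : Powers M d σ) (h : Reading M D P ts (t :: us) σ) (ht : t.length ≤ D) (hDd : D ≤ d)
    (hts : ts.length + 1 ≤ c) (hA : 3 * (4 + c * D) ≤ M.A) (hB : 3 * (4 + c * D) + 3 < M.B)
    (hiB : M.inp.length < M.B) :
    Does M wordProg σ fun τ => ∃ P', Reading M D P' (ts ++ [t]) us τ := by
  have hcD : (ts.length + 1) * D ≤ c * D := Nat.mul_le_mul_right _ hts
  rw [Nat.add_mul, Nat.one_mul] at hcD
  have hin := h.inp
  simp only [List.flatMap_cons, encStr, List.cons_append] at hin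
  obtain ⟨i1, i2, i3⟩ := drop_eq_cons hin
  have hdB := hp.lt
  have hdN := hp.hN
  have hP := h.dict.trie.pos
  rw [List.getD_eq_getElem?_getD] at i2
  refine Does.assign_seq (by simp; omega) (by simp; omega) ?_
  refine Does.assign_seq (by simp) (by simp; omega) ?_
  refine Does.assign_seq (by simp) (by simp; omega) ?_
  refine Does.for (K := t.length) (fun j τ => ∃ P', Dict P' τ ∧
      P'.length ≤ 4 + ts.length * D + j ∧ (∀ s ∈ P', s.length ≤ D) ∧ (∀ t ∈ ts, t ∈ P') ∧
      τ.var xCur < P'.length ∧ node P' (τ.var xCur) = t.take j ∧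
      M.inp.drop (τ.var xIn) = (t.drop j).map Fin.val ++ us.flatMap encStr)
    (by decide) (by omega) (by omega) ?_ ?_ ?_ ?_
  · intro j τ hf _ _
    simp [hf.var xWordLen (by decide), i2]
  · rintro j τ hj hf hjv ⟨P', h1, h2, h3, h4, h5, h6, h7⟩
    have e1 : τ.arr aPow = σ.arr aPow := by rw [hf.arr _ (by decide)]; simp
    rw [List.drop_eq_getElem_cons hj, List.map_cons, List.cons_append] at h7
    have hlen : (node P' (τ.var xCur)).length = j := by rw [h6]; simp; omega
    refine Does.mono (stepProg_does (hp.congr e1) h1 h5 (by omega) (by omega) (by omega) rfl h7 hiB)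
      ?_
    rintro ρ - ⟨P'', q1, q2, q3, q4, q5, q6, q7⟩ v
    refine ⟨P'', q4.congr (by simp) rfl rfl rfl rfl, by omega, ?_, fun s hs => q1.subset (h4 s hs),
      by simpa using q5, ?_, by simpa using q7⟩
    · intro s hs
      rcases q3 s hs with h | h
      · omega
      · exact h3 s h
    · simp only [State.setVar_var, Nat.reduceEqDiff, if_false, q6, h6]
      simp
  · rintro τ - ⟨P', h1, h2, h3, h4, h5, h6, h7⟩
    refine ⟨P', h1, ?_, h3, ?_, by simpa using h7⟩
    · simp only [List.length_append, List.length_singleton, Nat.add_mul]; omega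
    · intro s hs
      rw [List.mem_append, List.mem_singleton] at hs
      rcases hs with hs | hs
      · exact h4 s hs
      · rw [hs]
        rw [List.take_of_length_le le_rfl] at h6
        rw [← h6]; exact node_mem h5
  · exact ⟨P, h.dict.congr (by simp) rfl rfl rfl rfl, by have := h.size; omega, h.len, h.mem,
      by simpa using hP, by simpa using h.dict.trie.root, by simpa using i3⟩

/-- Reads all words of the input. -/
def readProg : Com :=
  xIn ≔ 3 ;;
  .for xWord (.input 2) wordProg

lemma readProg_runs {M : Machine} {σ : State} {d D n k : ℕ} {P : List Str} {ms : List Str}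
    (hp : Powers M d σ) (hd : Dict P σ) (hP4 : P.length = 4) (hPD : ∀ s ∈ P, s.length ≤ D)
    (hinp : M.inp = encPre n k ms) (hms : ∀ t ∈ ms, t.length ≤ D) (hDd : D ≤ d)
    (hA : 3 * (4 + ms.length * D) ≤ M.A) (hB : 3 * (4 + ms.length * D) + 3 < M.B)
    (hiB : M.inp.length < M.B) :
    Runs M readProg σ (ms.length * (wordProg.tb M.N + 10) + 20) fun τ =>
      ∃ P', Dict P' τ ∧ P'.length ≤ 4 + ms.length * D ∧ (∀ s ∈ P', s.length ≤ D) ∧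
        ∀ t ∈ ms, t ∈ P' := by
  have hmsB : ms.length < M.B := by
    have h1 : ∀ l : List Str, l.length ≤ (l.flatMap encStr).length := by
      intro l
      induction l with
      | nil => simp
      | cons a l ih => simp [encStr] at ih ⊢; omega
    have := h1 ms
    rw [hinp] at hiB
    simp only [encPre, List.length_cons] at hiB
    omega
  have hB' := M.hB
  have hlen : 2 < M.inp.length := by rw [hinp]; simp [encPre]
  have hv : M.inp.getD 2 0 = ms.length := by rw [hinp]; simp [encPre]
  refine Runs.mono (Q := fun τ => ∃ P', Dict P' τ ∧ P'.length ≤ 4 + ms.length * D ∧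
    (∀ s ∈ P', s.length ≤ D) ∧ ∀ t ∈ ms, t ∈ P') (Runs.seq
    (P := fun τ => τ = σ.setVar xIn 3) (Does.assign (by simp) (by simp; omega) (by simp)) ?_)
    (?_ : (xIn ≔ 3).tb M.N + (2 + (ms.length * (Exp.cost (.input 2) + wordProg.tb M.N + 8) +
      (Exp.cost (.input 2) + 3)) + 1) + 1 ≤ _)
    fun _ _ h => h
  · rintro _ - rfl
    refine Runs.for (K := ms.length) (fun j τ => ∃ P', Reading M D P' (ms.take j) (ms.drop j) τ)
      (by decide) hmsB ?_ ?_ ?_ ?_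
    · intro j τ _ _ _
      exact ⟨⟨(by norm_num : 2 < 16), hlen, hv.trans_lt hmsB⟩, hv⟩
    · rintro j τ hj hf hjv ⟨P', h⟩
      rw [List.drop_eq_getElem_cons hj] at h
      have e1 : τ.arr aPow = σ.arr aPow := by rw [hf.arr _ (by decide)]; simp
      refine Does.mono (wordProg_does (hp.congr e1) h (hms _ (List.getElem_mem _)) hDd
        (c := ms.length) (by simp; omega) hA hB hiB) ?_
      rintro ρ - ⟨P'', h'⟩ v
      rw [List.take_concat_get' _ _ hj] at h'
      exact ⟨P'', h'.dict.congr (by simp) rfl rfl rfl rfl, h'.size, h'.len, h'.mem,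
        by simpa using h'.inp⟩
    · rintro τ - ⟨P', h⟩
      rw [List.take_of_length_le le_rfl] at h
      exact ⟨P', h.dict, h.size, h.len, h.mem⟩
    · exact ⟨P, hd.congr (by simp) rfl rfl rfl rfl, by simp [hP4], hPD, by simp,
        by simp [hinp, encPre]⟩
  · have h1 : Exp.cost (.input 2) = 2 := rfl
    have h2 : (xIn ≔ 3).tb M.N = 2 := rfl
    have h3 : 2 + wordProg.tb M.N + 8 = wordProg.tb M.N + 10 := by omega
    rw [h1, h2, h3]; omega

/-! ### The table of fillings -/

notation "xCell" => 40
notation "xGap" => 41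
notation "xLeft" => 42
notation "xRight" => 43
notation "xSum" => 44

/-- Computes the entry of the table for gaps of length 0. -/
def baseProg : Com :=
  xStr ≔ .get aCode (𝐯 xLeft) + .get aRev (𝐯 xRight) * .get aPow (.get aLen (𝐯 xLeft)) ;;
  xLen ≔ .get aLen (𝐯 xLeft) + .get aLen (𝐯 xRight) ;;
  freeProg ;;
  .store aTable (𝐯 xCell) (𝐯 xFree)

/-- Computes an entry of the table for a gap of positive length from those for shorter gaps. -/
def extendProg : Com :=
  xSum ≔ 0 ;;
  .for xLetter 3 (
    xStr ≔ .get aCode (𝐯 xLeft) + 𝐯 xLetter * .get aPow (.get aLen (𝐯 xLeft)) ;;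
    xLen ≔ .get aLen (𝐯 xLeft) + 1 ;;
    freeProg ;;
    .ite (𝐯 xFree) (
      findProg ;;
      xSum ≔ 𝐯 xSum +
        .get aTable (((𝐯 xGap - 1) * 𝐯 xV + 𝐯 xNode) * 𝐯 xV2 + 𝐯 xRight)) .skip) ;;
  .store aTable (𝐯 xCell) (𝐯 xSum)

/-- Computes the entry `xCell` of the table. -/
def cellProg : Com :=
  xGap ≔ 𝐯 xCell / (𝐯 xV * 𝐯 xV2) ;;
  xLeft ≔ 𝐯 xCell / 𝐯 xV2 % 𝐯 xV ;;
  xRight ≔ 𝐯 xCell % 𝐯 xV2 ;;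
  xMax ≔ 𝐯 xM ;;
  .ite (𝐯 xGap ≐ 0) baseProg extendProg

/-- Computes the table. -/
def tableProg : Com :=
  .for xCell ((𝐯 xN + 1) * 𝐯 xV * 𝐯 xV2) cellProg

/-- Sums of three terms, as computed by a loop over the letters. -/
lemma sum_letters_lt (f : Fin 3 → ℕ) (b : ℕ) (h : ∀ a, f a ≤ b) (j : ℕ) :
    ∑ a ∈ Finset.univ.filter (fun a : Fin 3 => a.val < j), f a ≤ 3 * b := by
  calc _ ≤ ∑ a : Fin 3, f a := Finset.sum_le_sum_of_subset (Finset.filter_subset _ _)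
    _ ≤ ∑ _a : Fin 3, b := Finset.sum_le_sum fun a _ => h a
    _ = 3 * b := by simp

lemma sum_letters_succ (f : Fin 3 → ℕ) {j : ℕ} (hj : j < 3) :
    ∑ a ∈ Finset.univ.filter (fun a : Fin 3 => a.val < j + 1), f a =
      ∑ a ∈ Finset.univ.filter (fun a : Fin 3 => a.val < j), f a + f ⟨j, hj⟩ := by
  have : Finset.univ.filter (fun a : Fin 3 => a.val < j + 1) =
      insert ⟨j, hj⟩ (Finset.univ.filter (fun a : Fin 3 => a.val < j)) := by
    ext a
    simp only [Finset.mem_filter, Finset.mem_univ, true_and, Finset.mem_insert, Fin.ext_iff]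
    omega
  rw [this, Finset.sum_insert (by simp), add_comm]

lemma sum_letters_three (f : Fin 3 → ℕ) :
    ∑ a ∈ Finset.univ.filter (fun a : Fin 3 => a.val < 3), f a = ∑ a, f a := by
  exact congrArg (fun s => Finset.sum s f) (Finset.filter_true_of_mem fun a _ => a.isLt)

/-- The contents of the table for `V2` right contexts at cell `z`. -/
noncomputable def cell (m : ℕ) (P : List Str) (V2 z : ℕ) : ℕ :=
  fill m (z / (P.length * V2)) (node P (z / V2 % P.length)) (node P (z % V2))

lemma cell_eq {m : ℕ} {P : List Str} {V2 g r r' : ℕ} (hr : r < P.length) (hr' : r' < V2) :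
    cell m P V2 ((g * P.length + r) * V2 + r') = fill m g (node P r) (node P r') := by
  have h1 : ((g * P.length + r) * V2 + r') / V2 = g * P.length + r := by
    rw [Nat.add_comm, Nat.add_mul_div_right _ _ (by omega), Nat.div_eq_of_lt hr', zero_add]
  have h2 : (g * P.length + r) / P.length = g := by
    rw [Nat.add_comm, Nat.add_mul_div_right _ _ (by omega), Nat.div_eq_of_lt hr, zero_add]
  have h3 : (g * P.length + r) % P.length = r := by
    rw [Nat.add_comm, Nat.add_mul_mod_self_right, Nat.mod_eq_of_lt hr]
  have h4 : ((g * P.length + r) * V2 + r') % V2 = r' := by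
    rw [Nat.add_comm, Nat.add_mul_mod_self_right, Nat.mod_eq_of_lt hr']
  rw [cell, Nat.mul_comm P.length V2, ← Nat.div_div_eq_div_mul, h1, h2, h3, h4]

lemma cell_le {m : ℕ} {P : List Str} {V2 z : ℕ} : cell m P V2 z ≤ 3 ^ (z / (P.length * V2)) :=
  count_le _ _

/-- The memory holds the parameters `n` and `m`, the dictionary `P` and the first `z` cells of the
table for `V2` right contexts. -/
structure Tables (M : Machine) (n m V2 z : ℕ) (P : List Str) (σ : State) : Prop where
  hn : σ.var xN = n
  hm : σ.var xM = m
  hV2 : σ.var xV2 = V2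
  powers : Powers M (n + 4) σ
  dict : Dict P σ
  table : ∀ z' < z, σ.arr aTable z' = cell m P V2 z'

lemma Tables.congr {M : Machine} {n m V2 z : ℕ} {P : List Str} {σ τ : State}
    (h : Tables M n m V2 z P σ) (hv : ∀ x, 1 ≤ x → x ≤ 4 → τ.var x = σ.var x)
    (ha : ∀ a, a ≤ 4 ∨ a = aRev → τ.arr a = σ.arr a) : Tables M n m V2 z P τ :=
  ⟨(hv 1 (by omega) (by omega)).trans h.hn, (hv 2 (by omega) (by omega)).trans h.hm,
    (hv 4 (by omega) (by omega)).trans h.hV2, h.powers.congr (ha 4 (by omega)),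
    h.dict.congr (hv 3 (by omega) (by omega)) (ha 0 (by omega)) (ha 1 (by omega))
      (ha 2 (by omega)) (ha 7 (by omega)), by rw [ha 3 (by omega)]; exact h.table⟩

lemma Tables.frame {M : Machine} {n m V2 z : ℕ} {P : List Str} {σ τ : State} {c : Com}
    (h : Tables M n m V2 z P σ) (hf : Frame c σ τ) (hv : ∀ x ∈ c.wv, x = 0 ∨ 5 ≤ x)
    (ha : ∀ a ∈ c.wa, 5 ≤ a ∧ a ≠ aRev) : Tables M n m V2 z P τ :=
  h.congr (fun x h1 h4 => hf.var x fun hx => by have := hv x hx; omega)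
    (fun a h1 => hf.arr a fun hx => by have := ha a hx; omega)

lemma Tables.setVar {M : Machine} {n m V2 z : ℕ} {P : List Str} {σ : State}
    (h : Tables M n m V2 z P σ) {x : ℕ} (v : ℕ) (hx : 5 ≤ x) :
    Tables M n m V2 z P (σ.setVar x v) :=
  h.congr (fun y h1 h4 => by simp only [State.setVar_var]; rw [if_neg (by omega)]) (fun _ _ => rfl)

/-- The dictionary fits the length of the strings, and the machine fits the dictionary. -/
structure Fits (M : Machine) (n m V2 : ℕ) (P : List Str) : Prop where
  m_le : 4 * m ≤ n
  len : ∀ s ∈ P, 2 * s.length ≤ n + 2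
  V2_pos : 0 < V2
  V2_le : V2 ≤ P.length
  mem : 3 * P.length ≤ M.A
  table : (n + 1) * P.length * V2 ≤ M.A
  bound : (n + 1) * P.length * V2 + 3 * P.length + 3 < M.B
  covers : CoversPrefixes m (· ∈ P)

lemma baseProg_does {M : Machine} {σ : State} {n m V2 z : ℕ} {P : List Str}
    (h : Tables M n m V2 z P σ) (hF : Fits M n m V2 P) (hz : z < (n + 1) * P.length * V2)
    (hcell : σ.var xCell = z) (hg : z / (P.length * V2) = 0)
    (hq : σ.var xLeft = z / V2 % P.length) (hr : σ.var xRight = z % V2) (hm : σ.var xMax = m) :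
    Does M baseProg σ fun τ => τ.arr aTable z = cell m P V2 z ∧
      ∀ z' ≠ z, τ.arr aTable z' = σ.arr aTable z' := by
  have hV := h.dict.trie.pos
  obtain ⟨u, hu⟩ : ∃ u, u = z / V2 % P.length := ⟨_, rfl⟩
  obtain ⟨v, hv⟩ : ∃ v, v = z % V2 := ⟨_, rfl⟩
  have hu' : u < P.length := hu ▸ Nat.mod_lt _ hV
  have hv' : v < P.length := (hv ▸ Nat.mod_lt _ hF.V2_pos : v < V2).trans_le hF.V2_le
  rw [← hu] at hq; rw [← hv] at hr
  have l1 := hF.len _ (node_mem hu')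
  have l2 := hF.len _ (node_mem hv')
  have hpA := h.powers.hA
  have hpB := h.powers.lt
  have hmA := hF.mem
  have hml := hF.m_le
  have htA := hF.table
  have hpw := h.powers.eq (node P u).length (by omega)
  have e1 : num (node P u) + num (node P v).reverse * 3 ^ (node P u).length =
    num (node P u ++ (node P v).reverse) := (num_append _ _).symm
  have hb := h.powers.num_lt (s := node P u ++ (node P v).reverse) (by simp; omega)
  refine Does.assign_seq ?_ ?_ ?_
  · simp [hq, hr, h.dict.len u hu']; omega
  · simpa [hq, hr, h.dict.len u hu', h.dict.code u hu', h.dict.rev v hv', hpw, e1] using hb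
  refine Does.assign_seq ?_ ?_ ?_
  · simp [hq, hr]; omega
  · simp [hq, hr, h.dict.len u hu', h.dict.len v hv']; omega
  refine Does.seq (freeProg_does (d := n + 4) (m := m) (s := node P u ++ (node P v).reverse)
    (h.powers.congr rfl) ?_ ?_ ?_ ?_ ?_) ?_
  · simp [hq, hr, h.dict.len u hu', h.dict.code u hu', h.dict.rev v hv', hpw, e1]
  · simp [hq, hr, h.dict.len u hu', h.dict.len v hv']
  · simp [hm]
  · simp; omega
  · omega
  · intro τ hf hfree
    have e2 : τ.var xCell = z := by rw [hf.var _ (by decide)]; simp [hcell]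
    have e3 : τ.arr aTable = σ.arr aTable := by rw [hf.arr _ (by decide)]; simp
    have := ind_le (Free m (node P u ++ (node P v).reverse))
    refine Does.store (by simp) (by simp [e2]; omega) (by simp) (by simp [hfree]; omega) ⟨?_, ?_⟩
    · simp [e2, hfree, cell, hg, ← hu, ← hv, fill_zero]
    · intro z' hz'
      simp [e2, e3, hz']

lemma extendProg_does {M : Machine} {σ : State} {n m V2 z g : ℕ} {P : List Str}
    (h : Tables M n m V2 z P σ) (hF : Fits M n m V2 P) (hz : z < (n + 1) * P.length * V2)
    (hcell : σ.var xCell = z) (hg : z / (P.length * V2) = g + 1) (hgap : σ.var xGap = g + 1)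
    (hq : σ.var xLeft = z / V2 % P.length) (hr : σ.var xRight = z % V2) (hm : σ.var xMax = m) :
    Does M extendProg σ fun τ => τ.arr aTable z = cell m P V2 z ∧
      ∀ z' ≠ z, τ.arr aTable z' = σ.arr aTable z' := by
  have hV := h.dict.trie.pos
  obtain ⟨u, hu⟩ : ∃ u, u = z / V2 % P.length := ⟨_, rfl⟩
  obtain ⟨v, hv⟩ : ∃ v, v = z % V2 := ⟨_, rfl⟩
  have hu' : u < P.length := hu ▸ Nat.mod_lt _ hV
  have hv2 : v < V2 := hv ▸ Nat.mod_lt _ hF.V2_pos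
  have hv' : v < P.length := hv2.trans_le hF.V2_le
  rw [← hu] at hq; rw [← hv] at hr
  have l1 := hF.len _ (node_mem hu')
  have hpA := h.powers.hA
  have hpN := h.powers.hN
  have hpB := h.powers.lt
  have hmA := hF.mem
  have hml := hF.m_le
  have htA := hF.table
  have hbd := hF.bound
  have hpw := h.powers.eq (node P u).length (by omega)
  have hgn : g + 1 < n + 1 := by
    rw [← hg]
    apply Nat.div_lt_of_lt_mul
    rwa [Nat.mul_comm, ← Nat.mul_assoc]
  have hterm : ∀ a : Fin 3, fill m g (node P u ++ [a]) (node P v) ≤ 3 ^ n := fun a =>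
    (count_le _ _).trans (Nat.pow_le_pow_right (by norm_num) (by omega))
  have h3n : 3 * (3 * 3 ^ n) < M.B := by
    have := h.powers.hB
    have h3 : 0 < 3 ^ n := by positivity
    rw [show n + 4 + 3 = n + 7 by omega, pow_add] at this
    omega
  -- cells with a smaller gap precede the cell that is computed
  have hidx : ∀ r < P.length, (g * P.length + r) * V2 + v < z := by
    intro r hr
    have h1 : (g + 1) * (P.length * V2) ≤ z := by
      rw [← hg]; exact Nat.div_mul_le_self _ _
    have h2 : (r + 1) * V2 ≤ P.length * V2 := Nat.mul_le_mul_right _ hr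
    rw [Nat.add_mul] at h1 h2 ⊢
    rw [Nat.mul_assoc]; omega
  refine Does.assign_seq (by simp) (by simp; omega) ?_
  refine Does.seq (P := fun τ => τ.var xSum = cell m P V2 z) ?_ ?_
  · refine Does.for (K := 3) (fun j τ => τ.var xSum =
      ∑ a ∈ Finset.univ.filter (fun a : Fin 3 => a.val < j),
        fill m g (node P u ++ [a]) (node P v)) (by decide) (by omega) (by omega) ?_ ?_ ?_ ?_
    · simp
    · intro j τ hj hf hjv hI
      obtain ⟨a, ha⟩ : ∃ a : Fin 3, a = ⟨j, hj⟩ := ⟨_, rfl⟩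
      have haj : a.val = j := by rw [ha]
      have e : Tables M n m V2 z P τ :=
        (h.setVar (x := xSum) _ (by decide)).frame hf (by decide) (by decide)
      have hq' : τ.var xLeft = u := by rw [hf.var _ (by decide)]; simp [hq]
      have hr' : τ.var xRight = v := by rw [hf.var _ (by decide)]; simp [hr]
      have hm' : τ.var xMax = m := by rw [hf.var _ (by decide)]; simp [hm]
      have hg' : τ.var xGap = g + 1 := by rw [hf.var _ (by decide)]; simp [hgap]
      have hpw' := e.powers.eq (node P u).length (by omega)
      have e1 : num (node P u) + j * 3 ^ (node P u).length = num (node P u ++ [a]) := by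
        rw [num_concat, haj]
      have hsl : (node P u ++ [a]).length ≤ n + 4 := by simp; omega
      have hb := h.powers.num_lt hsl
      have hsum := sum_letters_lt _ _ hterm j
      refine Does.assign_seq ?_ ?_ ?_
      · simp [hq', e.dict.len u hu']; omega
      · simpa [hq', e.dict.len u hu', e.dict.code u hu', hpw', hjv, e1] using hb
      refine Does.assign_seq ?_ ?_ ?_
      · simp [hq']; omega
      · simp [hq', e.dict.len u hu']; omega
      refine Does.seq (freeProg_does (d := n + 4) (m := m) (s := node P u ++ [a])
        (e.powers.congr rfl) ?_ ?_ ?_ hsl (by omega)) ?_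
      · simp [hq', e.dict.len u hu', e.dict.code u hu', hpw', hjv, e1]
      · simp [hq', e.dict.len u hu']
      · simp [hm']
      intro ρ hf' hfree
      have hsum' : ρ.var xSum = τ.var xSum := by rw [hf'.var _ (by decide)]; simp
      have e' : Tables M n m V2 z P ρ :=
        ((e.setVar (x := xStr) _ (by decide)).setVar (x := xLen) _ (by decide)).frame hf'
          (by decide) (by decide)
      refine Does.ite (by simp) ?_ ?_
      · intro hne
        have hfr : Free m (node P u ++ [a]) := by
          by_contra hn; simp [hfree, ind_false hn] at hne
        refine Does.seq (findProg_does (d := n + 4) (s := node P u ++ [a]) e'.powers e'.dict.trie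
          hmA (by omega) ?_ ?_ hsl) ?_
        · rw [hf'.var _ (by decide)]
          simp [hq', e.dict.len u hu', e.dict.code u hu', hpw', hjv, e1]
        · rw [hf'.var _ (by decide)]
          simp [hq', e.dict.len u hu']
        rintro θ hf'' ⟨hlt, hls⟩
        obtain ⟨r, hr''⟩ : ∃ r, r = θ.var xNode := ⟨_, rfl⟩
        rw [← hr''] at hlt hls
        have a1 : θ.var xGap = g + 1 := by
          rw [hf''.var _ (by decide), hf'.var _ (by decide)]; simp [hg']
        have a2 : θ.var xV = P.length := by
          rw [hf''.var _ (by decide)]; exact e'.dict.size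
        have a3 : θ.var xV2 = V2 := by rw [hf''.var _ (by decide)]; exact e'.hV2
        have a4 : θ.var xRight = v := by
          rw [hf''.var _ (by decide), hf'.var _ (by decide)]; simp [hr']
        have a5 : θ.var xSum = τ.var xSum := by rw [hf''.var _ (by decide), hsum']
        have a6 : θ.arr aTable = ρ.arr aTable := hf''.arr _ (by decide)
        have hi := hidx r hlt
        have a7 : θ.arr aTable ((g * P.length + r) * V2 + v) =
            fill m g (node P u ++ [a]) (node P v) := by
          rw [a6, e'.table _ hi, cell_eq hlt hv2, fill_congr_left hF.covers g hfr hls]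
        have := hterm a
        refine Does.assign ?_ ?_ fun w => ?_
        · simp [a1, a2, a3, a4, ← hr'']; omega
        · simp [a1, a2, a3, a4, ← hr'', a5, a7, hI]; omega
        · rw [sum_letters_succ _ hj, ← ha]
          simp [a1, a2, a3, a4, ← hr'', a5, a7, hI]
      · intro hne
        have hfr : ¬ Free m (node P u ++ [a]) := by
          intro hn; simp [hfree, ind_true hn] at hne
        refine Does.skip fun w => ?_
        rw [sum_letters_succ _ hj, ← ha, fill_eq_zero hfr]
        simp [hsum', hI]
    · intro τ _ hI
      rw [hI, sum_letters_three, cell, hg, ← hu, ← hv, fill_succ]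
    · simp
  · intro τ hf hsum
    have e2 : τ.var xCell = z := by rw [hf.var _ (by decide)]; simp [hcell]
    have e3 : τ.arr aTable = σ.arr aTable := by rw [hf.arr _ (by decide)]; simp
    have : cell m P V2 z ≤ 3 ^ n := cell_le.trans (Nat.pow_le_pow_right (by norm_num) (by omega))
    refine Does.store (by simp) (by simp [e2]; omega) (by simp) (by simp [hsum]; omega) ⟨?_, ?_⟩
    · simp [e2, hsum]
    · intro z' hz'
      simp [e2, e3, hz']

lemma cellProg_does {M : Machine} {σ : State} {n m V2 z : ℕ} {P : List Str}
    (h : Tables M n m V2 z P σ) (hF : Fits M n m V2 P) (hz : z < (n + 1) * P.length * V2)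
    (hcell : σ.var xCell = z) : Does M cellProg σ (Tables M n m V2 (z + 1) P) := by
  have hbd := hF.bound
  have hml := hF.m_le
  have hpB := h.powers.lt
  have d1 : z / (P.length * V2) ≤ z := Nat.div_le_self _ _
  have d2 : z / V2 % P.length ≤ z := (Nat.mod_le _ _).trans (Nat.div_le_self _ _)
  have d3 : z % V2 ≤ z := Nat.mod_le _ _
  have hV := h.dict.size
  have hV2 := h.hV2
  have hm := h.hm
  refine Does.mono (P := fun τ => τ.arr aTable z = cell m P V2 z ∧
      ∀ z' ≠ z, τ.arr aTable z' = σ.arr aTable z') ?_ ?_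
  · refine Does.assign_seq (by simp) (by simp [hcell, hV, hV2]; omega) ?_
    refine Does.assign_seq (by simp) (by simp [hcell, hV, hV2]; omega) ?_
    refine Does.assign_seq (by simp) (by simp [hcell, hV2]; omega) ?_
    refine Does.assign_seq (by simp) (by simp [hm]; omega) ?_
    have hT : ∀ w x y t, Tables M n m V2 z P
        ((((σ.setVar xGap w).setVar xLeft x).setVar xRight y).setVar xMax t) := fun w x y t =>
      (((h.setVar w (by decide)).setVar x (by decide)).setVar y (by decide)).setVar t (by decide)
    refine Does.ite (by simp) (fun hc => ?_) (fun hc => ?_)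
    · simp only [Exp.val_eq, Exp.val_var, State.setVar_var, Nat.reduceEqDiff, if_false, if_true,
        Exp.val_div, Exp.val_mul, hcell, hV, hV2, Exp.val_zero, ne_eq, ite_eq_right_iff,
        one_ne_zero, imp_false, not_not] at hc
      exact baseProg_does (hT _ _ _ _) hF hz (by simp [hcell]) hc (by simp [hcell, hV2, hV])
        (by simp [hcell, hV2]) (by simp [hm])
    · simp only [Exp.val_eq, Exp.val_var, State.setVar_var, Nat.reduceEqDiff, if_false, if_true,
        Exp.val_div, Exp.val_mul, hcell, hV, hV2, Exp.val_zero, ite_eq_right_iff,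
        one_ne_zero, imp_false] at hc
      obtain ⟨g, hg⟩ := Nat.exists_eq_succ_of_ne_zero hc
      exact extendProg_does (hT _ _ _ _) hF hz (by simp [hcell]) hg
        (by simpa [hcell, hV, hV2] using hg) (by simp [hcell, hV2, hV])
        (by simp [hcell, hV2]) (by simp [hm])
  · rintro τ hf ⟨h1, h2⟩
    refine ⟨(hf.var _ (by decide)).trans h.hn, (hf.var _ (by decide)).trans h.hm,
      (hf.var _ (by decide)).trans h.hV2, h.powers.congr (hf.arr _ (by decide)),
      h.dict.congr (hf.var _ (by decide)) (hf.arr _ (by decide)) (hf.arr _ (by decide))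
        (hf.arr _ (by decide)) (hf.arr _ (by decide)), ?_⟩
    · intro z' hz'
      by_cases hzz : z' = z
      · rw [hzz, h1]
      · rw [h2 z' hzz, h.table z' (by omega)]

lemma tableProg_runs {M : Machine} {σ : State} {n m V2 : ℕ} {P : List Str}
    (h : Tables M n m V2 0 P σ) (hF : Fits M n m V2 P) :
    Runs M tableProg σ ((n + 1) * P.length * V2 * (cellProg.tb M.N + 15) + 15)
      (Tables M n m V2 ((n + 1) * P.length * V2) P) := by
  have hc : ((𝐯 xN + 1) * 𝐯 xV * 𝐯 xV2).cost = 7 := rfl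
  refine Runs.mono (Runs.for (K := (n + 1) * P.length * V2) (T := cellProg.tb M.N) (fun z τ => Tables M n m V2 z P τ)
    (by decide) (by have := hF.bound; omega) ?_ ?_ (fun τ _ h => h) ?_) ?_ (fun _ _ h => h)
  · intro j τ _ _ hI
    simp [hI.hn, hI.dict.size, hI.hV2]
  · intro j τ hj hf hjv hI
    refine Does.mono (cellProg_does hI hF hj hjv) fun ρ _ hρ v => hρ.setVar v (by decide)
  · exact h.setVar 0 (by decide)
  · rw [hc, show 7 + cellProg.tb M.N + 8 = cellProg.tb M.N + 15 by omega]; omega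

/-! ### The precomputation -/

/-- Reads `n` and `k`, and computes `⌊n/k⌋` and whether `k` is 4. -/
def paramProg : Com :=
  xN ≔ .input 0 ;;
  xM ≔ 𝐯 xN / .input 1 ;;
  xFour ≔ .input 1 ≺ 5

/-- The number of right contexts in the table: only the strings of length at most 1 if `k = 4`. -/
def contextProg : Com :=
  .ite (𝐯 xFour) (xV2 ≔ 4) (xV2 ≔ 𝐯 xV)

/-- The precomputation. -/
def preProg : Com :=
  paramProg ;; powProg ;; initProg ;; readProg ;; contextProg ;; tableProg

lemma Machine.B_le (M : Machine) : M.B ≤ 2 ^ M.w :=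
  (Nat.le_self_pow (by norm_num) _).trans M.hw

/-- The number `k` is the only value of the program that may exceed the bound of the machine. -/
lemma paramProg_does {M : Machine} {σ : State} {n k : ℕ} {l : List ℕ}
    (hinp : M.inp = n :: k :: l) (hn : n < M.B) (hk : 4 ≤ k) (hkw : k < 2 ^ M.w) :
    Does M paramProg σ fun τ => τ.var xN = n ∧ τ.var xM = n / k ∧
      τ.var xFour = if k = 4 then 1 else 0 := by
  have hB := M.hB
  have hBw := M.B_le
  have h1w : 1 < 2 ^ M.w := by omega
  have h5w : 5 < 2 ^ M.w := by omega
  have hdiv : n / k ≤ n := Nat.div_le_self _ _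
  have hI : ∀ τ, (Exp.input 1).eval M.w M.A M.inp τ = some k := by
    intro τ
    change ((word M.w 1).bind fun j => (M.inp[j]?).bind (word M.w)) = some k
    simp [word, h1w, hinp, hkw]
  refine Does.assign_seq ?_ ?_ ?_
  · simp [hinp, hn]
  · simp [hinp, hn]
  have hv : (Exp.input 0).val M.inp σ = n := by simp [hinp]
  rw [hv]
  refine Does.seq (P := fun τ => τ.var xN = n ∧ τ.var xM = n / k)
    (Does.assign_of_eval (v := n / k) ?_ (by omega) (by simp)) ?_
  · change ((word M.w ((σ.setVar xN n).var xN)).bind fun x =>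
      ((Exp.input 1).eval M.w M.A M.inp (σ.setVar xN n)).bind fun y => word M.w (x / y)) = _
    have h1 : n < 2 ^ M.w := by omega
    have h2 : n / k < 2 ^ M.w := by omega
    rw [hI]
    simp [word, h1, h2]
  · rintro τ - ⟨h1, h2⟩
    refine Does.assign_of_eval (v := if k = 4 then 1 else 0) ?_ (by split_ifs <;> omega)
      (by simp [h1, h2])
    change (((Exp.input 1).eval M.w M.A M.inp τ).bind fun x =>
      (word M.w 5).bind fun y => word M.w (if x < y then 1 else 0)) = _
    rw [hI]
    have h3 : (k < 5) ↔ k = 4 := by omega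
    simp only [word, if_pos h5w, Option.bind_some, h3]
    rw [if_pos]
    split_ifs <;> omega

/-- The bound for the length of the words in the dictionary. -/
def maxLen (n k : ℕ) : ℕ := max (2 * (n / k)) 1

/-- The bound for the number of nodes. -/
def maxNodes (n k c : ℕ) : ℕ := 4 + c * maxLen n k

/-- The bound for the number of right contexts. -/
def maxContexts (n k c : ℕ) : ℕ := if k = 4 then 4 else maxNodes n k c

/-- The memory contents that the precomputation leaves. -/
structure Ready (M : Machine) (n k V2 : ℕ) (P : List Str) (σ : State) : Prop where
  tables : Tables M n (n / k) V2 ((n + 1) * P.length * V2) P σ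
  contexts : k = 4 ∧ V2 = 4 ∨ V2 = P.length
  zero : ∀ a i, a = aFixed ∨ a = aBad ∨ a = aLetter → σ.arr a i = 0

lemma preProg_runs {M : Machine} {n k : ℕ} {ms : List Str} (hk : 4 ≤ k) (hkw : k < 2 ^ M.w)
    (hinp : M.inp = encPre n k ms) (hms : ∀ t ∈ ms, t.length ≤ 2 * (n / k))
    (hcov : ∀ t ∈ minSquares (n / k), t ∈ ms) (hA : n + 12 < M.A) (hN : n + 4 < M.N)
    (hA1 : 3 * maxNodes n k ms.length ≤ M.A)
    (hA2 : (n + 1) * maxNodes n k ms.length * maxContexts n k ms.length ≤ M.A)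
    (hB : 3 ^ (n + 7) ≤ M.B)
    (hB1 : (n + 1) * maxNodes n k ms.length * maxContexts n k ms.length +
      3 * maxNodes n k ms.length + 3 < M.B) (hiB : M.inp.length < M.B) :
    Runs M preProg State.init (ms.length * (wordProg.tb M.N + 10) +
      (n + 1) * maxNodes n k ms.length * maxContexts n k ms.length * (cellProg.tb M.N + 15) +
      (powProg.tb M.N + initProg.tb M.N + 100))
      fun τ => ∃ P V2, Ready M n k V2 P τ ∧ Fits M n (n / k) V2 P := by
  have hnB : n + 1 < M.B := by
    have h1 : n + 7 < 3 ^ (n + 7) := Nat.lt_pow_self (by norm_num)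
    omega
  have hm4 : 4 * (n / k) ≤ n := by
    calc 4 * (n / k) ≤ k * (n / k) := Nat.mul_le_mul_right _ hk
      _ ≤ n := Nat.mul_div_le _ _
  have hD : 2 * maxLen n k ≤ n + 2 := by unfold maxLen; omega
  have hD1 : 1 ≤ maxLen n k := le_max_right _ _
  have hD2 : 2 * (n / k) ≤ maxLen n k := le_max_left _ _
  have hmono : ∀ T T', T' ≤ T → ∀ c σ (P : State → Prop), Runs M c σ T' P → Runs M c σ T P :=
    fun T T' h c σ P hr => hr.mono h fun _ _ h => h
  set V := maxNodes n k ms.length with hV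
  set W := maxContexts n k ms.length with hW
  have ht1 : paramProg.tb M.N = 15 := rfl
  have ht2 : contextProg.tb M.N = 6 := rfl
  refine hmono _ (paramProg.tb M.N + (powProg.tb M.N + (initProg.tb M.N +
    ((ms.length * (wordProg.tb M.N + 10) + 20) + (contextProg.tb M.N +
    ((n + 1) * V * W * (cellProg.tb M.N + 15) + 15) + 1) + 1) + 1) + 1) + 1) (by omega) _ _ _ ?_
  refine Runs.seq (paramProg_does hinp (by omega) hk hkw) ?_
  rintro σ₁ hf₁ ⟨hn, hm, hfour⟩
  refine Runs.seq (powProg_does hn (by omega) hN hB) ?_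
  intro σ₂ hf₂ hpow
  refine Runs.seq (initProg_does (by omega) (by omega) ?_) ?_
  · intro a i ha
    rw [hf₂.arr a (by have : powProg.wa = [aPow] := rfl; simp [this, ha]), hf₁.arr a (by
      have : paramProg.wa = [] := rfl; simp [this])]
    rfl
  intro σ₃ hf₃ hdict
  have hpow₃ := hpow.congr (hf₃.arr aPow (by decide))
  refine Runs.seq (readProg_runs (D := maxLen n k) hpow₃ hdict rfl ?_ hinp
    (fun t ht => (hms t ht).trans hD2) (by omega) hA1 (by change 3 * V + 3 < M.B; omega) hiB) ?_
  · intro s hs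
    simp only [smallStrings, List.mem_cons, List.not_mem_nil, or_false] at hs
    rcases hs with rfl | rfl | rfl | rfl <;> simp [hD1]
  rintro σ₄ hf₄ ⟨P, hP, hPV, hPl, hPm⟩
  have hPV' : P.length ≤ V := hPV
  have e1 : σ₄.var xN = n := by
    rw [hf₄.var _ (by decide), hf₃.var _ (by decide), hf₂.var _ (by decide), hn]
  have e2 : σ₄.var xM = n / k := by
    rw [hf₄.var _ (by decide), hf₃.var _ (by decide), hf₂.var _ (by decide), hm]
  have e3 : σ₄.var xFour = if k = 4 then 1 else 0 := by
    rw [hf₄.var _ (by decide), hf₃.var _ (by decide), hf₂.var _ (by decide), hfour]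
  have hpow₄ := hpow₃.congr (hf₄.arr aPow (by decide))
  have hP4 := hP.four
  refine Runs.seq (P := fun τ => ∃ V2, Tables M n (n / k) V2 0 P τ ∧
    (k = 4 ∧ V2 = 4 ∨ k ≠ 4 ∧ V2 = P.length)) (T₁ := contextProg.tb M.N) ?_ ?_
  · have hT : ∀ x, Tables M n (n / k) x 0 P (σ₄.setVar xV2 x) := fun x =>
      ⟨by simpa using e1, by simpa using e2, by simp, hpow₄.congr rfl,
        hP.congr (by simp) rfl rfl rfl rfl, by simp⟩
    refine Does.ite (by simp) (fun h => ?_) (fun h => ?_)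
    · have hk4 : k = 4 := by by_contra hk4; simp [e3, hk4] at h
      have := M.hB
      exact Does.assign (by simp) (by simp; omega) ⟨4, hT 4, Or.inl ⟨hk4, rfl⟩⟩
    · have hk4 : k ≠ 4 := by rintro rfl; simp [e3] at h
      exact Does.assign (by simp) (by simp [hP.size]; omega)
        ⟨P.length, by simpa [hP.size] using hT P.length, Or.inr ⟨hk4, rfl⟩⟩
  rintro σ₅ hf₅ ⟨V2, hT, hV2⟩
  have hV2W : V2 ≤ W := by
    rw [hW, maxContexts]
    rcases hV2 with ⟨h1, h2⟩ | ⟨h1, h2⟩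
    · rw [if_pos h1, h2]
    · rw [if_neg h1, h2]; exact hPV'
  have hprod : (n + 1) * P.length * V2 ≤ (n + 1) * V * W :=
    Nat.mul_le_mul (Nat.mul_le_mul_left _ hPV') hV2W
  have hF : Fits M n (n / k) V2 P := by
    refine ⟨hm4, fun s hs => by have := hPl s hs; omega, by omega, by omega, by omega, by omega,
      by omega, fun t ht s hs => hP.trie.prefix_mem (hPm t (hcov t ht)) hs⟩
  refine (tableProg_runs hT hF).mono ?_ ?_
  · have := Nat.mul_le_mul_right (cellProg.tb M.N + 15) hprod
    omega
  · intro σ₆ hf₆ hT'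
    refine ⟨P, V2, ⟨hT', by tauto, fun a i ha => ?_⟩, hF⟩
    have hz : ∀ a, a = aFixed ∨ a = aBad ∨ a = aLetter →
        a ∉ tableProg.wa ∧ a ∉ contextProg.wa ∧ a ∉ readProg.wa ∧ a ∉ initProg.wa ∧
        a ∉ powProg.wa ∧ a ∉ paramProg.wa := by
      rintro a (rfl | rfl | rfl) <;> decide
    obtain ⟨h1, h2, h3, h4, h5, h6⟩ := hz a ha
    rw [hf₆.arr a h1, hf₅.arr a h2, hf₄.arr a h3, hf₃.arr a h4, hf₂.arr a h5, hf₁.arr a h6]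
    rfl

/-! ### Batches as constraints on single letters -/

/-- The length of the interval `[L, R + T - 1)` that a batch determines. -/
def Batch.len (b : Batch) : ℕ := 2 * b.U.length + b.T - 1

/-- The letters of the periodic extension of `U`. -/
def Batch.per (b : Batch) (i : ℕ) : Fin 3 := b.U.getD (i % b.U.length) 0

/-- The string that a batch determines on the interval `[L, R + T - 1)`. -/
def Batch.run (b : Batch) : Str := (List.range b.len).map b.per

/-- The constraint of a batch on the letter `a` at position `i`: it is given within the determined
interval, and next to the interval it must not complete a further minimal square. -/
def Batch.Allows (b : Batch) (i : ℕ) (a : Fin 3) : Prop :=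
  (b.L ≤ i → i < b.L + b.len → a = b.per (i - b.L)) ∧
  (i + 1 = b.L → ¬ MinimalSquare (a :: b.run.take (2 * b.U.length - 1))) ∧
  (i = b.L + b.len → ¬ MinimalSquare (b.run.drop b.T ++ [a]))

@[simp] lemma Batch.run_length (b : Batch) : b.run.length = b.len := by simp [run]

lemma Batch.run_getElem (b : Batch) {i : ℕ} (h : i < b.run.length) : b.run[i] = b.per i := by
  simp [run]

lemma Batch.per_add (b : Batch) (i : ℕ) : b.per (i + b.U.length) = b.per i := by
  simp [per]

lemma Batch.per_lt (b : Batch) {i : ℕ} (h : i < b.U.length) : b.per i = b.U[i] := by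
  rw [per, Nat.mod_eq_of_lt h, List.getD_eq_getElem _ _ h]

lemma window_square_iff {u : Str} {p j : ℕ} (h : j + 2 * p ≤ u.length) :
    ((u.drop j).take (2 * p)).take p = ((u.drop j).take (2 * p)).drop p ↔
      ∀ i < p, u.getD (j + i) 0 = u.getD (j + i + p) 0 := by
  have hl : ((u.drop j).take (2 * p)).length = 2 * p := by simp; omega
  constructor
  · intro he i hi
    have := congrArg (fun l => List.getD l i 0) he
    rw [List.getD_eq_getElem _ _ (by simp; omega), List.getD_eq_getElem _ _ (by simp; omega)] at this
    rw [List.getD_eq_getElem _ _ (by omega), List.getD_eq_getElem _ _ (by omega)]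
    simp only [List.getElem_take, List.getElem_drop] at this
    rw [this]; congr 1; omega
  · intro he
    refine List.ext_getElem (by simp; omega) fun i h1 h2 => ?_
    have hi : i < p := by simp at h1; omega
    have := he i hi
    rw [List.getD_eq_getElem _ _ (by omega), List.getD_eq_getElem _ _ (by omega)] at this
    simp only [List.getElem_take, List.getElem_drop]
    rw [this]; congr 1; omega

/-- All windows of length `2p` of a string are minimal squares iff the string has period `p` and
contains no square of half-length below `p`. -/
lemma windows_minimal_iff {u : Str} {p T : ℕ} (hp : 1 ≤ p) (hT : 1 ≤ T)
    (hl : u.length = 2 * p + T - 1) :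
    (∀ j < T, MinimalSquare ((u.drop j).take (2 * p))) ↔
      (∀ i, i + p < u.length → u.getD i 0 = u.getD (i + p) 0) ∧ Free (p - 1) u := by
  have hw : ∀ j < T, ((u.drop j).take (2 * p)).length = 2 * p := fun j hj => by simp; omega
  constructor
  · intro h
    refine ⟨fun i hi => ?_, fun w hw1 hw2 hinf => ?_⟩
    · have h1 := ((minimalSquare_iff hp (hw (min i (T - 1)) (by omega))).1
        (h (min i (T - 1)) (by omega))).1
      have h2 := (window_square_iff (by omega)).1 h1 (i - min i (T - 1)) (by omega)
      rwa [show min i (T - 1) + (i - min i (T - 1)) = i by omega] at h2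
    · obtain ⟨i, hi, h1, h2⟩ := append_self_infix_iff.1 hinf
      have h3 := ((minimalSquare_iff hp (hw (min i (T - 1)) (by omega))).1
        (h (min i (T - 1)) (by omega))).2
      refine h3 w hw1 hw2 (append_self_infix_iff.2 ⟨i - min i (T - 1), ?_, ?_, ?_⟩)
      · rw [hw _ (by omega)]; omega
      · rw [List.drop_take, List.drop_drop, List.take_take, min_eq_left (by omega)]
        rwa [show min i (T - 1) + (i - min i (T - 1)) = i by omega]
      · rw [List.drop_take, List.drop_drop, List.take_take, min_eq_left (by omega)]
        rwa [show min i (T - 1) + (i - min i (T - 1) + w.length) = i + w.length by omega]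
  · rintro ⟨h1, h2⟩ j hj
    rw [minimalSquare_iff hp (hw j hj), window_square_iff (by omega)]
    refine ⟨fun i hi => h1 _ (by omega), h2.infix ?_⟩
    exact (List.take_prefix _ _).isInfix.trans (List.drop_suffix _ _).isInfix

/-- Containment of a batch as a condition on the batch and on the single letters of the string. -/
lemma Batch.containedIn_iff {n : ℕ} {b : Batch} (hb : b.Valid n) (hp : 1 ≤ b.U.length) {s : Str}
    (hs : s.length = n) : b.ContainedIn n s ↔
      Free (b.U.length - 1) b.run ∧ ∀ i < n, b.Allows i (s.getD i 0) := by
  obtain ⟨hT, hR, hn, -⟩ := hb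
  set p := b.U.length with hpdef
  have hlen : b.len = 2 * p + b.T - 1 := rfl
  set u := (s.drop b.L).take b.len with hu
  have hul : u.length = 2 * p + b.T - 1 := by simp [hu]; omega
  have hsl : ∀ j < b.T, slice s (b.L + j) (b.R + j) = (u.drop j).take (2 * p) := by
    intro j hj
    rw [slice, hu, List.drop_take, List.drop_drop, List.take_take]
    congr 1; omega
  have hget : ∀ i < b.len, u.getD i 0 = s.getD (b.L + i) 0 := by
    intro i hi
    rw [List.getD_eq_getElem _ _ (by omega), List.getD_eq_getElem _ _ (by omega)]
    simp [hu]
  have hU : slice s b.L (b.L + p) = u.take p := by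
    rw [slice, hu, List.take_take, min_eq_left (by omega)]; congr 1; omega
  have hrun : u = b.run ↔ ∀ i < b.len, s.getD (b.L + i) 0 = b.per i := by
    constructor
    · intro h i hi
      rw [← hget i hi, h, List.getD_eq_getElem _ _ (by simpa using hi), b.run_getElem]
    · intro h
      refine List.ext_getElem (by simp [hul, hlen]) fun i h1 h2 => ?_
      rw [b.run_getElem, ← h i (by omega), ← hget i (by omega), List.getD_eq_getElem _ _ h1]
  have main : (slice s b.L (b.L + p) = b.U ∧
      (∀ j < b.T, MinimalSquare (slice s (b.L + j) (b.R + j)))) ↔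
      Free (p - 1) b.run ∧ u = b.run := by
    have h1 : (∀ j < b.T, MinimalSquare (slice s (b.L + j) (b.R + j))) ↔
        ∀ j < b.T, MinimalSquare ((u.drop j).take (2 * p)) :=
      forall₂_congr fun j hj => by rw [hsl j hj]
    rw [h1, windows_minimal_iff hp hT hul, hU]
    constructor
    · rintro ⟨h2, h3, h4⟩
      suffices hur : u = b.run from ⟨hur ▸ h4, hur⟩
      refine List.ext_getElem (by simp [hul, hlen]) fun i hi1 hi2 => ?_
      rw [b.run_getElem, ← List.getD_eq_getElem _ 0 hi1]
      induction i using Nat.strong_induction_on with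
      | _ i ih =>
        rcases Nat.lt_or_ge i p with hip | hip
        · rw [b.per_lt hip, List.getD_eq_getElem _ _ hi1]
          simp only [← h2, List.getElem_take]
        · obtain ⟨i', rfl⟩ := Nat.exists_eq_add_of_le' hip
          rw [b.per_add, ← h3 i' hi1]
          exact ih i' (by omega) (by omega) (by simp at hi2 ⊢; omega)
    · rintro ⟨h2, h3⟩
      refine ⟨?_, ?_, h3 ▸ h2⟩
      · rw [h3]
        refine List.ext_getElem (by simp [hlen]; omega) fun i hi1 hi2 => ?_
        simp [b.run_getElem, b.per_lt hi2]
      · intro i hi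
        rw [h3] at hi ⊢
        rw [List.getD_eq_getElem _ _ (by omega), List.getD_eq_getElem _ _ hi, b.run_getElem,
          b.run_getElem, b.per_add]
  have hleft : u = b.run → ((b.L = 0 ∨ ¬ MinimalSquare (slice s (b.L - 1) (b.R - 1))) ↔
      ∀ i < n, i + 1 = b.L → ¬ MinimalSquare (s.getD i 0 :: b.run.take (2 * p - 1))) := by
    intro h
    have h1 : 1 ≤ b.L → slice s (b.L - 1) (b.R - 1) =
        s.getD (b.L - 1) 0 :: b.run.take (2 * p - 1) := by
      intro h1
      rw [slice, List.drop_eq_getElem_cons (by omega), ← h, hu,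
        List.getD_eq_getElem _ _ (by omega), List.take_take,
        show b.R - 1 - (b.L - 1) = (2 * p - 1) + 1 by omega, List.take_succ_cons,
        min_eq_left (by omega), show b.L - 1 + 1 = b.L by omega]
    constructor
    · intro h2 i hi hiL
      have h3 := h2.resolve_left (by omega)
      rw [h1 (by omega), show b.L - 1 = i by omega] at h3
      exact h3
    · intro h2
      by_cases h0 : b.L = 0
      · exact Or.inl h0
      · right
        rw [h1 (by omega)]
        exact h2 _ (by omega) (by omega)
  have hright : u = b.run → ((n < b.R + b.T ∨ ¬ MinimalSquare (slice s (b.L + b.T) (b.R + b.T))) ↔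
      ∀ i < n, i = b.L + b.len → ¬ MinimalSquare (b.run.drop b.T ++ [s.getD i 0])) := by
    intro h
    have h1 : b.L + b.len < n → slice s (b.L + b.T) (b.R + b.T) =
        b.run.drop b.T ++ [s.getD (b.L + b.len) 0] := by
      intro h1
      rw [slice, ← h, hu, List.drop_take, List.drop_drop,
        show b.R + b.T - (b.L + b.T) = (b.len - b.T) + 1 by omega, List.take_add_one,
        List.getElem?_drop, show b.L + b.T + (b.len - b.T) = b.L + b.len by omega,
        List.getElem?_eq_getElem (by omega), List.getD_eq_getElem _ _ (by omega)]
      rfl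
    constructor
    · rintro h2 i hi rfl
      have h3 := h2.resolve_left (by omega)
      rw [h1 (by omega)] at h3
      exact h3
    · intro h2
      by_cases h0 : b.L + b.len < n
      · right
        rw [h1 h0]
        exact h2 _ h0 rfl
      · left; omega
  constructor
  · rintro ⟨h1, h2, h3, h4⟩
    obtain ⟨h5, h6⟩ := main.1 ⟨h1, h2⟩
    have h7 := hrun.1 h6
    refine ⟨h5, fun i hi => ⟨fun h8 h9 => ?_, (hleft h6).1 h3 i hi, (hright h6).1 h4 i hi⟩⟩
    have := h7 (i - b.L) (by omega)
    rwa [show b.L + (i - b.L) = i by omega] at this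
  · rintro ⟨h1, h2⟩
    have h6 : u = b.run := hrun.2 fun i hi => by
      have := (h2 (b.L + i) (by omega)).1 (by omega) (by omega)
      rwa [show b.L + i - b.L = i by omega] at this
    obtain ⟨h7, h8⟩ := main.2 ⟨h1, h6⟩
    exact ⟨h7, h8, (hleft h6).2 fun i hi => (h2 i hi).2.1, (hright h6).2 fun i hi => (h2 i hi).2.2⟩

/-- All batches of the list allow the letter `a` at position `i`. -/
def Allowed (bs : List Batch) (i : ℕ) (a : Fin 3) : Prop := ∀ b ∈ bs, b.Allows i a

/-- Some batch of the list determines the letter at position `i`. -/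
def Fixed (bs : List Batch) (i : ℕ) : Prop := ∃ b ∈ bs, b.L ≤ i ∧ i < b.L + b.len

/-- If no batch has empty squares, containment of the batches is a condition on single letters,
apart from a condition on the batches themselves. -/
lemma h_eq {n k : ℕ} {S : Finset Batch} {bs : List Batch} (hS : ∀ b ∈ S, b.Valid n)
    (hbs : ∀ b, b ∈ bs ↔ b ∈ S) (hp : ∀ b ∈ bs, 1 ≤ b.U.length) :
    h n k S = ind (∀ b ∈ bs, Free (b.U.length - 1) b.run) *
      count n fun s => (∀ i < n, Allowed bs i (s.getD i 0)) ∧ Free (n / k) s := by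
  rw [← count_and_left, count_eq_ncard, h]
  congr 1
  ext s
  simp only [Set.mem_ofPred_eq]
  refine and_congr_right fun hs => ?_
  have : (∀ b ∈ S, b.ContainedIn n s) ↔ (∀ b ∈ bs, Free (b.U.length - 1) b.run) ∧
      ∀ i < n, Allowed bs i (s.getD i 0) := by
    constructor
    · intro h
      have h' := fun b hb => (Batch.containedIn_iff (hS b ((hbs b).1 hb)) (hp b hb) hs).1
        (h b ((hbs b).1 hb))
      exact ⟨fun b hb => (h' b hb).1, fun i hi b hb => (h' b hb).2 i hi⟩
    · rintro ⟨h1, h2⟩ b hb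
      have hb' := (hbs b).2 hb
      exact (Batch.containedIn_iff (hS b hb) (hp b hb') hs).2
        ⟨h1 b hb', fun i hi => h2 i hi b hb'⟩
  rw [this, kPromising_iff]
  tauto

lemma h_eq_zero_of_forall {n k : ℕ} {S : Finset Batch}
    (H : ∀ s : Str, s.length = n → Free (n / k) s → (∀ b ∈ S, b.ContainedIn n s) → False) :
    h n k S = 0 := by
  rw [h]
  convert Set.ncard_empty Str
  ext s
  simp only [Set.mem_ofPred_eq, Set.mem_empty_iff_false, iff_false, kPromising_iff]
  exact fun ⟨h1, h2, h3⟩ => H s h1 h2 h3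

/-- A batch with short squares contradicts the absence of short squares; and an empty string `U`
does not occur in a batch. -/
lemma h_eq_zero_of_short {n k : ℕ} {S : Finset Batch} {b : Batch} (hb : b ∈ S)
    (hS : ∀ b ∈ S, b.Valid n) (hl : b.U.length ≤ n / k) : h n k S = 0 := by
  refine h_eq_zero_of_forall fun s hs hf hc => ?_
  obtain ⟨h1, h2, -, -⟩ := hS b hb
  obtain ⟨-, h4, -, -⟩ := hc b hb
  obtain ⟨⟨w, hw, he⟩, -⟩ := h4 0 h1
  have hlen : (slice s (b.L + 0) (b.R + 0)).length ≤ 2 * b.U.length := by simp [slice]; omega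
  refine hf w hw ?_ (he ▸ ?_)
  · rw [he] at hlen; simp at hlen; omega
  · exact (List.take_prefix _ _).isInfix.trans (List.drop_suffix _ _).isInfix

/-- A string contains at most one batch with given `L` and `R`. -/
lemma Batch.eq_of_containedIn {n : ℕ} {b c : Batch} {s : Str} (hb : b.Valid n) (hc : c.Valid n)
    (hbs : b.ContainedIn n s) (hcs : c.ContainedIn n s) (hL : b.L = c.L) (hR : b.R = c.R) :
    b = c := by
  have key : ∀ {b c : Batch}, c.Valid n → b.ContainedIn n s → c.ContainedIn n s →
      b.L = c.L → b.R = c.R → c.T ≤ b.T := by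
    intro b c hc hbs hcs hL hR
    by_contra hT
    rcases hbs.2.2.2 with h1 | h1
    · have := hc.2.2.1; omega
    · rw [hL, hR] at h1
      exact h1 (hcs.2.1 b.T (by omega))
  have hT : b.T = c.T := le_antisymm (key hb hcs hbs hL.symm hR.symm) (key hc hbs hcs hL hR)
  have hl : b.U.length = c.U.length := by have := hb.2.1; have := hc.2.1; omega
  have hU : b.U = c.U := by rw [← hbs.1, ← hcs.1, hL, hl]
  cases b; cases c; simp_all

/-- No string contains more batches than there are pairs of `L` and `R`. -/
lemma h_eq_zero_of_many {n k : ℕ} {S : Finset Batch} (hS : ∀ b ∈ S, b.Valid n)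
    (hc : (n + 1) * (n + 1) < S.card) : h n k S = 0 := by
  refine h_eq_zero_of_forall fun s hs hf hcont => ?_
  have : (Finset.range (n + 1) ×ˢ Finset.range (n + 1)).card < S.card := by simpa using hc
  obtain ⟨b, hb, c, hc', hbc, he⟩ := Finset.exists_ne_map_eq_of_card_lt_of_maps_to this
    (f := fun b => (b.L, b.R)) (by
      intro b hb
      have h1 := hS b hb
      obtain ⟨h2, h3, h4, -⟩ := h1
      simp; omega)
  simp only [Prod.mk.injEq] at he
  exact hbc (Batch.eq_of_containedIn (hS b hb) (hS c hc') (hcont b hb) (hcont c hc') he.1 he.2)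

/-! ### Counting across blocks and gaps -/

/-- A pattern for strings of length `n`: the letter at position `i` has to satisfy `ok i`. The
positions in `F` have at most one such letter, and form blocks that a square of half-length at
most `m` cannot cover; the others only have constraints if they are next to a block. -/
structure Pattern (n m : ℕ) (F : ℕ → Prop) (ok : ℕ → Fin 3 → Prop) : Prop where
  unique : ∀ i a b, F i → ok i a → ok i b → a = b
  free : ∀ i a, ¬ F i → (∀ j, i = j + 1 → ¬ F j) → ¬ F (i + 1) → ok i a
  block : ∀ i, F i → (∀ j, i = j + 1 → ¬ F j) → ∀ j ≤ 2 * m + 1, F (i + j)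
  lt : ∀ i, F i → i < n

/-- Batches without short squares give a pattern: a run is longer than `2 * m + 1`, and a batch only
constrains its run and the two letters next to it. -/
lemma pattern_of_batches {n m : ℕ} {bs : List Batch} (hS : ∀ b ∈ bs, b.Valid n)
    (hp : ∀ b ∈ bs, m < b.U.length) : Pattern n m (Fixed bs) (Allowed bs) := by
  refine ⟨?_, ?_, ?_, ?_⟩
  · rintro i a a' ⟨b, hb, h1, h2⟩ ha ha'
    rw [(ha b hb).1 h1 h2, (ha' b hb).1 h1 h2]
  · intro i a h1 h2 h3 b hb
    have := hp b hb
    have hT := (hS b hb).1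
    have hl : b.len = 2 * b.U.length + b.T - 1 := rfl
    refine ⟨fun h4 h5 => absurd ⟨b, hb, h4, h5⟩ h1, fun h4 => ?_, fun h4 => ?_⟩
    · exact absurd ⟨b, hb, by omega, by omega⟩ h3
    · exact absurd ⟨b, hb, by omega, by omega⟩ (h2 (i - 1) (by omega))
  · rintro i ⟨b, hb, h1, h2⟩ h3 j hj
    have := hp b hb
    have hT := (hS b hb).1
    have hl : b.len = 2 * b.U.length + b.T - 1 := rfl
    have hL : b.L = i := by
      by_contra hne
      exact h3 (i - 1) (by omega) ⟨b, hb, by omega, by omega⟩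
    exact ⟨b, hb, by omega, by omega⟩
  · rintro i ⟨b, hb, h1, h2⟩
    obtain ⟨h3, h4, h5, -⟩ := hS b hb
    have hl : b.len = 2 * b.U.length + b.T - 1 := rfl
    omega

section Pattern
variable {n m : ℕ} {F : ℕ → Prop} {ok : ℕ → Fin 3 → Prop}

/-- The number of strings on the positions `[i, n)` that match the pattern and can follow `q`. -/
noncomputable def rest (n m : ℕ) (ok : ℕ → Fin 3 → Prop) (q : Str) (i : ℕ) : ℕ :=
  count (n - i) fun t => (∀ j < n - i, ok (i + j) (t.getD j 0)) ∧ Free m (q ++ t)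

/-- The number of strings of length `g` from position `i` on that match the pattern and can be put
between `q` and `v`. -/
noncomputable def gap (m : ℕ) (ok : ℕ → Fin 3 → Prop) (q : Str) (i g : ℕ) (v : Str) : ℕ :=
  count g fun x => (∀ j < g, ok (i + j) (x.getD j 0)) ∧ Free m (q ++ x ++ v)

lemma rest_end (q : Str) : rest n m ok q n = ind (Free m q) := by
  simp [rest, count]

lemma rest_le (q : Str) (i : ℕ) : rest n m ok q i ≤ 3 ^ (n - i) := count_le _ _

/-- A position in a block has one candidate letter, which prolongs the left context. -/
lemma rest_fixed (hP : Pattern n m F ok) {q : Str} {i : ℕ} {c : Fin 3} (hi : F i) (hc : ok i c) :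
    rest n m ok q i = ind (Free m (q ++ [c])) * rest n m ok (q ++ [c]) (i + 1) := by
  have hin := hP.lt i hi
  obtain ⟨d, hd⟩ : ∃ d, n - i = d + 1 := ⟨n - i - 1, by omega⟩
  have hd' : n - (i + 1) = d := by omega
  rw [rest, rest, hd, hd', count, Finset.sum_eq_single c, ← count_and_left]
  · refine count_congr fun x hx => ?_
    have h1 : (∀ j < d + 1, ok (i + j) ((c :: x).getD j 0)) ↔
        ∀ j < d, ok (i + 1 + j) (x.getD j 0) := by
      constructor
      · intro h j hj
        have := h (j + 1) (by omega)
        rwa [List.getD_cons_succ, ← Nat.add_assoc, Nat.add_right_comm] at this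
      · intro h j hj
        cases j with
        | zero => simpa using hc
        | succ j =>
          rw [List.getD_cons_succ, ← Nat.add_assoc, Nat.add_right_comm]
          exact h j (by omega)
    rw [h1, List.append_assoc]
    constructor
    · rintro ⟨h2, h3⟩
      exact ⟨h3.infix ⟨[], x, by simp⟩, h2, h3⟩
    · rintro ⟨-, h2, h3⟩
      exact ⟨h2, h3⟩
  · intro a _ ha
    refine count_false _ fun x hx h => ha (hP.unique i a c hi ?_ hc)
    simpa using h.1 0 (by omega)
  · simp

lemma rest_gap_end {q : Str} {i : ℕ} : rest n m ok q i = gap m ok q i (n - i) [] := by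
  simp [rest, gap]

/-- The fillings of a gap are independent of what follows the first `2 * m` letters of the block
after it. -/
lemma rest_gap (hP : Pattern n m F ok) {S : ℕ → Fin 3} (hS : ∀ i, F i → ok i (S i)) {q : Str}
    {i y : ℕ} (hiy : i < y) (hy : F y) (hy' : ¬ F (y - 1)) :
    rest n m ok q i = gap m ok q i (y - i) ((List.range (2 * m)).map fun j => S (y + j)) *
      rest n m ok [] y := by
  have hyn := hP.lt y hy
  have hblock := hP.block y hy (fun j hj => by rwa [hj] at hy')
  have hbn := hP.lt _ (hblock (2 * m + 1) le_rfl)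
  rw [rest, show n - i = (y - i) + (n - y) by omega, gap, rest, ← count_append]
  refine count_congr fun t ht => ?_
  have hx : (t.take (y - i)).length = y - i := by simp; omega
  have ht' : (t.drop (y - i)).length = n - y := by simp; omega
  have h1 : (∀ j < y - i + (n - y), ok (i + j) (t.getD j 0)) ↔
      (∀ j < y - i, ok (i + j) ((t.take (y - i)).getD j 0)) ∧
      ∀ j < n - y, ok (y + j) ((t.drop (y - i)).getD j 0) := by
    constructor
    · intro h
      refine ⟨fun j hj => ?_, fun j hj => ?_⟩
      · have := h j (by omega)
        rw [List.getD_eq_getElem _ _ (by omega)] at this ⊢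
        simpa using this
      · have := h (y - i + j) (by omega)
        rw [List.getD_eq_getElem _ _ (by omega)] at this ⊢
        rw [show i + (y - i + j) = y + j by omega] at this
        simpa using this
    · rintro ⟨h1, h2⟩ j hj
      rcases Nat.lt_or_ge j (y - i) with h | h
      · have := h1 j h
        rw [List.getD_eq_getElem _ _ (by omega)] at this ⊢
        simpa using this
      · have := h2 (j - (y - i)) (by omega)
        rw [List.getD_eq_getElem _ _ (by omega)] at this ⊢
        simp only [List.getElem_drop, show y - i + (j - (y - i)) = j by omega,
          show y + (j - (y - i)) = i + j by omega] at this
        exact this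
  rw [h1]
  have h2 : (∀ j < n - y, ok (y + j) ((t.drop (y - i)).getD j 0)) →
      (t.drop (y - i)).take (2 * m) = (List.range (2 * m)).map fun j => S (y + j) := by
    intro h
    refine List.ext_getElem (by simp; omega) fun j h3 h4 => ?_
    have hj : j < 2 * m := by simpa using h4
    have h5 := h j (by omega)
    rw [List.getD_eq_getElem _ _ (by omega)] at h5
    have h6 := hblock j (by omega)
    simp only [List.getElem_take, List.getElem_map, List.getElem_range]
    exact hP.unique _ _ _ h6 h5 (hS _ h6)
  have h3 : (∀ j < n - y, ok (y + j) ((t.drop (y - i)).getD j 0)) →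
      (Free m (q ++ t) ↔ Free m (q ++ t.take (y - i) ++
        (List.range (2 * m)).map fun j => S (y + j)) ∧ Free m ([] ++ t.drop (y - i))) := by
    intro h
    have h4 : t = t.take (y - i) ++ ((t.drop (y - i)).take (2 * m) ++
        (t.drop (y - i)).drop (2 * m)) := by
      rw [List.take_append_drop, List.take_append_drop]
    have h5 : q ++ t = q ++ t.take (y - i) ++ (t.drop (y - i)).take (2 * m) ++
        (t.drop (y - i)).drop (2 * m) := by
      conv_lhs => rw [h4]
      simp only [List.append_assoc]
    rw [h5, free_append_append_iff (by simp; omega), List.take_append_drop, h2 h,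
      List.nil_append]
  tauto

lemma gap_one (q : Str) (i : ℕ) (v : Str) :
    gap m ok q i 1 v = ∑ a : Fin 3, ind (ok i a) * fill m 0 (q ++ [a]) v.reverse := by
  rw [gap, count]
  refine Finset.sum_congr rfl fun a _ => ?_
  rw [fill_zero, List.reverse_reverse, count, ← ind_and]
  refine ind_congr ?_
  simp

/-- The first and the last letter of a gap, which alone are constrained, become part of the
contexts. -/
lemma gap_add_two (q : Str) (i g : ℕ) (v : Str) (hfree : ∀ j, j < g → ∀ a, ok (i + 1 + j) a) :
    gap m ok q i (g + 2) v = ∑ a : Fin 3, ∑ b : Fin 3, ind (ok i a) * (ind (ok (i + g + 1) b) *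
      fill m g (q ++ [a]) (v.reverse ++ [b])) := by
  rw [gap, count]
  refine Finset.sum_congr rfl fun a _ => ?_
  rw [count_concat]
  refine Finset.sum_congr rfl fun b _ => ?_
  rw [fill, ← count_and_left, ← count_and_left]
  refine count_congr fun x hx => ?_
  have h1 : (∀ j < g + 2, ok (i + j) ((a :: (x ++ [b])).getD j 0)) ↔
      ok i a ∧ ok (i + g + 1) b := by
    constructor
    · intro h
      have h2 := h 0 (by omega)
      have h3 := h (g + 1) (by omega)
      rw [List.getD_cons_succ, List.getD_append_right _ _ _ _ (by omega)] at h3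
      simp only [hx, Nat.sub_self] at h3
      exact ⟨by simpa using h2, by simpa [Nat.add_assoc] using h3⟩
    · rintro ⟨h2, h3⟩ j hj
      cases j with
      | zero => simpa using h2
      | succ j =>
        rcases Nat.lt_or_ge j g with hjg | hjg
        · have := hfree j hjg ((a :: (x ++ [b])).getD (j + 1) 0)
          rwa [Nat.add_right_comm, Nat.add_assoc] at this
        · have : j = g := by omega
          subst this
          rw [List.getD_cons_succ, List.getD_append_right _ _ _ _ (by omega)]
          simpa [hx, Nat.add_assoc] using h3
  rw [h1]
  simp [and_assoc]

end Pattern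

/-! ### Processing the batches of a query -/

notation "xAlive" => 50
notation "xBatch" => 51
notation "xStart" => 52
notation "xCount" => 53
notation "xPeriod" => 54
notation "xRun" => 55
notation "xRunLen" => 56
notation "xIdx" => 57
notation "xTarget" => 58

/-- Reads a batch; `xRun` becomes the number of its string `U`. -/
def readBatchProg : Com :=
  xStart ≔ .input (𝐯 xIn) ;;
  xCount ≔ .input (𝐯 xIn + 2) ;;
  xPeriod ≔ .input (𝐯 xIn + 3) ;;
  xRun ≔ 0 ;;
  .for xIdx (𝐯 xPeriod)
    (xRun ≔ 𝐯 xRun + .input (𝐯 xIn + 4 + 𝐯 xIdx) * .get aPow (𝐯 xIdx)) ;;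
  xIn ≔ 𝐯 xIn + 4 + 𝐯 xPeriod

/-- Extends the string `U` of a batch periodically to the interval that it determines. -/
def extendRunProg : Com :=
  xRunLen ≔ 2 * 𝐯 xPeriod + 𝐯 xCount - 1 ;;
  .for xIdx (𝐯 xRunLen - 𝐯 xPeriod)
    (xRun ≔ 𝐯 xRun +
      𝐯 xRun / .get aPow (𝐯 xIdx) % 3 * .get aPow (𝐯 xIdx + 𝐯 xPeriod))

/-- Tests the string determined by a batch for squares shorter than those of the batch. -/
def checkRunProg : Com :=
  xStr ≔ 𝐯 xRun ;;
  xLen ≔ 𝐯 xRunLen ;;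
  xMax ≔ 𝐯 xPeriod - 1 ;;
  freeProg ;;
  .ite (𝐯 xFree) .skip (xAlive ≔ 0)

/-- Fixes the letters that a batch determines. -/
def fixProg : Com :=
  .for xIdx (𝐯 xRunLen) (
    .store aFixed (𝐯 xStart + 𝐯 xIdx) 1 ;;
    .for xLetter 3 (
      .ite (𝐯 xLetter ≐ 𝐯 xRun / .get aPow (𝐯 xIdx) % 3) .skip
        (.store aBad ((𝐯 xStart + 𝐯 xIdx) * 3 + 𝐯 xLetter) 1)))

/-- Forbids the letter with the index `xTarget` if the string `xStr` is a minimal square. -/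
def forbidProg : Com :=
  xLen ≔ 2 * 𝐯 xPeriod ;;
  xMax ≔ 𝐯 xPeriod - 1 ;;
  .ite (𝐯 xStr % .get aPow (𝐯 xPeriod) ≐ 𝐯 xStr / .get aPow (𝐯 xPeriod))
    (freeProg ;; .ite (𝐯 xFree) (.store aBad (𝐯 xTarget) 1) .skip) .skip

/-- Forbids the letter that would extend a batch to the left. -/
def leftProg : Com :=
  .ite (𝐯 xStart) (
    .for xLetter 3 (
      xStr ≔ 𝐯 xLetter + 3 * (𝐯 xRun % .get aPow (2 * 𝐯 xPeriod - 1)) ;;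
      xTarget ≔ (𝐯 xStart - 1) * 3 + 𝐯 xLetter ;;
      forbidProg)) .skip

/-- Forbids the letter that would extend a batch to the right. -/
def rightProg : Com :=
  .ite (𝐯 xStart + 𝐯 xRunLen ≺ 𝐯 xN) (
    .for xLetter 3 (
      xStr ≔ 𝐯 xRun / .get aPow (𝐯 xCount) + 𝐯 xLetter * .get aPow (2 * 𝐯 xPeriod - 1) ;;
      xTarget ≔ (𝐯 xStart + 𝐯 xRunLen) * 3 + 𝐯 xLetter ;;
      forbidProg)) .skip

/-- Processes one batch. -/
def batchProg : Com :=
  readBatchProg ;;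
  .ite (𝐯 xM ≺ 𝐯 xPeriod)
    (extendRunProg ;; checkRunProg ;; fixProg ;; leftProg ;; rightProg) (xAlive ≔ 0)

lemma drop_getD {l r : List ℕ} {x i : ℕ} (h : l.drop x = r) (hi : i < r.length) :
    x + i < l.length ∧ l.getD (x + i) 0 = r.getD i 0 := by
  subst h
  simp only [List.length_drop] at hi
  refine ⟨by omega, ?_⟩
  rw [List.getD_eq_getElem _ _ (by omega), List.getD_eq_getElem _ _ (by simp; omega)]
  simp

lemma Batch.run_prefix_succ (b : Batch) (j : ℕ) :
    (List.range (j + 1)).map b.per = (List.range j).map b.per ++ [b.per j] := by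
  simp [List.range_succ]

lemma Batch.U_eq (b : Batch) : (List.range b.U.length).map b.per = b.U :=
  List.ext_getElem (by simp) fun i h1 h2 => by simp [b.per_lt h2]

lemma readBatchProg_does {M : Machine} {σ : State} {n : ℕ} {b : Batch} {rest : List ℕ}
    (hp : Powers M (n + 4) σ) (hb : b.Valid n) (hin : M.inp.drop (σ.var xIn) = encBatch b ++ rest)
    (hiB : M.inp.length + 16 < M.B) :
    Does M readBatchProg σ fun τ => τ.var xStart = b.L ∧ τ.var xCount = b.T ∧
      τ.var xPeriod = b.U.length ∧ τ.var xRun = num b.U ∧ M.inp.drop (τ.var xIn) = rest := by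
  obtain ⟨hT, hR, hn, -⟩ := hb
  have hB := hp.lt
  have hpA := hp.hA
  have hN := hp.hN
  have hlen : (encBatch b ++ rest).length = 4 + b.U.length + rest.length := by
    simp [encBatch, encStr]; omega
  have get : ∀ i < (encBatch b ++ rest).length, σ.var xIn + i < M.inp.length ∧
      M.inp.getD (σ.var xIn + i) 0 = (encBatch b ++ rest).getD i 0 := fun i hi => drop_getD hin hi
  have g0 := get 0 (by omega)
  have g2 := get 2 (by omega)
  have g3 := get 3 (by omega)
  simp only [Nat.add_zero] at g0
  have f0 : (encBatch b ++ rest).getD 0 0 = b.L := rfl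
  have f2 : (encBatch b ++ rest).getD 2 0 = b.T := rfl
  have f3 : (encBatch b ++ rest).getD 3 0 = b.U.length := rfl
  have f4 : ∀ (i : ℕ) (hi : i < b.U.length), (encBatch b ++ rest).getD (4 + i) 0 = b.U[i].val := by
    intro i hi
    rw [List.getD_append _ _ _ _ (by simp [encBatch, encStr]; omega)]
    rw [show 4 + i = i + 1 + 1 + 1 + 1 by omega]
    simp only [encBatch, encStr, List.getD_cons_succ]
    rw [List.getD_eq_getElem _ _ (by simpa using hi)]; simp
  rw [f0] at g0; rw [f2] at g2; rw [f3] at g3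
  refine Does.assign_seq (by simp [-List.getD_eq_getElem?_getD, g0]; omega)
    (by simp [-List.getD_eq_getElem?_getD, g0]; omega) ?_
  refine Does.assign_seq (by simp [-List.getD_eq_getElem?_getD, g2]; omega)
    (by simp [-List.getD_eq_getElem?_getD, g2]; omega) ?_
  refine Does.assign_seq (by simp [-List.getD_eq_getElem?_getD, g3]; omega)
    (by simp [-List.getD_eq_getElem?_getD, g3]; omega) ?_
  refine Does.assign_seq (by simp) (by simp; omega) ?_
  refine Does.seq (P := fun τ => τ.var xRun = num b.U) ?_ ?_
  · refine Does.for (K := b.U.length) (fun j τ => τ.var xRun = num (b.U.take j))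
      (by decide) (by omega) (by omega) ?_ ?_ ?_ ?_
    · intro j τ hf _ _
      simp [-List.getD_eq_getElem?_getD, hf.var xPeriod (by decide), g3]
    · intro j τ hj hf hjv hI
      have e1 : τ.arr aPow j = 3 ^ j := by
        rw [hf.arr _ (by decide)]; simpa using hp.eq j (by omega)
      have e2 : τ.var xIn = σ.var xIn := by rw [hf.var _ (by decide)]; simp
      have gj := get (4 + j) (by omega)
      rw [f4 j hj, ← Nat.add_assoc] at gj
      have hl := b.U[j].isLt
      have e3 : num (b.U.take j) + b.U[j].val * 3 ^ j = num (b.U.take (j + 1)) := by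
        rw [List.take_succ_eq_append_getElem hj, num_concat]; simp; omega
      have hb' := hp.num_lt (s := b.U.take (j + 1)) (by simp; omega)
      refine Does.assign ?_ ?_ ?_
      · simp [-List.getD_eq_getElem?_getD, e2, hjv, gj]; omega
      · simp [-List.getD_eq_getElem?_getD, e2, hjv, gj, e1, hI, e3]; omega
      · simp [-List.getD_eq_getElem?_getD, e2, hjv, gj, e1, hI, e3]
    · intro τ _ hI
      rw [hI, List.take_of_length_le le_rfl]
    · simp
  · intro τ hf hI
    have e1 : τ.var xIn = σ.var xIn := by rw [hf.var _ (by decide)]; simp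
    have e2 : τ.var xPeriod = b.U.length := by
      rw [hf.var _ (by decide)]; simp [-List.getD_eq_getElem?_getD, g3]
    have e3 : τ.var xStart = b.L := by
      rw [hf.var _ (by decide)]; simp [-List.getD_eq_getElem?_getD, g0]
    have e4 : τ.var xCount = b.T := by
      rw [hf.var _ (by decide)]; simp [-List.getD_eq_getElem?_getD, g2]
    have hdl := congrArg List.length hin
    rw [hlen, List.length_drop] at hdl
    refine Does.assign (by simp) (by simp [e1, e2]; omega) ⟨?_, ?_, ?_, ?_, ?_⟩
    · simp [e3]
    · simp [e4]
    · simp [e2]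
    · simp [hI]
    · have : (encBatch b).length = 4 + b.U.length := by simp [encBatch, encStr]; omega
      simp only [State.setVar_var, if_true, Exp.val_add, Exp.val_var, Exp.val_ofNat, e1, e2]
      rw [Nat.add_assoc, ← List.drop_drop, hin]
      exact List.drop_left' this

/-- The registers describe the batch `b`, with its string extended to length `l`. -/
structure Holds (b : Batch) (l : ℕ) (σ : State) : Prop where
  start : σ.var xStart = b.L
  count : σ.var xCount = b.T
  period : σ.var xPeriod = b.U.length
  run : σ.var xRun = num ((List.range l).map b.per)

lemma Holds.frame {b : Batch} {l : ℕ} {σ τ : State} {c : Com} (h : Holds b l σ) (hf : Frame c σ τ)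
    (hv : ∀ x ∈ c.wv, x ≠ xStart ∧ x ≠ xCount ∧ x ≠ xPeriod ∧ x ≠ xRun) : Holds b l τ :=
  ⟨(hf.var _ fun h => (hv _ h).1 rfl).trans h.start,
    (hf.var _ fun h => (hv _ h).2.1 rfl).trans h.count,
    (hf.var _ fun h => (hv _ h).2.2.1 rfl).trans h.period,
    (hf.var _ fun h => (hv _ h).2.2.2 rfl).trans h.run⟩

lemma extendRunProg_does {M : Machine} {σ : State} {n : ℕ} {b : Batch}
    (hp : Powers M (n + 4) σ) (hb : b.Valid n) (hU : 1 ≤ b.U.length)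
    (h : Holds b b.U.length σ) :
    Does M extendRunProg σ fun τ => Holds b b.len τ ∧ τ.var xRunLen = b.len := by
  obtain ⟨hT, hR, hn, -⟩ := hb
  have hB := hp.lt
  have hpA := hp.hA
  have hN := hp.hN
  have hlen : b.len = 2 * b.U.length + b.T - 1 := rfl
  refine Does.assign_seq (by simp) (by simp [h.period, h.count]; omega) ?_
  refine Does.for (K := b.len - b.U.length) (fun j τ =>
      τ.var xRun = num ((List.range (b.U.length + j)).map b.per)) (by decide) (by omega) (by omega)
      ?_ ?_ ?_ ?_
  · intro j τ hf _ _
    simp [hf.var xRunLen (by decide), hf.var xPeriod (by decide), h.period, h.count, hlen]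
  · intro j τ hj hf hjv hI
    have e1 : τ.arr aPow = σ.arr aPow := by rw [hf.arr _ (by decide)]; simp
    have e2 : τ.var xPeriod = b.U.length := by rw [hf.var _ (by decide)]; simp [h.period]
    have e3 := hp.eq j (by omega)
    have e4 := hp.eq (j + b.U.length) (by omega)
    have e5 : num ((List.range (b.U.length + j)).map b.per) / 3 ^ j % 3 = (b.per j).val := by
      rw [num_digit, List.getD_eq_getElem _ _ (by simp; omega)]; simp
    have e6 : num ((List.range (b.U.length + j)).map b.per) +
        (b.per j).val * 3 ^ (j + b.U.length) =
        num ((List.range (b.U.length + (j + 1))).map b.per) := by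
      rw [← Nat.add_assoc, b.run_prefix_succ, num_concat, List.length_map, List.length_range,
        Nat.add_comm b.U.length j, b.per_add]
    have hb' := hp.num_lt (s := (List.range (b.U.length + (j + 1))).map b.per) (by simp; omega)
    refine Does.assign ?_ ?_ ?_
    · simp [e2, hjv]; omega
    · simp only [Exp.val_add, Exp.val_var, Exp.val_mul, Exp.val_mod, Exp.val_div, Exp.val_get,
        Exp.val_ofNat, hI, hjv, e1, e2, e3, e4, e5, e6, hb']
    · simp only [Exp.val_add, Exp.val_var, Exp.val_mul, Exp.val_mod, Exp.val_div, Exp.val_get,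
        Exp.val_ofNat, hI, hjv, e1, e2, e3, e4, e5, e6]
      simp
  · intro τ hf hI
    rw [show b.U.length + (b.len - b.U.length) = b.len by omega] at hI
    refine ⟨⟨?_, ?_, ?_, hI⟩, ?_⟩
    · rw [hf.var _ (by decide)]; simp [h.start]
    · rw [hf.var _ (by decide)]; simp [h.count]
    · rw [hf.var _ (by decide)]; simp [h.period]
    · rw [hf.var _ (by decide)]; simp [h.period, h.count, hlen]
  · simp [h.run]

lemma checkRunProg_does {M : Machine} {σ : State} {n : ℕ} {b : Batch} {c : Prop}
    (hp : Powers M (n + 4) σ) (hb : b.Valid n) (hU : 1 ≤ b.U.length)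
    (h : Holds b b.len σ) (hl : σ.var xRunLen = b.len) (hc : σ.var xAlive = ind c) :
    Does M checkRunProg σ fun τ => τ.var xAlive = ind (c ∧ Free (b.U.length - 1) b.run) := by
  obtain ⟨hT, hR, hn, -⟩ := hb
  have hB := hp.lt
  have hlen : b.len = 2 * b.U.length + b.T - 1 := rfl
  have hrun := hp.num_lt (s := b.run) (by simp; omega)
  have hr : σ.var xRun = num b.run := h.run
  refine Does.assign_seq (by simp) (by simpa [hr] using hrun) ?_
  refine Does.assign_seq (by simp) (by simp [hl]; omega) ?_
  refine Does.assign_seq (by simp) (by simp [h.period]; omega) ?_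
  refine Does.seq (freeProg_does (d := n + 4) (m := b.U.length - 1) (s := b.run) (hp.congr rfl)
    (by simp [hr]) (by simp [hl]) (by simp [h.period]) (by simp; omega) (by omega)) ?_
  intro τ hf hfree
  have e1 : τ.var xAlive = ind c := by rw [hf.var _ (by decide)]; simp [hc]
  refine Does.ite (by simp) (fun hne => Does.skip ?_) (fun hne => Does.assign (by simp)
    (by simp; omega) ?_)
  · simp only [Exp.val_var, hfree, ne_eq, ind_eq_zero, not_not] at hne
    rw [e1, ind_congr (and_iff_left hne)]
  · simp only [Exp.val_var, hfree, ind_eq_zero] at hne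
    rw [ind_false (fun h => hne h.2)]; simp

lemma fixProg_does {M : Machine} {σ : State} {n : ℕ} {b : Batch}
    (hp : Powers M (n + 4) σ) (hb : b.Valid n) (hA : M.B ≤ M.A)
    (h : Holds b b.len σ) (hl : σ.var xRunLen = b.len) :
    Does M fixProg σ fun τ =>
      (∀ i, τ.arr aFixed i = 0 ↔ σ.arr aFixed i = 0 ∧ ¬ (b.L ≤ i ∧ i < b.L + b.len)) ∧
      ∀ i (a : Fin 3), τ.arr aBad (i * 3 + a.val) = 0 ↔ σ.arr aBad (i * 3 + a.val) = 0 ∧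
        (b.L ≤ i → i < b.L + b.len → a = b.per (i - b.L)) := by
  obtain ⟨hT, hR, hn, -⟩ := hb
  have hB := hp.lt
  have hN := hp.hN
  have hlen : b.len = 2 * b.U.length + b.T - 1 := rfl
  refine Does.for (K := b.len) (fun j τ =>
      (∀ i, τ.arr aFixed i = 0 ↔ σ.arr aFixed i = 0 ∧ ¬ (b.L ≤ i ∧ i < b.L + j)) ∧
      ∀ i (a : Fin 3), τ.arr aBad (i * 3 + a.val) = 0 ↔ σ.arr aBad (i * 3 + a.val) = 0 ∧
        (b.L ≤ i → i < b.L + j → a = b.per (i - b.L))) (by decide) (by omega) (by omega)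
      ?_ ?_ (fun τ _ h => h) ?_
  · intro j τ hf _ _
    simp [hf.var xRunLen (by decide), hl]
  · rintro j τ hj hf hjv ⟨h1, h2⟩
    have hH : Holds b b.len τ := h.frame hf (by decide)
    refine Does.store_seq (by simp) (by simp [hH.start, hjv]; omega) (by simp) (by simp; omega) ?_
    refine Does.for (K := 3) (fun c ρ =>
      ∀ i (a : Fin 3), ρ.arr aBad (i * 3 + a.val) = 0 ↔ τ.arr aBad (i * 3 + a.val) = 0 ∧
        ¬ (i = b.L + j ∧ a.val < c ∧ a ≠ b.per j)) (by decide) (by omega) (by omega) ?_ ?_ ?_ ?_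
    · simp
    · intro c ρ hc hf' hcv hI
      have e1 : ρ.arr aPow = σ.arr aPow := by
        rw [hf'.arr _ (by decide)]; simp [hf.arr aPow (by decide)]
      have e2 : ρ.var xIdx = j := by rw [hf'.var _ (by decide)]; simp [hjv]
      have e3 : ρ.var xRun = num b.run := by
        rw [hf'.var _ (by decide)]; exact hH.run
      have e4 : ρ.var xStart = b.L := by rw [hf'.var _ (by decide)]; simpa using hH.start
      have e5 := hp.eq j (by omega)
      have e6 : num b.run / 3 ^ j % 3 = (b.per j).val := by
        rw [num_digit, List.getD_eq_getElem _ _ (by simpa using hj), b.run_getElem]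
      have hpA := hp.hA
      refine Does.ite (by simp [e2]; omega) (fun hne => ?_) (fun hne => ?_)
      · simp only [Exp.val_eq, Exp.val_var, hcv, Exp.val_mod, Exp.val_div, Exp.val_get, e1, e2,
          e3, e5, e6, Exp.val_ofNat, ne_eq, ite_eq_right_iff, one_ne_zero, imp_false,
          not_not] at hne
        refine Does.skip fun v i a => ?_
        simp only [State.setVar_arr]
        rw [hI i a]
        refine and_congr_right fun _ => not_congr (and_congr_right fun _ => ?_)
        constructor
        · rintro ⟨q1, q2⟩; exact ⟨by omega, q2⟩
        · rintro ⟨q1, q2⟩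
          refine ⟨?_, q2⟩
          have : a.val ≠ (b.per j).val := fun h => q2 (Fin.ext h)
          omega
      · simp only [Exp.val_eq, Exp.val_var, hcv, Exp.val_mod, Exp.val_div, Exp.val_get, e1, e2,
          e3, e5, e6, Exp.val_ofNat, ite_eq_right_iff, one_ne_zero, imp_false] at hne
        refine Does.store (by simp) (by simp [e4, e2, hcv]; omega) (by simp) (by simp; omega) ?_
        intro v i a
        simp only [State.setVar_arr, State.setArr_arr, if_true, Exp.val_add, Exp.val_mul,
          Exp.val_var, e4, e2, hcv, Exp.val_ofNat, Exp.val_one, Function.update_apply]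
        have ha := a.isLt
        split_ifs with hia
        · have q1 : i = b.L + j := by omega
          have q2 : a.val = c := by omega
          have : a ≠ b.per j := fun h => hne (by rw [← q2, h])
          exact ⟨fun h => h.elim, fun h => absurd ⟨q1, by omega, this⟩ h.2⟩
        · rw [hI i a]
          refine and_congr_right fun _ => not_congr (and_congr_right fun q1 => ?_)
          constructor
          · rintro ⟨q2, q3⟩; exact ⟨by omega, q3⟩
          · rintro ⟨q2, q3⟩; exact ⟨by omega, q3⟩
    · intro ρ hf' hI v
      refine ⟨fun i => ?_, fun i a => ?_⟩
      · simp only [State.setVar_arr]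
        rw [hf'.arr _ (by decide)]
        simp only [State.setArr_arr, if_true, Exp.val_add, Exp.val_var, hH.start, hjv,
          Exp.val_one, Function.update_apply]
        split_ifs with hi
        · exact ⟨fun h => h.elim, fun h => absurd (by omega) h.2⟩
        · rw [h1 i]
          refine and_congr_right fun _ => not_congr ?_
          omega
      · simp only [State.setVar_arr]
        have ha := a.isLt
        rw [hI i a, h2 i a, and_assoc]
        refine and_congr_right fun _ => ?_
        constructor
        · rintro ⟨q1, q2⟩ q3 q4
          by_cases q5 : i = b.L + j
          · subst q5
            by_contra q6
            rw [Nat.add_sub_cancel_left] at q6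
            exact q2 ⟨rfl, ha, q6⟩
          · exact q1 q3 (by omega)
        · intro q1
          refine ⟨fun q2 q3 => q1 q2 (by omega), ?_⟩
          rintro ⟨rfl, -, q3⟩
          have := q1 (by omega) (by omega)
          rw [Nat.add_sub_cancel_left] at this
          exact q3 this
    · intro i a; simp
  · refine ⟨fun i => ?_, fun i a => ?_⟩
    · simp
    · simp only [State.setVar_arr, Nat.add_zero]
      exact ⟨fun h => ⟨h, fun h1 h2 => by omega⟩, fun h => h.1⟩

lemma forbidProg_does {M : Machine} {σ : State} {n p : ℕ} {s : Str}
    (hpw : Powers M (n + 4) σ) (hpd : σ.var xPeriod = p) (hp : 1 ≤ p) (hs : s.length = 2 * p)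
    (hpn : 2 * p ≤ n + 4) (hx : σ.var xStr = num s) (ht : σ.var xTarget < M.A) :
    Does M forbidProg σ fun τ => ∀ i, τ.arr aBad i = 0 ↔
      σ.arr aBad i = 0 ∧ ¬ (i = σ.var xTarget ∧ MinimalSquare s) := by
  have hB := hpw.lt
  have hA := hpw.hA
  have hmin := minimalSquare_iff hp hs
  have hpow := hpw.eq p (by omega)
  have hiff : num s % 3 ^ p = num s / 3 ^ p ↔ s.take p = s.drop p := by
    rw [← num_take, ← num_drop]
    exact ⟨fun h => num_inj (by simp; omega) h, fun h => by rw [h]⟩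
  refine Does.assign_seq (by simp) (by simp [hpd]; omega) ?_
  refine Does.assign_seq (by simp) (by simp [hpd]; omega) ?_
  refine Does.ite (by simp [hpd]; omega) (fun hne => ?_) (fun hne => ?_)
  · simp [hpd, hx, hpow, hiff] at hne
    refine Does.seq (freeProg_does (d := n + 4) (m := p - 1) (s := s) (hpw.congr rfl)
      (by simp [hx]) (by simp [hpd, hs]) (by simp [hpd]) (by omega) (by omega)) ?_
    intro τ hf hfree
    have e1 : τ.arr aBad = σ.arr aBad := by rw [hf.arr _ (by decide)]; simp
    have e2 : τ.var xTarget = σ.var xTarget := by rw [hf.var _ (by decide)]; simp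
    refine Does.ite (by simp) (fun hne' => ?_) (fun hne' => ?_)
    · simp only [Exp.val_var, hfree, ne_eq, ind_eq_zero, not_not] at hne'
      refine Does.store (by simp) (by simpa [e2] using ht) (by simp) (by simp; omega) fun i => ?_
      have hm : MinimalSquare s := hmin.2 ⟨hne, hne'⟩
      simp only [State.setArr_arr, if_true, Exp.val_var, e2, e1, Exp.val_one,
        Function.update_apply, hm, and_true]
      split_ifs with hi <;> simp [hi]
    · simp only [Exp.val_var, hfree, ind_eq_zero] at hne'
      refine Does.skip fun i => ?_
      have hm : ¬ MinimalSquare s := fun h => hne' (hmin.1 h).2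
      simp [e1, hm]
  · simp [hpd, hx, hpow, hiff] at hne
    refine Does.skip fun i => ?_
    have hm : ¬ MinimalSquare s := fun h => hne (hmin.1 h).1
    simp [hm]

lemma leftProg_does {M : Machine} {σ : State} {n : ℕ} {b : Batch}
    (hp : Powers M (n + 4) σ) (hb : b.Valid n) (hU : 1 ≤ b.U.length) (hA : M.B ≤ M.A)
    (h : Holds b b.len σ) :
    Does M leftProg σ fun τ => ∀ i (a : Fin 3), τ.arr aBad (i * 3 + a.val) = 0 ↔
      σ.arr aBad (i * 3 + a.val) = 0 ∧
        (i + 1 = b.L → ¬ MinimalSquare (a :: b.run.take (2 * b.U.length - 1))) := by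
  obtain ⟨hT, hR, hn, -⟩ := hb
  have hB := hp.lt
  have hN := hp.hN
  have hpA := hp.hA
  have hlen : b.len = 2 * b.U.length + b.T - 1 := rfl
  refine Does.ite (by simp) (fun hne => ?_) (fun hne => ?_)
  · have hL : b.L ≠ 0 := by simpa [h.start] using hne
    refine Does.for (K := 3) (fun c τ => ∀ i (a : Fin 3), τ.arr aBad (i * 3 + a.val) = 0 ↔
      σ.arr aBad (i * 3 + a.val) = 0 ∧
        (i + 1 = b.L → a.val < c → ¬ MinimalSquare (a :: b.run.take (2 * b.U.length - 1))))
        (by decide) (by omega) (by omega) (by simp) ?_ ?_ ?_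
    · intro c τ hc hf hcv hI
      have hH : Holds b b.len τ := h.frame hf (by decide)
      have hp' : Powers M (n + 4) τ := hp.congr (hf.arr _ (by decide))
      obtain ⟨a, ha⟩ : ∃ a : Fin 3, a = ⟨c, hc⟩ := ⟨_, rfl⟩
      have hac : a.val = c := by rw [ha]
      have e1 := hp'.eq (2 * b.U.length - 1) (by omega)
      have hr : τ.var xRun = num b.run := hH.run
      have e2 : c + 3 * (num b.run % 3 ^ (2 * b.U.length - 1)) =
          num (a :: b.run.take (2 * b.U.length - 1)) := by
        rw [num_cons, num_take, hac]
      have hsl : (a :: b.run.take (2 * b.U.length - 1)).length = 2 * b.U.length := by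
        simp; omega
      have hb' := hp.num_lt (s := a :: b.run.take (2 * b.U.length - 1)) (by omega)
      refine Does.assign_seq ?_ ?_ ?_
      · simp [hH.period]; omega
      · simp [hH.period, hr, e1, hcv, e2, hb']
      refine Does.assign_seq (by simp) (by simp [hH.start, hcv]; omega) ?_
      refine Does.mono (forbidProg_does (n := n) (p := b.U.length)
        (s := a :: b.run.take (2 * b.U.length - 1)) (hp'.congr rfl) (by simp [hH.period]) hU hsl
        (by omega) ?_ ?_) ?_
      · simp [hH.period, hr, e1, hcv, e2]
      · simp [hH.start, hcv]; omega
      · intro ρ hf' hρ v i x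
        have hx := x.isLt
        simp only [State.setVar_arr]
        rw [hρ]
        simp only [State.setVar_arr, State.setVar_var, if_true, Exp.val_add, Exp.val_mul,
          Exp.val_sub, Exp.val_var, Exp.val_one, Exp.val_ofNat, hH.start, hcv, Nat.reduceEqDiff,
          if_false]
        rw [hI i x, and_assoc]
        refine and_congr_right fun _ => ?_
        constructor
        · rintro ⟨q1, q2⟩ q3 q4 q5
          by_cases q6 : x = a
          · subst q6
            exact q2 ⟨by omega, q5⟩
          · have : x.val ≠ a.val := fun h => q6 (Fin.ext h)
            exact q1 q3 (by omega) q5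
        · intro q1
          refine ⟨fun q2 q3 => q1 q2 (by omega), ?_⟩
          rintro ⟨q2, q3⟩
          have q4 : i + 1 = b.L := by omega
          have q5 : x = a := Fin.ext (by omega)
          rw [← q5] at q3
          exact q1 q4 (by omega) q3
    · intro τ _ hI i a
      rw [hI i a]
      exact and_congr_right fun _ => ⟨fun q q1 => q q1 a.isLt, fun q q1 _ => q q1⟩
    · intro i a; simp
  · have hL : b.L = 0 := by simpa [h.start] using hne
    refine Does.skip fun i a => ?_
    rw [hL]; simp

lemma rightProg_does {M : Machine} {σ : State} {n : ℕ} {b : Batch}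
    (hp : Powers M (n + 4) σ) (hb : b.Valid n) (hU : 1 ≤ b.U.length) (hA : M.B ≤ M.A)
    (h : Holds b b.len σ) (hl : σ.var xRunLen = b.len) (hn' : σ.var xN = n) :
    Does M rightProg σ fun τ => ∀ i < n, ∀ (a : Fin 3), τ.arr aBad (i * 3 + a.val) = 0 ↔
      σ.arr aBad (i * 3 + a.val) = 0 ∧
        (i = b.L + b.len → ¬ MinimalSquare (b.run.drop b.T ++ [a])) := by
  obtain ⟨hT, hR, hn, -⟩ := hb
  have hB := hp.lt
  have hN := hp.hN
  have hpA := hp.hA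
  have hlen : b.len = 2 * b.U.length + b.T - 1 := rfl
  refine Does.ite (by simp) (fun hne => ?_) (fun hne => ?_)
  · have hL : b.L + b.len < n := by simpa [h.start, hl, hn'] using hne
    refine Does.for (K := 3) (fun c τ => ∀ i < n, ∀ (a : Fin 3),
      τ.arr aBad (i * 3 + a.val) = 0 ↔ σ.arr aBad (i * 3 + a.val) = 0 ∧
        (i = b.L + b.len → a.val < c → ¬ MinimalSquare (b.run.drop b.T ++ [a])))
        (by decide) (by omega) (by omega) (by simp) ?_ ?_ ?_
    · intro c τ hc hf hcv hI
      have hH : Holds b b.len τ := h.frame hf (by decide)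
      have hp' : Powers M (n + 4) τ := hp.congr (hf.arr _ (by decide))
      have hl' : τ.var xRunLen = b.len := by rw [hf.var _ (by decide)]; exact hl
      obtain ⟨a, ha⟩ : ∃ a : Fin 3, a = ⟨c, hc⟩ := ⟨_, rfl⟩
      have hac : a.val = c := by rw [ha]
      have e1 := hp'.eq (2 * b.U.length - 1) (by omega)
      have e1' := hp'.eq b.T (by omega)
      have hr : τ.var xRun = num b.run := hH.run
      have e2 : num b.run / 3 ^ b.T + c * 3 ^ (2 * b.U.length - 1) =
          num (b.run.drop b.T ++ [a]) := by
        rw [num_concat, num_drop, hac, List.length_drop, b.run_length]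
        congr 3; omega
      have hsl : (b.run.drop b.T ++ [a]).length = 2 * b.U.length := by
        simp; omega
      have hb' := hp.num_lt (s := b.run.drop b.T ++ [a]) (by omega)
      refine Does.assign_seq ?_ ?_ ?_
      · simp [hH.period, hH.count]; omega
      · simp [hH.period, hH.count, hr, e1, e1', hcv, e2, hb']
      refine Does.assign_seq (by simp) (by simp [hH.start, hl', hcv]; omega) ?_
      refine Does.mono (forbidProg_does (n := n) (p := b.U.length)
        (s := b.run.drop b.T ++ [a]) (hp'.congr rfl) (by simp [hH.period]) hU hsl
        (by omega) ?_ ?_) ?_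
      · simp [hH.period, hH.count, hr, e1, e1', hcv, e2]
      · simp [hH.start, hl', hcv]; omega
      · intro ρ hf' hρ v i hi x
        have hx := x.isLt
        simp only [State.setVar_arr]
        rw [hρ]
        simp only [State.setVar_arr, State.setVar_var, if_true, Exp.val_add, Exp.val_mul,
          Exp.val_var, Exp.val_ofNat, hH.start, hl', hcv, Nat.reduceEqDiff,
          if_false]
        rw [hI i hi x, and_assoc]
        refine and_congr_right fun _ => ?_
        constructor
        · rintro ⟨q1, q2⟩ q3 q4 q5
          by_cases q6 : x = a
          · subst q6
            exact q2 ⟨by omega, q5⟩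
          · have : x.val ≠ a.val := fun h => q6 (Fin.ext h)
            exact q1 q3 (by omega) q5
        · intro q1
          refine ⟨fun q2 q3 => q1 q2 (by omega), ?_⟩
          rintro ⟨q2, q3⟩
          have q4 : i = b.L + b.len := by omega
          have q5 : x = a := Fin.ext (by omega)
          rw [← q5] at q3
          exact q1 q4 (by omega) q3
    · intro τ _ hI i hi a
      rw [hI i hi a]
      exact and_congr_right fun _ => ⟨fun q q1 => q q1 a.isLt, fun q q1 _ => q q1⟩
    · intro i hi a; simp
  · have hL : ¬ b.L + b.len < n := by simpa [h.start, hl, hn'] using hne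
    refine Does.skip fun i hi a => ?_
    exact ⟨fun q => ⟨q, fun q1 => by omega⟩, fun q => q.1⟩

/-- The state of the machine after processing the batches `bs`. Once a batch with short squares
has been met, the arrays have no meaning. -/
structure Processed (n m : ℕ) (bs : List Batch) (σ : State) : Prop where
  alive : σ.var xAlive = ind (∀ b ∈ bs, m < b.U.length ∧ Free (b.U.length - 1) b.run)
  fixed : (∀ b ∈ bs, m < b.U.length) → ∀ i, σ.arr aFixed i = 0 ↔ ¬ Fixed bs i
  bad : (∀ b ∈ bs, m < b.U.length) → ∀ i < n, ∀ a : Fin 3,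
    σ.arr aBad (i * 3 + a.val) = 0 ↔ Allowed bs i a

lemma batchProg_does {M : Machine} {σ : State} {n m : ℕ} {b : Batch} {bs : List Batch}
    {rest : List ℕ} (hp : Powers M (n + 4) σ) (hb : b.Valid n) (hA : M.B ≤ M.A)
    (hn : σ.var xN = n) (hm : σ.var xM = m)
    (hin : M.inp.drop (σ.var xIn) = encBatch b ++ rest)
    (hiB : M.inp.length + 16 < M.B) (h : Processed n m bs σ) :
    Does M batchProg σ fun τ => Processed n m (bs ++ [b]) τ ∧ M.inp.drop (τ.var xIn) = rest := by
  have hB := hp.lt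
  have hmem : ∀ p : Batch → Prop, (∀ x ∈ bs ++ [b], p x) ↔ (∀ x ∈ bs, p x) ∧ p b := by
    intro p; simp [or_imp, forall_and]
  refine Does.seq (readBatchProg_does hp hb hin hiB) ?_
  rintro τ hf ⟨s1, s2, s3, s4, s5⟩
  have hp₁ := hp.congr (hf.arr aPow (by decide))
  have n₁ : τ.var xN = n := (hf.var _ (by decide)).trans hn
  have m₁ : τ.var xM = m := (hf.var _ (by decide)).trans hm
  have al₁ : τ.var xAlive = _ := (hf.var _ (by decide)).trans h.alive
  have fx₁ : τ.arr aFixed = σ.arr aFixed := hf.arr _ (by decide)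
  have bd₁ : τ.arr aBad = σ.arr aBad := hf.arr _ (by decide)
  refine Does.ite (by simp) (fun hne => ?_) (fun hne => ?_)
  · have hU : m < b.U.length := by simpa [m₁, s3] using hne
    refine Does.seq (extendRunProg_does hp₁ hb (by omega) ⟨s1, s2, s3, by rw [b.U_eq, s4]⟩) ?_
    rintro τ₂ hf₂ ⟨H₂, l₂⟩
    have hp₂ := hp₁.congr (hf₂.arr aPow (by decide))
    refine Does.seq (checkRunProg_does hp₂ hb (by omega) H₂ l₂
      ((hf₂.var _ (by decide)).trans al₁)) ?_
    intro τ₃ hf₃ al₃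
    have hp₃ := hp₂.congr (hf₃.arr aPow (by decide))
    have H₃ := H₂.frame hf₃ (by decide)
    have l₃ := (hf₃.var xRunLen (by decide)).trans l₂
    refine Does.seq (fixProg_does hp₃ hb hA H₃ l₃) ?_
    rintro τ₄ hf₄ ⟨fx₄, bd₄⟩
    have hp₄ := hp₃.congr (hf₄.arr aPow (by decide))
    have H₄ := H₃.frame hf₄ (by decide)
    have l₄ := (hf₄.var xRunLen (by decide)).trans l₃
    refine Does.seq (leftProg_does hp₄ hb (by omega) hA H₄) ?_
    rintro τ₅ hf₅ bd₅
    have hp₅ := hp₄.congr (hf₅.arr aPow (by decide))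
    have H₅ := H₄.frame hf₅ (by decide)
    have l₅ := (hf₅.var xRunLen (by decide)).trans l₄
    have n₅ : τ₅.var xN = n := by
      rw [hf₅.var _ (by decide), hf₄.var _ (by decide), hf₃.var _ (by decide),
        hf₂.var _ (by decide), n₁]
    refine Does.mono (rightProg_does hp₅ hb (by omega) hA H₅ l₅ n₅) ?_
    intro τ₆ hf₆ bd₆
    refine ⟨⟨?_, ?_, ?_⟩, ?_⟩
    · rw [hf₆.var _ (by decide), hf₅.var _ (by decide), hf₄.var _ (by decide), al₃, hmem]
      refine ind_congr ?_
      tauto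
    · intro hall i
      have hall' := ((hmem _).1 hall).1
      rw [hf₆.arr _ (by decide), hf₅.arr _ (by decide), fx₄, hf₃.arr _ (by decide),
        hf₂.arr _ (by decide), fx₁, h.fixed hall' i]
      simp only [Fixed, List.mem_append, List.mem_singleton]
      grind
    · intro hall i hi a
      have hall' := ((hmem _).1 hall).1
      rw [bd₆ i hi a, bd₅ i a, bd₄ i a, hf₃.arr _ (by decide), hf₂.arr _ (by decide), bd₁,
        h.bad hall' i hi a]
      rw [Allowed, Allowed, hmem, Batch.Allows]
      tauto
    · rw [hf₆.var _ (by decide), hf₅.var _ (by decide), hf₄.var _ (by decide),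
        hf₃.var _ (by decide), hf₂.var _ (by decide), s5]
  · have hU : ¬ m < b.U.length := by simpa [m₁, s3] using hne
    refine Does.assign (by simp) (by simp; omega) ⟨⟨?_, ?_, ?_⟩, ?_⟩
    · rw [ind_false]
      · simp
      · intro hall; exact hU ((hmem _).1 hall).2.1
    · intro hall; exact absurd ((hmem _).1 hall).2 hU
    · intro hall; exact absurd ((hmem _).1 hall).2 hU
    · simpa using s5

/-- Selects an allowed letter for every position. -/
def lettersProg : Com :=
  .for xIdx (𝐯 xN) (
    xOk ≔ 0 ;;
    .for xLetter 3 (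
      .ite (.get aBad (𝐯 xIdx * 3 + 𝐯 xLetter)) .skip
        (.store aLetter (𝐯 xIdx) (𝐯 xLetter) ;; xOk ≔ 1)) ;;
    .ite (𝐯 xOk) .skip (xAlive ≔ 0))

lemma lettersProg_does {M : Machine} {σ : State} {n : ℕ} {ok : ℕ → Fin 3 → Prop} {c : Prop}
    (hp : Powers M (n + 4) σ) (hA : M.B ≤ M.A) (hn : σ.var xN = n)
    (hok : ∀ i < n, ∀ a : Fin 3, σ.arr aBad (i * 3 + a.val) = 0 ↔ ok i a)
    (hc : σ.var xAlive = ind c) :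
    Does M lettersProg σ fun τ => τ.var xAlive = ind (c ∧ ∀ i < n, ∃ a, ok i a) ∧
      ∀ i < n, (∃ a, ok i a) → ∃ a : Fin 3, ok i a ∧ τ.arr aLetter i = a.val := by
  have hB := hp.lt
  have hN := hp.hN
  have hpA := hp.hA
  refine Does.for (K := n) (fun j τ => τ.var xAlive = ind (c ∧ ∀ i < j, ∃ a, ok i a) ∧
      ∀ i < j, (∃ a, ok i a) → ∃ a : Fin 3, ok i a ∧ τ.arr aLetter i = a.val)
      (by decide) (by omega) (by omega) ?_ ?_ (fun τ _ h => h) ?_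
  · intro j τ hf _ _
    simp [hf.var xN (by decide), hn]
  · rintro j τ hj hf hjv ⟨h1, h2⟩
    refine Does.assign_seq (by simp) (by simp; omega) ?_
    refine Does.seq (P := fun ρ => ρ.var xOk = ind (∃ a : Fin 3, ok j a) ∧
      ((∃ a : Fin 3, ok j a) → ∃ a : Fin 3, ok j a ∧ ρ.arr aLetter j = a.val) ∧
      ∀ i ≠ j, ρ.arr aLetter i = τ.arr aLetter i) ?_ ?_
    · refine Does.for (K := 3) (fun d ρ => ρ.var xOk = ind (∃ a : Fin 3, a.val < d ∧ ok j a) ∧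
        ((∃ a : Fin 3, a.val < d ∧ ok j a) → ∃ a : Fin 3, ok j a ∧ ρ.arr aLetter j = a.val) ∧
        ∀ i ≠ j, ρ.arr aLetter i = τ.arr aLetter i) (by decide) (by omega) (by omega) (by simp)
        ?_ ?_ ?_
      · rintro d ρ hd hf' hdv ⟨i1, i2, i3⟩
        obtain ⟨a, ha⟩ : ∃ a : Fin 3, a = ⟨d, hd⟩ := ⟨_, rfl⟩
        have had : a.val = d := by rw [ha]
        have e1 : ρ.var xIdx = j := by rw [hf'.var _ (by decide)]; simp [hjv]
        have e2 : ρ.arr aBad (j * 3 + d) = 0 ↔ ok j a := by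
          rw [hf'.arr _ (by decide)]
          simp only [State.setVar_arr]
          rw [hf.arr _ (by decide), ← had]; exact hok j hj a
        have hex : (∃ x : Fin 3, x.val < d + 1 ∧ ok j x) ↔
            (∃ x : Fin 3, x.val < d ∧ ok j x) ∨ ok j a := by
          constructor
          · rintro ⟨x, q1, q2⟩
            by_cases q3 : x = a
            · exact Or.inr (q3 ▸ q2)
            · have : x.val ≠ a.val := fun h => q3 (Fin.ext h)
              exact Or.inl ⟨x, by omega, q2⟩
          · rintro (⟨x, q1, q2⟩ | q)
            · exact ⟨x, by omega, q2⟩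
            · exact ⟨a, by omega, q⟩
        refine Does.ite (by simp [e1, hdv]; omega) (fun hne => ?_) (fun hne => ?_)
        · simp only [Exp.val_get, Exp.val_add, Exp.val_mul, Exp.val_var, Exp.val_ofNat, e1, hdv,
            ne_eq, e2] at hne
          refine Does.skip fun v => ?_
          rw [hex, or_iff_left hne]
          exact ⟨i1, i2, i3⟩
        · simp only [Exp.val_get, Exp.val_add, Exp.val_mul, Exp.val_var, Exp.val_ofNat, e1, hdv,
            e2] at hne
          refine Does.store_seq (by simp) (by simp [e1]; omega) (by simp) (by simp [hdv]; omega) ?_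
          refine Does.assign (by simp) (by simp; omega) fun v => ⟨?_, fun _ => ⟨a, hne, ?_⟩, ?_⟩
          · rw [ind_true (hex.2 (Or.inr hne))]; simp
          · simp [e1, hdv, had]
          · intro i hi
            simp [e1, hi, i3 i hi]
      · rintro ρ _ ⟨i1, i2, i3⟩
        have : (∃ a : Fin 3, a.val < 3 ∧ ok j a) ↔ ∃ a : Fin 3, ok j a :=
          ⟨fun ⟨a, _, h⟩ => ⟨a, h⟩, fun ⟨a, h⟩ => ⟨a, a.isLt, h⟩⟩
        rw [this] at i1 i2
        exact ⟨i1, i2, i3⟩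
      · refine ⟨?_, ?_, ?_⟩
        · rw [ind_false (by simp)]; simp
        · rintro ⟨a, h, -⟩; omega
        · simp
    · rintro ρ hf' ⟨i1, i2, i3⟩
      have e1 : ρ.var xAlive = τ.var xAlive := by rw [hf'.var _ (by decide)]; simp
      have key : ∀ i < j + 1, (∃ a, ok i a) → ∃ a : Fin 3, ok i a ∧ ρ.arr aLetter i = a.val := by
        intro i hi hex
        by_cases hij : i = j
        · subst hij; exact i2 hex
        · rw [i3 i hij]; exact h2 i (by omega) hex
      have hsplit : (∀ i < j + 1, ∃ a, ok i a) ↔ (∀ i < j, ∃ a, ok i a) ∧ ∃ a, ok j a := by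
        simp only [Nat.lt_succ_iff_lt_or_eq, or_imp, forall_and, forall_eq]
      refine Does.ite (by simp) (fun hne => ?_) (fun hne => ?_)
      · simp only [Exp.val_var, i1, ne_eq, ind_eq_zero, not_not] at hne
        refine Does.skip fun v => ⟨?_, key⟩
        rw [State.setVar_var, if_neg (by decide), e1, h1, hsplit]
        exact ind_congr (by tauto)
      · simp only [Exp.val_var, i1, ind_eq_zero] at hne
        refine Does.assign (by simp) (by simp; omega) fun v => ⟨?_, key⟩
        rw [ind_false (fun h => hne (hsplit.1 h.2).2)]; simp
  · simp [hc]

/-! ### Scanning the pattern -/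

notation "xScan" => 60
notation "xBlock" => 61
notation "xBlockLen" => 62
notation "xProd" => 63
notation "xEnd" => 64
notation "xRev" => 65
notation "xRevLen" => 66
notation "xGapSum" => 67
notation "xLeftNode" => 68
notation "xFirst" => 69
notation "xLast" => 70
notation "xInner" => 71

/-- Adds to `xGapSum` the number of fillings of a gap of length `xInner` between the left context
with node `xLeftNode` and the right context `xStr`. The contexts are exchanged if the table does
not provide for the right one. -/
def addFillProg : Com :=
  freeProg ;;
  .ite (𝐯 xFree) (
    findProg ;;
    .ite (𝐯 xNode ≺ 𝐯 xV2)
      (xGapSum ≔ 𝐯 xGapSum +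
        .get aTable ((𝐯 xInner * 𝐯 xV + 𝐯 xLeftNode) * 𝐯 xV2 + 𝐯 xNode))
      (xGapSum ≔ 𝐯 xGapSum +
        .get aTable ((𝐯 xInner * 𝐯 xV + 𝐯 xNode) * 𝐯 xV2 + 𝐯 xLeftNode))) .skip

/-- The nodes of the strings of length at most 1 are the first four. -/
lemma Dict.lt_four {P : List Str} {σ : State} (h : Dict P σ) {s : Str} {v : ℕ} (hs : s.length ≤ 1)
    (hv : v < P.length) (hls : LongestSuffix (· ∈ P) s (node P v)) : v < 4 := by
  have h4 := h.four
  match s, hs with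
  | [], _ =>
    have : node P v = node P 0 := by rw [h.trie.root]; simpa using hls.suffix
    have := h.trie.node_inj hv (by omega) this
    omega
  | [a], _ =>
    have ha := a.isLt
    have h1 := hls.max [a] (h.letters a ▸ node_mem (by omega)) List.suffix_rfl
    have h2 : node P v = node P (a.val + 1) := by
      rw [h.letters a]
      exact hls.suffix.eq_of_length_le h1
    have := h.trie.node_inj hv (by omega) h2
    omega

lemma fill_le {m g n : ℕ} {q r : Str} (h : g ≤ n) : fill m g q r ≤ 3 ^ n :=
  (count_le _ _).trans (Nat.pow_le_pow_right (by norm_num) h)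

lemma table_index_lt {n g V V2 u v : ℕ} (hg : g ≤ n) (hu : u < V) (hv : v < V2) :
    (g * V + u) * V2 + v < (n + 1) * V * V2 := by
  have h1 : g * V + u + 1 ≤ (n + 1) * V := by
    have := Nat.mul_le_mul_right V (show g + 1 ≤ n + 1 by omega)
    rw [Nat.add_mul, Nat.one_mul] at this
    omega
  have h2 := Nat.mul_le_mul_right V2 h1
  rw [Nat.add_mul, Nat.one_mul] at h2
  omega

lemma addFillProg_does {M : Machine} {σ : State} {n m V2 g u : ℕ} {P : List Str} {q r : Str}
    (h : Tables M n m V2 ((n + 1) * P.length * V2) P σ) (hF : Fits M n m V2 P) (hV2 : 4 ≤ V2)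
    (hu : u < P.length) (hq : LongestSuffix (· ∈ P) q (node P u)) (hfq : Free m q)
    (hnode : σ.var xLeftNode = u) (hstr : σ.var xStr = num r) (hlen : σ.var xLen = r.length)
    (hr : r.length ≤ n + 4) (hmax : σ.var xMax = m) (hin : σ.var xInner = g) (hg : g ≤ n)
    (hsmall : V2 = P.length ∨ q.length ≤ 1 ∨ r.length ≤ 1)
    (hb : σ.var xGapSum + fill m g q r < M.B) :
    Does M addFillProg σ fun τ => τ.var xGapSum = σ.var xGapSum + fill m g q r := by
  have hbd := hF.bound
  have htA := hF.table
  have hml := hF.m_le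
  refine Does.seq (freeProg_does h.powers hstr hlen hmax hr (by omega)) ?_
  intro τ hf hfree
  have hT := h.frame hf (by decide) (by decide)
  refine Does.ite (by simp) (fun hne => ?_) (fun hne => ?_)
  · simp only [Exp.val_var, hfree, ne_eq, ind_eq_zero, not_not] at hne
    refine Does.seq (findProg_does hT.powers hT.dict.trie hF.mem (by omega)
      ((hf.var _ (by decide)).trans hstr) ((hf.var _ (by decide)).trans hlen) hr) ?_
    rintro ρ hf' ⟨hv, hls⟩
    obtain ⟨v, hv'⟩ : ∃ v, v = ρ.var xNode := ⟨_, rfl⟩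
    rw [← hv'] at hv hls
    have hT' := hT.frame hf' (by decide) (by decide)
    have e1 : ρ.var xGapSum = σ.var xGapSum := by rw [hf'.var _ (by decide), hf.var _ (by decide)]
    have e2 : ρ.var xInner = g := by rw [hf'.var _ (by decide), hf.var _ (by decide), hin]
    have e3 : ρ.var xLeftNode = u := by rw [hf'.var _ (by decide), hf.var _ (by decide), hnode]
    have e4 := hT'.dict.size
    have e5 := hT'.hV2
    have hfill : fill m g q r = fill m g (node P u) (node P v) :=
      fill_congr hF.covers g hfq hne hq hls
    refine Does.ite (by simp) (fun hne' => ?_) (fun hne' => ?_)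
    · have hvV : v < V2 := by simpa [← hv', e5] using hne'
      have hi := table_index_lt hg hu hvV
      have ht := (hT'.table _ hi).trans (cell_eq hu hvV)
      rw [← hfill] at ht
      refine Does.assign ?_ ?_ ?_
      · simp [e2, e3, e4, e5, ← hv']; omega
      · simpa [e1, e2, e3, e4, e5, ← hv', ht] using hb
      · simp [e1, e2, e3, e4, e5, ← hv', ht]
    · have hvV : ¬ v < V2 := by simpa [← hv', e5] using hne'
      have huV : u < V2 := by
        rcases hsmall with h1 | h1 | h1
        · omega
        · have := hT'.dict.lt_four h1 hu hq; omega
        · have := hT'.dict.lt_four h1 hv hls; omega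
      have hi := table_index_lt hg hv huV
      have ht := (hT'.table _ hi).trans (cell_eq hv huV)
      rw [fill_comm, ← hfill] at ht
      refine Does.assign ?_ ?_ ?_
      · simp [e2, e3, e4, e5, ← hv']; omega
      · simpa [e1, e2, e3, e4, e5, ← hv', ht] using hb
      · simp [e1, e2, e3, e4, e5, ← hv', ht]
  · simp only [Exp.val_var, hfree, ind_eq_zero] at hne
    refine Does.skip ?_
    rw [hf.var _ (by decide), fill_comm, fill_eq_zero hne]; rfl

/-- Adds the fillings of a gap of length at least 2 with a given first letter. -/
def lastLettersProg : Com :=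
  .for xLast 3 (
    .ite (.get aBad ((𝐯 xEnd - 1) * 3 + 𝐯 xLast)) .skip (
      xStr ≔ 𝐯 xRev + 𝐯 xLast * .get aPow (𝐯 xRevLen) ;;
      xLen ≔ 𝐯 xRevLen + 1 ;;
      xInner ≔ 𝐯 xEnd - 𝐯 xScan - 2 ;;
      addFillProg))

/-- Counts the fillings of the gap from `xScan` to `xEnd` between the block `xBlock` and the
reversed right context `xRev`. -/
def gapSumProg : Com :=
  xGapSum ≔ 0 ;;
  xMax ≔ 𝐯 xM ;;
  .for xFirst 3 (
    .ite (.get aBad (𝐯 xScan * 3 + 𝐯 xFirst)) .skip (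
      xStr ≔ 𝐯 xBlock + 𝐯 xFirst * .get aPow (𝐯 xBlockLen) ;;
      xLen ≔ 𝐯 xBlockLen + 1 ;;
      freeProg ;;
      .ite (𝐯 xFree) (
        findProg ;;
        xLeftNode ≔ 𝐯 xNode ;;
        .ite (𝐯 xEnd ≐ 𝐯 xScan + 1) (
          xStr ≔ 𝐯 xRev ;;
          xLen ≔ 𝐯 xRevLen ;;
          xInner ≔ 0 ;;
          addFillProg)
          lastLettersProg) .skip))

/-- The registers describe the gap `[i, y)` between `q` and `v`, and the forbidden letters. -/
structure GapCtx (M : Machine) (n m V2 : ℕ) (P : List Str) (ok : ℕ → Fin 3 → Prop) (q : Str)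
    (i y : ℕ) (v : Str) (σ : State) : Prop where
  tables : Tables M n m V2 ((n + 1) * P.length * V2) P σ
  bad : ∀ i < n, ∀ a : Fin 3, σ.arr aBad (i * 3 + a.val) = 0 ↔ ok i a
  block : σ.var xBlock = num q
  blockLen : σ.var xBlockLen = q.length
  scan : σ.var xScan = i
  gapEnd : σ.var xEnd = y
  rev : σ.var xRev = num v.reverse
  revLen : σ.var xRevLen = v.length

lemma GapCtx.frame {M : Machine} {n m V2 : ℕ} {P : List Str} {ok : ℕ → Fin 3 → Prop} {q : Str}
    {i y : ℕ} {v : Str} {σ τ : State} {c : Com} (h : GapCtx M n m V2 P ok q i y v σ)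
    (hf : Frame c σ τ)
    (hv : ∀ x ∈ c.wv, (x = 0 ∨ 5 ≤ x) ∧ x ≠ xScan ∧ x ≠ xBlock ∧ x ≠ xBlockLen ∧ x ≠ xEnd ∧
      x ≠ xRev ∧ x ≠ xRevLen) (ha : c.wa = []) : GapCtx M n m V2 P ok q i y v τ := by
  have hb : τ.arr aBad = σ.arr aBad := hf.arr _ (by simp [ha])
  exact ⟨h.tables.frame hf (fun x hx => (hv x hx).1) (by simp [ha]), by rw [hb]; exact h.bad,
    (hf.var _ fun h => (hv _ h).2.2.1 rfl).trans h.block,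
    (hf.var _ fun h => (hv _ h).2.2.2.1 rfl).trans h.blockLen,
    (hf.var _ fun h => (hv _ h).2.1 rfl).trans h.scan,
    (hf.var _ fun h => (hv _ h).2.2.2.2.1 rfl).trans h.gapEnd,
    (hf.var _ fun h => (hv _ h).2.2.2.2.2.1 rfl).trans h.rev,
    (hf.var _ fun h => (hv _ h).2.2.2.2.2.2 rfl).trans h.revLen⟩

lemma GapCtx.setVar {M : Machine} {n m V2 : ℕ} {P : List Str} {ok : ℕ → Fin 3 → Prop} {q : Str}
    {i y : ℕ} {v : Str} {σ : State} (h : GapCtx M n m V2 P ok q i y v σ) {x : ℕ} (w : ℕ)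
    (hx : (x = 0 ∨ 5 ≤ x) ∧ x ≠ xScan ∧ x ≠ xBlock ∧ x ≠ xBlockLen ∧ x ≠ xEnd ∧
      x ≠ xRev ∧ x ≠ xRevLen) : GapCtx M n m V2 P ok q i y v (σ.setVar x w) := by
  refine h.frame (c := .assign x 0) ⟨fun y hy => ?_, fun _ _ => rfl⟩ ?_ rfl
  · have : y ≠ x := by simpa [Com.wv] using hy
    simp [this]
  · simpa [Com.wv] using hx

/-- The number of fillings of a gap `[i, y)` with first letter `a`. -/
noncomputable def firstTerm (m : ℕ) (ok : ℕ → Fin 3 → Prop) (q : Str) (i y : ℕ) (v : Str)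
    (a : Fin 3) : ℕ :=
  ind (ok i a) * if y = i + 1 then fill m 0 (q ++ [a]) v.reverse else
    ∑ b : Fin 3, ind (ok (y - 1) b) * fill m (y - i - 2) (q ++ [a]) (v.reverse ++ [b])

lemma gap_eq_sum {m : ℕ} {ok : ℕ → Fin 3 → Prop} {q : Str} {i y : ℕ} {v : Str} (hiy : i < y)
    (hfree : ∀ j, i < j → j + 1 < y → ∀ a, ok j a) :
    gap m ok q i (y - i) v = ∑ a, firstTerm m ok q i y v a := by
  by_cases h : y = i + 1
  · subst h
    rw [Nat.add_sub_cancel_left, gap_one]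
    simp [firstTerm]
  · obtain ⟨g, rfl⟩ : ∃ g, y = i + (g + 2) := ⟨y - i - 2, by omega⟩
    rw [Nat.add_sub_cancel_left, gap_add_two _ _ _ _
      (fun j hj a => hfree _ (by omega) (by omega) a)]
    refine Finset.sum_congr rfl fun a _ => ?_
    rw [firstTerm, if_neg h, show i + (g + 2) - 1 = i + g + 1 by omega,
      show i + (g + 2) - i - 2 = g by omega, Finset.mul_sum]

lemma ind_mul_le (p : Prop) (x : ℕ) : ind p * x ≤ x :=
  (Nat.mul_le_mul_right x (ind_le p)).trans (by rw [Nat.one_mul])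

lemma lastLettersProg_does {M : Machine} {σ : State} {n m V2 u i y : ℕ} {P : List Str}
    {ok : ℕ → Fin 3 → Prop} {q v : Str} {a : Fin 3}
    (h : GapCtx M n m V2 P ok q i y v σ) (hF : Fits M n m V2 P) (hV2 : 4 ≤ V2)
    (hA : M.B ≤ M.A) (hiy : i + 1 < y) (hyn : y ≤ n) (hvn : v.length ≤ n)
    (hu : u < P.length) (hq : LongestSuffix (· ∈ P) (q ++ [a]) (node P u))
    (hfq : Free m (q ++ [a])) (hnode : σ.var xLeftNode = u) (hmax : σ.var xMax = m)
    (hsmall : V2 = P.length ∨ q = [] ∨ v = [])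
    (hb : σ.var xGapSum + 9 * 3 ^ n < M.B) :
    Does M lastLettersProg σ fun τ => τ.var xGapSum = σ.var xGapSum +
      ∑ b : Fin 3, ind (ok (y - 1) b) * fill m (y - i - 2) (q ++ [a]) (v.reverse ++ [b]) := by
  have hB := h.tables.powers.lt
  have hN := h.tables.powers.hN
  have hpA := h.tables.powers.hA
  have hle : ∀ b : Fin 3, ind (ok (y - 1) b) *
      fill m (y - i - 2) (q ++ [a]) (v.reverse ++ [b]) ≤ 3 ^ n := fun b =>
    (ind_mul_le _ _).trans (fill_le (by omega))
  refine Does.for (K := 3) (fun c τ => τ.var xGapSum = σ.var xGapSum +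
      ∑ b ∈ Finset.univ.filter (fun b : Fin 3 => b.val < c),
        ind (ok (y - 1) b) * fill m (y - i - 2) (q ++ [a]) (v.reverse ++ [b]))
      (by decide) (by omega) (by omega) (by simp) ?_ ?_ ?_
  · intro c τ hc hf hcv hI
    obtain ⟨b, hb'⟩ : ∃ b : Fin 3, b = ⟨c, hc⟩ := ⟨_, rfl⟩
    have hbc : b.val = c := by rw [hb']
    have hC := h.frame hf (by decide) (by decide)
    have e1 : τ.var xLeftNode = u := (hf.var _ (by decide)).trans hnode
    have e2 : τ.var xMax = m := (hf.var _ (by decide)).trans hmax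
    have hbad := hC.bad (y - 1) (by omega) b
    rw [hbc] at hbad
    have hsum := sum_letters_lt _ _ hle c
    refine Does.ite (by simp [hC.gapEnd, hcv]; omega) (fun hne => ?_) (fun hne => ?_)
    · simp only [Exp.val_get, Exp.val_add, Exp.val_mul, Exp.val_sub, Exp.val_var, Exp.val_one,
        Exp.val_ofNat, hC.gapEnd, hcv, ne_eq, hbad] at hne
      refine Does.skip fun w => ?_
      rw [sum_letters_succ _ hc, ← hb', ind_false hne]
      simpa using hI
    · simp only [Exp.val_get, Exp.val_add, Exp.val_mul, Exp.val_sub, Exp.val_var, Exp.val_one,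
        Exp.val_ofNat, hC.gapEnd, hcv, hbad] at hne
      have hrl : (v.reverse ++ [b]).length = v.length + 1 := by simp
      have e3 : num v.reverse + c * 3 ^ v.length = num (v.reverse ++ [b]) := by
        rw [num_concat, hbc, List.length_reverse]
      have hpw := hC.tables.powers.eq v.length (by omega)
      have hb'' := hC.tables.powers.num_lt (s := v.reverse ++ [b]) (by omega)
      refine Does.assign_seq ?_ ?_ ?_
      · simp [hC.revLen]; omega
      · simp [hC.rev, hC.revLen, hpw, hcv, e3, hb'']
      refine Does.assign_seq (by simp) (by simp [hC.revLen]; omega) ?_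
      refine Does.assign_seq (by simp) (by simp [hC.gapEnd, hC.scan]; omega) ?_
      have hf3 : fill m (y - i - 2) (q ++ [a]) (v.reverse ++ [b]) ≤ 3 ^ n := fill_le (by omega)
      refine Does.mono (addFillProg_does (n := n) (m := m) (V2 := V2) (g := y - i - 2) (u := u)
        (P := P) (q := q ++ [a]) (r := v.reverse ++ [b])
        (((hC.setVar _ (by decide)).setVar _ (by decide)).setVar _ (by decide)).tables hF hV2 hu hq
        hfq ?_ ?_ ?_ (by omega) ?_ ?_ (by omega) ?_ ?_) ?_
      · simp [e1]
      · simp [hC.rev, hC.revLen, hpw, hcv, e3]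
      · simp [hC.revLen]
      · simp [e2]
      · simp [hC.gapEnd, hC.scan]
      · rcases hsmall with h1 | h1 | h1 <;> simp [h1]
      · simp [hI]; omega
      · intro ρ _ hρ w
        rw [sum_letters_succ _ hc, ← hb', ind_true hne, Nat.one_mul]
        simp only [State.setVar_var, Nat.reduceEqDiff, if_false] at hρ ⊢
        rw [hρ, hI, Nat.add_assoc]
  · intro τ _ hI
    rw [hI, sum_letters_three]
  · simp

lemma gapSumProg_does {M : Machine} {σ : State} {n m V2 i y : ℕ} {P : List Str}
    {ok : ℕ → Fin 3 → Prop} {q v : Str}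
    (h : GapCtx M n m V2 P ok q i y v σ) (hF : Fits M n m V2 P) (hV2 : 4 ≤ V2)
    (hA : M.B ≤ M.A) (hiy : i < y) (hyn : y ≤ n) (hqn : q.length ≤ n) (hvn : v.length ≤ n)
    (hsmall : V2 = P.length ∨ q = [] ∨ v = [])
    (hfree : ∀ j, i < j → j + 1 < y → ∀ a, ok j a) :
    Does M gapSumProg σ fun τ => τ.var xGapSum = gap m ok q i (y - i) v := by
  have hB := h.tables.powers.lt
  have hN := h.tables.powers.hN
  have hpA := h.tables.powers.hA
  have hml := hF.m_le
  have h3n : 81 * 3 ^ n < M.B := by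
    have := h.tables.powers.hB
    have h3 : 0 < 3 ^ n := by positivity
    rw [show n + 4 + 3 = n + 7 by omega, pow_add] at this
    omega
  have hle : ∀ a : Fin 3, firstTerm m ok q i y v a ≤ 3 * 3 ^ n := by
    intro a
    refine (ind_mul_le _ _).trans ?_
    split_ifs
    · exact (fill_le (Nat.zero_le n)).trans (by omega)
    · calc _ ≤ ∑ _b : Fin 3, 3 ^ n := Finset.sum_le_sum fun b _ =>
            (ind_mul_le _ _).trans (fill_le (by omega))
        _ = 3 * 3 ^ n := by simp
  refine Does.assign_seq (by simp) (by simp; omega) ?_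
  refine Does.assign_seq (by simp) (by simp [h.tables.hm]; omega) ?_
  refine Does.for (K := 3) (fun c τ => τ.var xMax = m ∧ τ.var xGapSum =
      ∑ a ∈ Finset.univ.filter (fun a : Fin 3 => a.val < c), firstTerm m ok q i y v a)
      (by decide) (by omega) (by omega) (by simp) ?_ ?_ ?_
  · rintro c τ hc hf hcv ⟨hmax, hI⟩
    obtain ⟨a, ha⟩ : ∃ a : Fin 3, a = ⟨c, hc⟩ := ⟨_, rfl⟩
    have hac : a.val = c := by rw [ha]
    have hC := ((h.setVar (x := xGapSum) _ (by decide)).setVar (x := xMax) _ (by decide)).frame hf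
      (by decide) (by decide)
    have hbad := hC.bad i (by omega) a
    rw [hac] at hbad
    have hsum := sum_letters_lt _ _ hle c
    -- it suffices to add the term of the letter
    suffices H : Does M (.ite (.get aBad (𝐯 xScan * 3 + 𝐯 xFirst)) .skip (
        xStr ≔ 𝐯 xBlock + 𝐯 xFirst * .get aPow (𝐯 xBlockLen) ;;
        xLen ≔ 𝐯 xBlockLen + 1 ;;
        freeProg ;;
        .ite (𝐯 xFree) (
          findProg ;;
          xLeftNode ≔ 𝐯 xNode ;;
          .ite (𝐯 xEnd ≐ 𝐯 xScan + 1) (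
            xStr ≔ 𝐯 xRev ;;
            xLen ≔ 𝐯 xRevLen ;;
            xInner ≔ 0 ;;
            addFillProg)
            lastLettersProg) .skip)) τ
        fun ρ => ρ.var xGapSum = τ.var xGapSum + firstTerm m ok q i y v a by
      refine Does.mono H fun ρ hf' hρ w => ⟨?_, ?_⟩
      · rw [State.setVar_var, if_neg (by decide), hf'.var _ (by decide), hmax]
      · rw [State.setVar_var, if_neg (by decide), hρ, hI, sum_letters_succ _ hc, ha]
    refine Does.ite (by simp [hC.scan, hcv]; omega) (fun hne => ?_) (fun hne => ?_)
    · simp only [Exp.val_get, Exp.val_add, Exp.val_mul, Exp.val_var, Exp.val_ofNat, hC.scan, hcv,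
        ne_eq, hbad] at hne
      refine Does.skip ?_
      rw [firstTerm, ind_false hne, Nat.zero_mul, Nat.add_zero]
    · simp only [Exp.val_get, Exp.val_add, Exp.val_mul, Exp.val_var, Exp.val_ofNat, hC.scan, hcv,
        hbad] at hne
      have hql : (q ++ [a]).length = q.length + 1 := by simp
      have e3 : num q + c * 3 ^ q.length = num (q ++ [a]) := by rw [num_concat, hac]
      have hpw := hC.tables.powers.eq q.length (by omega)
      have hb'' := hC.tables.powers.num_lt (s := q ++ [a]) (by omega)
      refine Does.assign_seq ?_ ?_ ?_
      · simp [hC.blockLen]; omega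
      · simp [hC.block, hC.blockLen, hpw, hcv, e3, hb'']
      refine Does.assign_seq (by simp) (by simp [hC.blockLen]; omega) ?_
      have hC₁ := fun w w' => (hC.setVar (x := xStr) w (by decide)).setVar (x := xLen) w' (by decide)
      refine Does.seq (freeProg_does (d := n + 4) (m := m) (s := q ++ [a]) (hC₁ _ _).tables.powers
        ?_ ?_ ?_ (by omega) (by omega)) ?_
      · simp [hC.block, hC.blockLen, hpw, hcv, e3]
      · simp [hC.blockLen]
      · simp [hmax]
      intro τ₁ hf₁ hfr
      have hC₂ := (hC₁ _ _).frame hf₁ (by decide) (by decide)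
      have s₁ : τ₁.var xGapSum = τ.var xGapSum := by rw [hf₁.var _ (by decide)]; simp
      have m₁ : τ₁.var xMax = m := by rw [hf₁.var _ (by decide)]; simp [hmax]
      refine Does.ite (by simp) (fun hne' => ?_) (fun hne' => ?_)
      · simp only [Exp.val_var, hfr, ne_eq, ind_eq_zero, not_not] at hne'
        have hbd := hF.bound
        refine Does.seq (findProg_does (d := n + 4) (s := q ++ [a]) hC₂.tables.powers
          hC₂.tables.dict.trie hF.mem (by omega) ?_ ?_ (by omega)) ?_
        · rw [hf₁.var _ (by decide)]; simp [hC.block, hC.blockLen, hpw, hcv, e3]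
        · rw [hf₁.var _ (by decide)]; simp [hC.blockLen]
        rintro τ₂ hf₂ ⟨hu, hls⟩
        have hC₃ := hC₂.frame hf₂ (by decide) (by decide)
        have s₂ : τ₂.var xGapSum = τ.var xGapSum := (hf₂.var _ (by decide)).trans s₁
        have m₂ : τ₂.var xMax = m := (hf₂.var _ (by decide)).trans m₁
        refine Does.assign_seq (by simp) (by simp; omega) ?_
        have hC₄ := hC₃.setVar (x := xLeftNode) (τ₂.var xNode) (by decide)
        refine Does.ite (by simp) (fun hne'' => ?_) (fun hne'' => ?_)
        · have hy : y = i + 1 := by simpa [hC₃.gapEnd, hC₃.scan] using hne''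
          have hvl : v.reverse.length = v.length := by simp
          have hvb := hC₃.tables.powers.num_lt (s := v.reverse) (by omega)
          have hf3 : fill m 0 (q ++ [a]) v.reverse ≤ 3 ^ n := fill_le (Nat.zero_le n)
          refine Does.assign_seq (by simp) (by simp [hC₃.rev, hvb]) ?_
          refine Does.assign_seq (by simp) (by simp [hC₃.revLen]; omega) ?_
          refine Does.assign_seq (by simp) (by simp; omega) ?_
          refine Does.mono (addFillProg_does (n := n) (m := m) (V2 := V2) (g := 0)
            (u := τ₂.var xNode) (P := P) (q := q ++ [a]) (r := v.reverse)
            (((hC₄.setVar _ (by decide)).setVar _ (by decide)).setVar _ (by decide)).tables hF hV2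
            hu hls hne' ?_ ?_ ?_ (by omega) ?_ ?_ (by omega) ?_ ?_) ?_
          · simp
          · simp [hC₃.rev]
          · simp [hC₃.revLen]
          · simp [m₂]
          · simp
          · rcases hsmall with h1 | h1 | h1 <;> simp [h1]
          · simp [s₂, hI]; omega
          · intro ρ _ hρ
            rw [hρ, firstTerm, if_pos hy, ind_true hne, Nat.one_mul]
            simp [s₂]
        · have hy : ¬ y = i + 1 := by simpa [hC₃.gapEnd, hC₃.scan] using hne''
          refine Does.mono (lastLettersProg_does (a := a) hC₄ hF hV2 hA (by omega) hyn hvn hu hls hne'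
            (by simp) (by simp [m₂]) hsmall (by simp [s₂, hI]; omega)) ?_
          intro ρ _ hρ
          rw [hρ, firstTerm, if_neg hy, ind_true hne, Nat.one_mul]
          simp [s₂]
      · simp only [Exp.val_var, hfr, ind_eq_zero] at hne'
        refine Does.skip ?_
        have : firstTerm m ok q i y v a = 0 := by
          rw [firstTerm]; simp [fill_eq_zero hne']
        rw [this, s₁, Nat.add_zero]
  · rintro τ _ ⟨_, hI⟩
    rw [hI, sum_letters_three, gap_eq_sum hiy hfree]
  · simp [h.tables.hm]

/-- Extends the block by the letter at position `xScan`. -/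
def blockStepProg : Com :=
  xBlock ≔ 𝐯 xBlock + .get aLetter (𝐯 xScan) * .get aPow (𝐯 xBlockLen) ;;
  xBlockLen ≔ 𝐯 xBlockLen + 1 ;;
  xStr ≔ 𝐯 xBlock ;;
  xLen ≔ 𝐯 xBlockLen ;;
  xMax ≔ 𝐯 xM ;;
  freeProg ;;
  xProd ≔ 𝐯 xProd * 𝐯 xFree ;;
  xScan ≔ 𝐯 xScan + 1

/-- Finds the end of the gap that begins at position `xScan`. -/
def gapEndProg : Com :=
  xEnd ≔ 𝐯 xScan ;;
  .while ((𝐯 xEnd ≺ 𝐯 xN) * (.get aFixed (𝐯 xEnd) ≐ 0)) (xEnd ≔ 𝐯 xEnd + 1)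

/-- Computes the right context of a gap: as much of the following block as a short square that
meets the gap can cover, or nothing at the end of the string. -/
def contextRevProg : Com :=
  xRev ≔ 0 ;;
  xRevLen ≔ 0 ;;
  .ite (𝐯 xEnd ≺ 𝐯 xN) (
    .for xIdx (2 * 𝐯 xM) (xRev ≔ .get aLetter (𝐯 xEnd + 𝐯 xIdx) + 3 * 𝐯 xRev) ;;
    xRevLen ≔ 2 * 𝐯 xM) .skip

/-- Multiplies `xProd` by the number of fillings of the gap that begins at position `xScan`. -/
def gapStepProg : Com :=
  gapEndProg ;;
  contextRevProg ;;
  gapSumProg ;;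
  xProd ≔ 𝐯 xProd * 𝐯 xGapSum ;;
  xScan ≔ 𝐯 xEnd ;;
  xBlock ≔ 0 ;;
  xBlockLen ≔ 0

/-- Computes the number of strings that match the pattern. -/
def scanProg : Com :=
  xScan ≔ 0 ;;
  xBlock ≔ 0 ;;
  xBlockLen ≔ 0 ;;
  xProd ≔ 1 ;;
  .while (𝐯 xScan ≺ 𝐯 xN) (.ite (.get aFixed (𝐯 xScan)) blockStepProg gapStepProg)

/-- The memory describes the pattern; `S` gives an allowed letter for each position. -/
structure PatternCtx (M : Machine) (n m V2 : ℕ) (P : List Str) (F : ℕ → Prop)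
    (ok : ℕ → Fin 3 → Prop) (S : ℕ → Fin 3) (σ : State) : Prop where
  tables : Tables M n m V2 ((n + 1) * P.length * V2) P σ
  bad : ∀ i < n, ∀ a : Fin 3, σ.arr aBad (i * 3 + a.val) = 0 ↔ ok i a
  fixed : ∀ i, σ.arr aFixed i = 0 ↔ ¬ F i
  letter : ∀ i < n, σ.arr aLetter i = (S i).val

/-- The scan is at position `i`, at the end of the block `q`, which is empty after a gap. -/
structure ScanAt (n m : ℕ) (F : ℕ → Prop) (ok : ℕ → Fin 3 → Prop) (i : ℕ) (q : Str)
    (σ : State) : Prop where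
  scan : σ.var xScan = i
  le : i ≤ n
  block : σ.var xBlock = num q
  blockLen : σ.var xBlockLen = q.length
  len : q.length ≤ i
  mem : ∀ j, i - q.length ≤ j → j < i → F j
  start : ∀ j, i - q.length = j + 1 → ¬ F j
  prod : σ.var xProd * rest n m ok q i = rest n m ok [] 0
  prod_le : σ.var xProd ≤ 3 ^ i
  free : σ.var xProd ≠ 0 → Free m q

section
variable {M : Machine} {n m V2 : ℕ} {P : List Str} {F : ℕ → Prop} {ok : ℕ → Fin 3 → Prop}
  {S : ℕ → Fin 3} {σ τ : State} {c : Com} {i y : ℕ} {q : Str}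

lemma PatternCtx.frame (h : PatternCtx M n m V2 P F ok S σ) (hf : Frame c σ τ)
    (hv : ∀ x ∈ c.wv, x = 0 ∨ 5 ≤ x) (ha : c.wa = []) : PatternCtx M n m V2 P F ok S τ := by
  have hb : ∀ a, τ.arr a = σ.arr a := fun a => hf.arr _ (by simp [ha])
  exact ⟨h.tables.frame hf hv (by simp [ha]), by rw [hb]; exact h.bad, by rw [hb]; exact h.fixed,
    by rw [hb]; exact h.letter⟩

lemma PatternCtx.setVar (h : PatternCtx M n m V2 P F ok S σ) {x : ℕ} (v : ℕ)
    (hx : x = 0 ∨ 5 ≤ x) : PatternCtx M n m V2 P F ok S (σ.setVar x v) :=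
  ⟨h.tables.frame (c := .assign x 0) ⟨fun y hy => by
      have : y ≠ x := by simpa [Com.wv] using hy
      simp [this], fun _ _ => rfl⟩ (by simpa [Com.wv] using hx) (by simp [Com.wa]), h.bad, h.fixed, h.letter⟩

/-- One factor of the product: a block is scanned letter by letter, as `rest_fixed` says. -/
lemma blockStepProg_does (h : PatternCtx M n m V2 P F ok S σ) (hF : Fits M n m V2 P)
    (hP : Pattern n m F ok) (hS : ∀ i < n, ok i (S i)) (hi : F i)
    (hs : ScanAt n m F ok i q σ) :
    Does M blockStepProg σ (ScanAt n m F ok (i + 1) (q ++ [S i])) := by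
  have hin := hP.lt i hi
  have hB := h.tables.powers.lt
  have hpA := h.tables.powers.hA
  have hml := hF.m_le
  have hql := hs.len
  have hl : (q ++ [S i]).length = q.length + 1 := by simp
  have hpw := h.tables.powers.eq q.length (by omega)
  have hlet := h.letter i hin
  have e3 : num q + (S i).val * 3 ^ q.length = num (q ++ [S i]) := by rw [num_concat]
  have hb := h.tables.powers.num_lt (s := q ++ [S i]) (by omega)
  have h3 := h.tables.powers.pow_lt (i := i) (by omega)
  refine Does.assign_seq ?_ ?_ ?_
  · simp [hs.scan, hs.blockLen]; omega
  · simp [hs.scan, hs.block, hs.blockLen, hpw, hlet, e3, hb]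
  refine Does.assign_seq (by simp) (by simp [hs.blockLen]; omega) ?_
  refine Does.assign_seq (by simp)
    (by simp [hs.scan, hs.block, hs.blockLen, hpw, hlet, e3, hb]) ?_
  refine Does.assign_seq (by simp) (by simp [hs.blockLen]; omega) ?_
  refine Does.assign_seq (by simp) (by simp [h.tables.hm]; omega) ?_
  refine Does.seq (freeProg_does (d := n + 4) (m := m) (s := q ++ [S i])
    (h.tables.powers.congr rfl) ?_ ?_ ?_ (by omega) (by omega)) ?_
  · simp [hs.scan, hs.block, hs.blockLen, hpw, hlet, e3]
  · simp [hs.blockLen]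
  · simp [h.tables.hm]
  intro τ hf hfr
  have e1 : τ.var xProd = σ.var xProd := by rw [hf.var _ (by decide)]; simp
  have e2 : τ.var xScan = i := by rw [hf.var _ (by decide)]; simp [hs.scan]
  have e4 : τ.var xBlock = num (q ++ [S i]) := by
    rw [hf.var _ (by decide)]
    simp [hs.scan, hs.block, hs.blockLen, hpw, hlet, e3]
  have e5 : τ.var xBlockLen = q.length + 1 := by rw [hf.var _ (by decide)]; simp [hs.blockLen]
  have hle := hs.prod_le
  have hle' : σ.var xProd * ind (Free m (q ++ [S i])) ≤ σ.var xProd :=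
    (Nat.mul_le_mul_left _ (ind_le _)).trans (by simp)
  refine Does.assign_seq (by simp) (by simp [e1, hfr]; omega) ?_
  refine Does.assign (by simp) (by simp [e2]; omega) ?_
  have hx : ∀ v, ((τ.setVar xProd ((𝐯 xProd * 𝐯 xFree).val M.inp τ)).setVar xScan v).var xProd =
      σ.var xProd * ind (Free m (q ++ [S i])) := by
    intro v; simp [e1, hfr]
  refine ⟨by simp [e2], hin, by simp [e4], by simp [e5], by omega, ?_, ?_, ?_, ?_, ?_⟩
  · intro j h1 h2
    by_cases hj : j = i
    · exact hj ▸ hi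
    · exact hs.mem j (by omega) (by omega)
  · intro j hj
    exact hs.start j (by omega)
  · rw [hx, ← hs.prod, rest_fixed hP hi (hS i hin), Nat.mul_assoc]
  · rw [hx, pow_succ]; omega
  · rw [hx]
    intro hne
    by_contra hc
    exact hne (by rw [ind_false hc, Nat.mul_zero])

lemma gapEndProg_does (h : PatternCtx M n m V2 P F ok S σ)
    (hscan : σ.var xScan = i) (hin : i < n) (hi : ¬ F i) :
    Does M gapEndProg σ fun τ => ∃ y, τ.var xEnd = y ∧ i < y ∧ y ≤ n ∧ (y < n → F y) ∧
      ∀ j, i ≤ j → j < y → ¬ F j := by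
  have hB := h.tables.powers.lt
  have hN := h.tables.powers.hN
  have hpA := h.tables.powers.hA
  refine Does.assign_seq (by simp) (by simp [hscan]; omega) ?_
  refine Does.while (fun k τ => τ.var xEnd = i + k ∧ i + k ≤ n ∧
    ∀ j, i ≤ j → j < i + k → ¬ F j) ?_ ?_ ?_ ?_
  · rintro k τ hf ⟨h1, h2, h3⟩
    simp [h1]; omega
  · rintro k τ hf ⟨h1, h2, h3⟩ hne
    have hn : τ.var xN = n := by rw [hf.var _ (by decide)]; simp [h.tables.hn]
    have hfx : τ.arr aFixed (i + k) = 0 ↔ ¬ F (i + k) := by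
      rw [hf.arr _ (by decide)]; exact h.fixed _
    have hne' : i + k < n ∧ ¬ F (i + k) := by
      simp only [Exp.val_mul, Exp.val_lt, Exp.val_eq, Exp.val_get, Exp.val_var, Exp.val_zero, h1,
        hn] at hne
      split_ifs at hne with q1 q2
      · exact ⟨q1, hfx.1 q2⟩
      all_goals simp at hne
    refine ⟨by omega, Does.assign (by simp) (by simp [h1]; omega) ⟨by simp [h1]; omega, by omega, ?_⟩⟩
    intro j hj hj'
    by_cases hjk : j = i + k
    · exact hjk ▸ hne'.2
    · exact h3 j hj (by omega)
  · rintro k τ hf ⟨h1, h2, h3⟩ hne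
    have hn : τ.var xN = n := by rw [hf.var _ (by decide)]; simp [h.tables.hn]
    have hfx : τ.arr aFixed (i + k) = 0 ↔ ¬ F (i + k) := by
      rw [hf.arr _ (by decide)]; exact h.fixed _
    have hne' : i + k < n → F (i + k) := by
      intro q1
      by_contra q2
      simp only [Exp.val_mul, Exp.val_lt, Exp.val_eq, Exp.val_get, Exp.val_var, Exp.val_zero, h1,
        hn, hfx.2 q2] at hne
      simp [q1] at hne
    have hk : k ≠ 0 := by
      rintro rfl
      exact hi (hne' hin)
    exact ⟨i + k, h1, by omega, h2, hne', h3⟩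
  · exact ⟨by simp [hscan], by omega, fun j h1 h2 => by omega⟩

/-- The right context of a gap with end `y`. -/
def rightContext (n m : ℕ) (S : ℕ → Fin 3) (y : ℕ) : Str :=
  if y < n then (List.range (2 * m)).map fun j => S (y + j) else []

lemma contextRevProg_does (h : PatternCtx M n m V2 P F ok S σ) (hF : Fits M n m V2 P)
    (hP : Pattern n m F ok) (hend : σ.var xEnd = y)
    (hy : y < n → F y) (hy' : ∀ j, y = j + 1 → ¬ F j) :
    Does M contextRevProg σ fun τ => τ.var xRev = num (rightContext n m S y).reverse ∧
      τ.var xRevLen = (rightContext n m S y).length := by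
  have hB := h.tables.powers.lt
  have hN := h.tables.powers.hN
  have hpA := h.tables.powers.hA
  have hml := hF.m_le
  refine Does.assign_seq (by simp) (by simp; omega) ?_
  refine Does.assign_seq (by simp) (by simp; omega) ?_
  refine Does.ite (by simp) (fun hne => ?_) (fun hne => ?_)
  · have hyn : y < n := by simpa [hend, h.tables.hn] using hne
    have hbl := hP.lt _ (hP.block y (hy hyn) hy' (2 * m + 1) le_rfl)
    rw [rightContext, if_pos hyn]
    refine Does.seq (P := fun τ => τ.var xRev =
      num ((List.range (2 * m)).map fun j => S (y + j)).reverse) ?_ ?_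
    · refine Does.for (K := 2 * m) (fun j τ => τ.var xRev =
        num ((List.range j).map fun j => S (y + j)).reverse)
        (by decide) (by omega) (by omega) ?_ ?_ (fun τ _ h => h) ?_
      · intro j τ hf _ _
        simp [hf.var xM (by decide), h.tables.hm]
      · intro j τ hj hf hjv hI
        have e1 : τ.var xEnd = y := by rw [hf.var _ (by decide)]; simp [hend]
        have e2 : τ.arr aLetter (y + j) = (S (y + j)).val := by
          rw [hf.arr _ (by decide)]; exact h.letter _ (by omega)
        have e3 : (S (y + j)).val + 3 * num ((List.range j).map fun j => S (y + j)).reverse =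
            num ((List.range (j + 1)).map fun j => S (y + j)).reverse := by
          rw [List.range_succ, List.map_append, List.reverse_append]
          simp [num_cons]
        have hb := h.tables.powers.num_lt
          (s := ((List.range (j + 1)).map fun j => S (y + j)).reverse) (by simp; omega)
        refine Does.assign ?_ ?_ ?_
        · simp [e1, hjv]; omega
        · simp only [Exp.val_get, Exp.val_add, Exp.val_mul, Exp.val_var, Exp.val_ofNat, e1, hjv,
            e2, hI, e3, hb]
        · intro v
          simp only [Exp.val_get, Exp.val_add, Exp.val_mul, Exp.val_var, Exp.val_ofNat, e1, hjv,
            e2, hI, e3, State.setVar_var]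
          simp
      · simp
    · intro τ hf hI
      have e1 : τ.var xM = m := by rw [hf.var _ (by decide)]; simp [h.tables.hm]
      exact Does.assign (by simp) (by simp [e1]; omega) ⟨by simp [hI], by simp [e1]⟩
  · have hyn : ¬ y < n := by simpa [hend, h.tables.hn] using hne
    rw [rightContext, if_neg hyn]
    exact Does.skip ⟨by simp, by simp⟩

lemma gap_le {v : Str} {g : ℕ} : gap m ok q i g v ≤ 3 ^ g := count_le _ _

lemma gapStepProg_does (h : PatternCtx M n m V2 P F ok S σ) (hF : Fits M n m V2 P)
    (hP : Pattern n m F ok) (hS : ∀ i < n, ok i (S i)) (hV2 : 4 ≤ V2) (hA : M.B ≤ M.A)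
    (hsmall : V2 = P.length ∨ n < 4 * m + 4) (hin : i < n) (hi : ¬ F i)
    (hs : ScanAt n m F ok i q σ) :
    Does M gapStepProg σ fun τ => ∃ y, i < y ∧ ScanAt n m F ok y [] τ := by
  have hB := h.tables.powers.lt
  have hpA := h.tables.powers.hA
  have hml := hF.m_le
  have hql := hs.len
  refine Does.seq (gapEndProg_does h hs.scan hin hi) ?_
  rintro τ₁ hf₁ ⟨y, hy, hiy, hyn, hFy, hgap⟩
  have h₁ := h.frame hf₁ (by decide) (by decide)
  refine Does.seq (contextRevProg_does h₁ hF hP hy hFy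
    fun j hj => hgap j (by omega) (by omega)) ?_
  rintro τ₂ hf₂ ⟨hr, hrl⟩
  have h₂ := h₁.frame hf₂ (by decide) (by decide)
  have hvl : (rightContext n m S y).length ≤ n := by
    rw [rightContext]; split_ifs <;> simp; omega
  have hC : GapCtx M n m V2 P ok q i y (rightContext n m S y) τ₂ := by
    refine ⟨h₂.tables, h₂.bad, ?_, ?_, ?_, (hf₂.var _ (by decide)).trans hy, hr, hrl⟩
    · rw [hf₂.var _ (by decide), hf₁.var _ (by decide), hs.block]
    · rw [hf₂.var _ (by decide), hf₁.var _ (by decide), hs.blockLen]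
    · rw [hf₂.var _ (by decide), hf₁.var _ (by decide), hs.scan]
  -- for `k = 4` there is no room for two blocks and a gap between them
  have hsm : V2 = P.length ∨ q = [] ∨ rightContext n m S y = [] := by
    rcases hsmall with h1 | h1
    · exact Or.inl h1
    · by_cases hq : q = []
      · exact Or.inr (Or.inl hq)
      · refine Or.inr (Or.inr ?_)
        have hq0 := List.length_pos_iff.2 hq
        have hbl := hP.block _ (hs.mem (i - q.length) le_rfl (by omega)) hs.start
        have hq2 : 2 * m + 1 < q.length := by
          by_contra hc
          have := hbl q.length (by omega)
          rw [Nat.sub_add_cancel hql] at this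
          exact hi this
        rw [rightContext, if_neg]
        intro hyn'
        have := hP.lt _ (hP.block y (hFy hyn') (fun j hj => hgap j (by omega) (by omega))
          (2 * m + 1) le_rfl)
        omega
  refine Does.seq (gapSumProg_does hC hF hV2 hA hiy hyn (by omega) hvl hsm ?_) ?_
  · intro j h1 h2 a
    exact hP.free j a (hgap j (by omega) (by omega)) (fun j' hj' => hgap j' (by omega) (by omega))
      (hgap _ (by omega) (by omega))
  intro τ₃ hf₃ hg
  have e1 : τ₃.var xProd = σ.var xProd := by
    rw [hf₃.var _ (by decide), hf₂.var _ (by decide), hf₁.var _ (by decide)]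
  have e2 : τ₃.var xEnd = y := (hf₃.var _ (by decide)).trans hC.gapEnd
  have hle : σ.var xProd * gap m ok q i (y - i) (rightContext n m S y) ≤ 3 ^ y := by
    have := Nat.mul_le_mul hs.prod_le
      (gap_le (m := m) (ok := ok) (q := q) (i := i) (v := rightContext n m S y) (g := y - i))
    rwa [← pow_add, show i + (y - i) = y by omega] at this
  have hlt := h.tables.powers.pow_lt (i := y) (by omega)
  have hrest : rest n m ok q i = gap m ok q i (y - i) (rightContext n m S y) *
      rest n m ok [] y := by
    rw [rightContext]
    split_ifs with hyn'
    · exact rest_gap hP (fun j hj => hS j (hP.lt j hj)) hiy (hFy hyn') (hgap _ (by omega) (by omega))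
    · have : y = n := by omega
      subst this
      rw [rest_end, ind_true (free_nil m), Nat.mul_one, rest_gap_end]
  refine Does.assign_seq (by simp) (by simp [e1, hg]; omega) ?_
  refine Does.assign_seq (by simp) (by simp [e2]; omega) ?_
  refine Does.assign_seq (by simp) (by simp; omega) ?_
  refine Does.assign (by simp) (by simp; omega) ⟨y, hiy, ?_⟩
  refine ⟨by simp [e2], hyn, by simp [num], by simp, by simp, ?_, ?_, ?_, ?_, ?_⟩
  · intro j h1 h2; simp at h1; omega
  · intro j hj; simp at hj; exact hgap j (by omega) (by omega)
  · simp [e1, hg, ← hs.prod, hrest, Nat.mul_assoc]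
  · simp [e1, hg, hle]
  · exact fun _ => free_nil m

lemma scanProg_does (h : PatternCtx M n m V2 P F ok S σ) (hF : Fits M n m V2 P)
    (hP : Pattern n m F ok) (hS : ∀ i < n, ok i (S i)) (hV2 : 4 ≤ V2) (hA : M.B ≤ M.A)
    (hsmall : V2 = P.length ∨ n < 4 * m + 4) :
    Does M scanProg σ fun τ => τ.var xProd = rest n m ok [] 0 := by
  have hB := h.tables.powers.lt
  have hN := h.tables.powers.hN
  have hpA := h.tables.powers.hA
  have h' := (((h.setVar (x := xScan) 0 (by decide)).setVar (x := xBlock) 0 (by decide)).setVar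
    (x := xBlockLen) 0 (by decide)).setVar (x := xProd) 1 (by decide)
  refine Does.assign_seq (by simp) (by simp; omega) ?_
  refine Does.assign_seq (by simp) (by simp; omega) ?_
  refine Does.assign_seq (by simp) (by simp; omega) ?_
  refine Does.assign_seq (by simp) (by simp; omega) ?_
  refine Does.while (fun j τ => ∃ i q, j ≤ i ∧ ScanAt n m F ok i q τ) (by simp) ?_ ?_ ?_
  · rintro j τ hf ⟨i, q, hji, hs⟩ hne
    have hc := h'.frame hf (by decide) (by decide)
    have hin : i < n := by simpa [hs.scan, hc.tables.hn] using hne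
    refine ⟨by omega, Does.ite (by simp [hs.scan]; omega) (fun hne' => ?_) (fun hne' => ?_)⟩
    · have hi : F i := by
        simpa only [Exp.val_get, Exp.val_var, hs.scan, ne_eq, hc.fixed, not_not] using hne'
      exact (blockStepProg_does hc hF hP hS hi hs).mono fun ρ _ hρ => ⟨_, _, by omega, hρ⟩
    · have hi : ¬ F i := by
        simpa only [Exp.val_get, Exp.val_var, hs.scan, hc.fixed] using hne'
      refine (gapStepProg_does hc hF hP hS hV2 hA hsmall hin hi hs).mono ?_
      rintro ρ _ ⟨y, hy, hρ⟩
      exact ⟨y, [], by omega, hρ⟩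
  · rintro j τ hf ⟨i, q, -, hs⟩ hne
    have hc := h'.frame hf (by decide) (by decide)
    have hin : ¬ i < n := by simpa [hs.scan, hc.tables.hn] using hne
    have hi : i = n := le_antisymm hs.le (by omega)
    have hp := hs.prod
    rw [hi, rest_end] at hp
    by_cases h0 : τ.var xProd = 0
    · rw [← hp, h0, Nat.zero_mul]
    · rw [← hp, ind_true (hs.free h0), Nat.mul_one]
  · exact ⟨0, [], le_rfl, by simp, by omega, by simp [num], by simp, by simp, fun j _ h => by omega,
      fun j h => by simp at h, by simp, by simp, fun _ => free_nil m⟩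

end

/-! ### The query -/

/-- The query. A string contains at most one batch for each `L` and `R`, so that larger sets of
batches need not be read. -/
def queryProg : Com :=
  .ite ((𝐯 xN + 1) * (𝐯 xN + 1) ≺ .input 2) (xRes ≔ 0) (
    xAlive ≔ 1 ;;
    xIn ≔ 3 ;;
    .for xBatch (.input 2) batchProg ;;
    .ite (𝐯 xAlive) (
      lettersProg ;;
      .ite (𝐯 xAlive) (
        scanProg ;;
        xRes ≔ 𝐯 xProd) (xRes ≔ 0)) (xRes ≔ 0))

lemma rest_eq (n m : ℕ) (ok : ℕ → Fin 3 → Prop) : rest n m ok [] 0 =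
    count n fun s => (∀ i < n, ok i (s.getD i 0)) ∧ Free m s := by
  simp [rest]

lemma queryProg_does {M : Machine} {σ : State} {n k V2 : ℕ} {P : List Str} {S : Finset Batch}
    {bs : List Batch} (h : Ready M n k V2 P σ) (hF : Fits M n (n / k) V2 P) (hA : M.B ≤ M.A)
    (hN : (n + 1) * (n + 1) ≤ M.N)
    (hinp : M.inp = encQuery n k bs)
    (hS : ∀ b ∈ S, b.Valid n) (hnd : bs.Nodup) (hbs : ∀ b, b ∈ bs ↔ b ∈ S)
    (hl : bs.length < M.B) (hiB : bs.length ≤ (n + 1) * (n + 1) → M.inp.length + 16 < M.B) :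
    Does M queryProg σ fun τ => τ.var 0 = SquareCount.h n k S := by
  classical
  have hT := h.tables
  have hB := hT.powers.lt
  have hcard : S.card = bs.length := by
    rw [← List.toFinset_card_of_nodup hnd]
    congr 1
    ext b
    simp [hbs]
  have hval : ∀ b ∈ bs, b.Valid n := fun b hb => hS b ((hbs b).1 hb)
  have hV2 : 4 ≤ V2 := by
    have := hT.dict.four
    rcases h.contexts with h1 | h1 <;> omega
  have hsmall : V2 = P.length ∨ n < 4 * (n / k) + 4 := by
    rcases h.contexts with ⟨rfl, -⟩ | h1
    · right; omega
    · exact Or.inl h1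
  have hin2v : ∀ τ, (Exp.input 2).Safe M τ ∧ (Exp.input 2).val M.inp τ = bs.length := by
    intro τ
    have hg : (encQuery n k bs).getD 2 0 = bs.length := rfl
    have hg' : 2 < (encQuery n k bs).length := by simp [encQuery]
    simp [-List.getD_eq_getElem?_getD, hinp, hg, hg', hl]
  refine Does.ite (by simpa using (hin2v σ).1) (fun hne => ?_) (fun hne => ?_)
  · have hc : (n + 1) * (n + 1) < bs.length := by
      rw [Exp.val_lt, (hin2v σ).2] at hne
      simpa [hT.hn] using hne
    exact Does.assign (by simp) (by simp; omega)
      (by simp [h_eq_zero_of_many (k := k) hS (by omega)])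
  have hc : bs.length ≤ (n + 1) * (n + 1) := by
    rw [Exp.val_lt, (hin2v σ).2] at hne
    simpa [hT.hn] using hne
  have hiB := hiB hc
  refine Does.assign_seq (by simp) (by simp; omega) ?_
  refine Does.assign_seq (by simp) (by simp; omega) ?_
  have hT₁ : ∀ u v, Tables M n (n / k) V2 ((n + 1) * P.length * V2) P
      ((σ.setVar xAlive u).setVar xIn v) := fun u v =>
    (hT.setVar u (by decide)).setVar v (by decide)
  refine Does.seq (P := fun τ => Processed n (n / k) bs τ) ?_ ?_
  · refine Does.for (K := bs.length) (fun j τ => Processed n (n / k) (bs.take j) τ ∧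
      M.inp.drop (τ.var xIn) = (bs.drop j).flatMap encBatch) (by decide) hl (by omega) ?_ ?_ ?_ ?_
    · exact fun _ τ _ _ _ => hin2v τ
    · rintro j τ hj hf - ⟨hp, hd⟩
      have hTτ := (hT₁ _ _).frame hf (by decide) (by decide)
      have hdrop := List.drop_eq_getElem_cons hj
      refine Does.mono (batchProg_does (b := bs[j]) (rest := (bs.drop (j + 1)).flatMap encBatch)
        hTτ.powers (hval _ (List.getElem_mem hj)) hA hTτ.hn hTτ.hm ?_ hiB hp) ?_
      · rw [hd, hdrop, List.flatMap_cons]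
      · rintro ρ _ ⟨⟨p1, p2, p3⟩, hd'⟩ v
        rw [List.take_concat_get' _ _ hj] at p1 p2 p3
        exact ⟨⟨by simpa using p1, p2, p3⟩, by simpa using hd'⟩
    · rintro τ _ ⟨hp, -⟩
      rwa [List.take_length] at hp
    · refine ⟨⟨?_, ?_, ?_⟩, ?_⟩
      · simpa using (ind_true trivial).symm
      · intro _ i; simp [h.zero aFixed i (by decide), Fixed]
      · intro _ i _ a; simp [h.zero aBad _ (by decide), Allowed]
      · simp [hinp, encQuery]
  intro τ₁ hf₁ hp
  have h₁ := (hT₁ _ _).frame hf₁ (by decide) (by decide)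
  refine Does.ite (by simp) (fun hne => ?_) (fun hne => ?_)
  · simp only [Exp.val_var, hp.alive, ne_eq, ind_eq_zero, not_not] at hne
    have hlong : ∀ b ∈ bs, n / k < b.U.length := fun b hb => (hne b hb).1
    have hh := h_eq (k := k) hS hbs fun b hb => (Nat.zero_le _).trans_lt (hlong b hb)
    rw [ind_true (fun b hb => (hne b hb).2), Nat.one_mul, ← rest_eq] at hh
    have hP := pattern_of_batches hval hlong
    refine Does.seq (lettersProg_does h₁.powers hA h₁.hn (hp.bad hlong) hp.alive) ?_
    rintro τ₂ hf₂ ⟨hal, hlet⟩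
    have h₂ := h₁.frame hf₂ (by decide) (by decide)
    refine Does.ite (by simp) (fun hne' => ?_) (fun hne' => ?_)
    · simp only [Exp.val_var, hal, ne_eq, ind_eq_zero, not_not] at hne'
      have hex : ∀ i, ∃ a : Fin 3, i < n → Allowed bs i a ∧ τ₂.arr aLetter i = a.val := by
        intro i
        by_cases hi : i < n
        · obtain ⟨a, ha⟩ := hlet i hi (hne'.2 i hi)
          exact ⟨a, fun _ => ha⟩
        · exact ⟨0, fun h => absurd h hi⟩
      choose L hL using hex
      have hctx : PatternCtx M n (n / k) V2 P (Fixed bs) (Allowed bs) L τ₂ :=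
        ⟨h₂, by rw [hf₂.arr _ (by decide)]; exact hp.bad hlong,
          by rw [hf₂.arr _ (by decide)]; exact hp.fixed hlong, fun i hi => (hL i hi).2⟩
      refine Does.seq (scanProg_does hctx hF hP (fun i hi => (hL i hi).1) hV2 hA hsmall) ?_
      intro τ₃ hf₃ hr
      have := h₂.powers.pow_lt (i := n) (by omega)
      have hle : rest n (n / k) (Allowed bs) [] 0 ≤ 3 ^ n := rest_le _ _
      exact Does.assign (by simp) (by simp [hr]; omega) (by simp [hr, hh])
    · simp only [Exp.val_var, hal, ind_eq_zero] at hne'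
      refine Does.assign (by simp) (by simp; omega) ?_
      have : ∃ i < n, ∀ a, ¬ Allowed bs i a := by
        by_contra! hall
        exact hne' ⟨hne, hall⟩
      obtain ⟨i, hi, hno⟩ := this
      rw [hh, rest_eq, count_false _ fun x _ hx => hno _ (hx.1 i hi)]
      simp
  · simp only [Exp.val_var, hp.alive, ind_eq_zero] at hne
    refine Does.assign (by simp) (by simp; omega) ?_
    by_cases hlong : ∀ b ∈ bs, n / k < b.U.length
    · rw [h_eq (k := k) hS hbs fun b hb => (Nat.zero_le _).trans_lt (hlong b hb), ind_false, Nat.zero_mul]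
      · simp
      · exact fun hall => hne fun b hb => ⟨hlong b hb, hall b hb⟩
    · obtain ⟨b, hb, hl⟩ : ∃ b ∈ bs, b.U.length ≤ n / k := by
        by_contra! hc
        exact hlong hc
      rw [h_eq_zero_of_short ((hbs b).1 hb) hS hl]
      simp

/-! ### The resources -/

/-- The function is bounded by a polynomial. -/
def PolyBdd (f : ℕ → ℕ) : Prop := ∃ C, ∀ n, f n ≤ poly C n

lemma PolyBdd.const (c : ℕ) : PolyBdd fun _ => c :=
  ⟨c, fun n => Nat.le_mul_of_pos_right _ (by positivity)⟩

lemma PolyBdd.id : PolyBdd fun n => n := ⟨1, fun n => by simp [poly]⟩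

lemma PolyBdd.add {f g : ℕ → ℕ} (hf : PolyBdd f) (hg : PolyBdd g) :
    PolyBdd fun n => f n + g n := by
  obtain ⟨C, hC⟩ := hf
  obtain ⟨D, hD⟩ := hg
  refine ⟨C + D, fun n => (Nat.add_le_add (hC n) (hD n)).trans ?_⟩
  rw [poly, poly, poly, Nat.add_mul]
  exact Nat.add_le_add (Nat.mul_le_mul_left _ (Nat.pow_le_pow_right (by omega) (by omega)))
    (Nat.mul_le_mul_left _ (Nat.pow_le_pow_right (by omega) (by omega)))

lemma PolyBdd.mul {f g : ℕ → ℕ} (hf : PolyBdd f) (hg : PolyBdd g) :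
    PolyBdd fun n => f n * g n := by
  obtain ⟨C, hC⟩ := hf
  obtain ⟨D, hD⟩ := hg
  refine ⟨C * D + (C + D), fun n => (Nat.mul_le_mul (hC n) (hD n)).trans ?_⟩
  calc poly C n * poly D n = C * D * (n + 1) ^ (C + D) := by rw [poly, poly, pow_add]; ring
    _ ≤ poly (C * D + (C + D)) n :=
      Nat.mul_le_mul (by omega) (Nat.pow_le_pow_right (by omega) (by omega))

lemma PolyBdd.tb {N : ℕ → ℕ} (hN : PolyBdd N) (c : Com) : PolyBdd fun n => c.tb (N n) := by
  induction c with
  | skip => exact .const 1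
  | assign x e => exact .const (e.cost + 1)
  | store a i e => exact .const (i.cost + e.cost + 1)
  | seq c₁ c₂ h₁ h₂ => exact (h₁.add h₂).add (.const 1)
  | ite e c₁ c₂ h₁ h₂ => exact ((PolyBdd.const e.cost).add (h₁.add h₂)).add (.const 1)
  | _ e c h =>
    exact ((hN.mul (((PolyBdd.const e.cost).add h).add (.const 1))).add (.const e.cost)).add
      (.const 1)

/-- The bound for the iterations of a loop, other than the loops over the dictionary and the table. -/
def maxIter (n : ℕ) : ℕ := (n + 1) * (n + 1) + 5

/-- The bound for the contents of a memory cell. -/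
def maxVal (n : ℕ) : ℕ := 3 ^ (7 * n + 7)

lemma maxVal_eq (n : ℕ) : maxVal n = 2187 * (3 ^ n) ^ 7 := by
  rw [maxVal, pow_add, pow_mul', Nat.mul_comm]
  norm_num

lemma maxVal_pow_le {n w : ℕ} (hw : 336 * (n + 1) ≤ w) : maxVal n ^ 24 ≤ 2 ^ w := by
  calc maxVal n ^ 24 = 3 ^ (168 * (n + 1)) := by rw [maxVal, ← pow_mul]; congr 1; ring
    _ ≤ 4 ^ (168 * (n + 1)) := Nat.pow_le_pow_left (by norm_num) _
    _ = 2 ^ (336 * (n + 1)) := by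
      rw [show (4 : ℕ) = 2 ^ 2 by norm_num, ← pow_mul]; congr 1; ring
    _ ≤ 2 ^ w := Nat.pow_le_pow_right (by norm_num) hw

lemma length_le_of_strings {n : ℕ} {l : List Str} (hnd : l.Nodup) (hl : ∀ s ∈ l, s.length ≤ n) :
    l.length ≤ (n + 1) * 3 ^ n := by
  classical
  rw [← List.toFinset_card_of_nodup hnd]
  have : (Finset.range (n + 1) ×ˢ Finset.range (3 ^ n)).card = (n + 1) * 3 ^ n := by simp
  rw [← this]
  refine Finset.card_le_card_of_injOn (fun s => (s.length, num s)) ?_ ?_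
  · intro s hs
    have h1 := hl s (by simpa using hs)
    have h2 := num_lt_of_le h1
    simp; omega
  · intro s _ t _ h
    simp only [Prod.mk.injEq] at h
    exact num_inj h.1 h.2

/-- The number of batches in the input of a query is exponential at most, so that it fits into a
word even if the batches are not read. -/
lemma length_le_of_batches {n : ℕ} {l : List Batch} (hnd : l.Nodup) (hl : ∀ b ∈ l, b.Valid n) :
    l.length ≤ (n + 1) * ((n + 2) * ((n + 1) * 3 ^ n)) := by
  classical
  rw [← List.toFinset_card_of_nodup hnd]
  have : (Finset.range (n + 1) ×ˢ (Finset.range (n + 2) ×ˢ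
    (Finset.range (n + 1) ×ˢ Finset.range (3 ^ n)))).card =
      (n + 1) * ((n + 2) * ((n + 1) * 3 ^ n)) := by simp
  rw [← this]
  refine Finset.card_le_card_of_injOn (fun b => (b.L, b.T, b.U.length, num b.U)) ?_ ?_
  · intro b hb
    obtain ⟨h1, h2, h3, -⟩ := hl b (by simpa using hb)
    have h4 := num_lt_of_le (show b.U.length ≤ n by omega)
    simp; omega
  · intro b hb c hc h
    obtain ⟨-, h2, -⟩ := hl b (by simpa using hb)
    obtain ⟨-, h3, -⟩ := hl c (by simpa using hc)
    simp only [Prod.mk.injEq] at h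
    have hU := num_inj h.2.2.1 h.2.2.2
    cases b; cases c; simp_all

lemma length_flatMap_le {α : Type*} {l : List α} {f : α → List ℕ} {c : ℕ}
    (h : ∀ x ∈ l, (f x).length ≤ c) : (l.flatMap f).length ≤ l.length * c := by
  induction l with
  | nil => simp
  | cons x l ih =>
    have h1 := h x (by simp)
    have h2 := ih fun y hy => h y (by simp [hy])
    rw [List.flatMap_cons, List.length_append, List.length_cons, Nat.add_mul]
    omega

lemma length_eq_ncard {l : List Str} {A : Set Str} (hnd : l.Nodup) (h : ∀ s, s ∈ l ↔ s ∈ A) :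
    l.length = A.ncard := by
  classical
  rw [← List.toFinset_card_of_nodup hnd, ← Set.ncard_coe_finset]
  congr 1
  ext s
  simp [h]

/-- The precomputation and the query for word length `w` and memory `A`; the number `W` of right
contexts in the table is constant for `k = 4`. -/
lemma computes {n k w A T Q W : ℕ} (hk : 4 ≤ k) (hw : 336 * (n + 1) ≤ w) (hkw : k < 2 ^ w)
    (hW : k = 4 ∧ W = 4 ∨ W = 5 * (n + 1) * numMin (n / k))
    (hA : 5 * (n + 1) ^ 2 * numMin (n / k) * W ≤ A)
    (hT : numMin (n / k) * (wordProg.tb (maxIter n) + 10) +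
      5 * (n + 1) ^ 2 * numMin (n / k) * W * (cellProg.tb (maxIter n) + 15) +
      (powProg.tb (maxIter n) + initProg.tb (maxIter n) + 100) ≤ T)
    (hQ : queryProg.tb (maxIter n) ≤ Q) : Computes preProg queryProg n k w T A Q := by
  intro ms hnd hms
  have hm4 : 4 * (n / k) ≤ n :=
    (Nat.mul_le_mul_right _ hk).trans (Nat.mul_div_le _ _)
  have hlen : ∀ t ∈ ms, t.length ≤ 2 * (n / k) := fun t ht => ((hms t).1 ht).2
  have hq : ms.length ≤ numMin (n / k) := by
    rw [length_eq_ncard hnd hms]; exact le_max_right _ _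
  have hq1 : 1 ≤ numMin (n / k) := le_max_left _ _
  obtain ⟨q, hqq⟩ : ∃ q, q = numMin (n / k) := ⟨_, rfl⟩
  rw [← hqq] at hW hA hT hq hq1
  have hc3 := length_le_of_strings hnd fun t ht => (hlen t ht).trans (by omega : _ ≤ n)
  have hD : maxLen n k ≤ n + 1 := by unfold maxLen; omega
  have hny : n + 1 ≤ 3 ^ n := Nat.lt_pow_self (by norm_num)
  -- all values are bounded by powers of `y`, as there are at most `(n + 1) * y` words
  obtain ⟨y, hy⟩ : ∃ y, y = 3 ^ n := ⟨_, rfl⟩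
  rw [← hy] at hc3 hny
  have hB := maxVal_eq n
  rw [← hy] at hB
  obtain ⟨V, hV⟩ : ∃ V, V = maxNodes n k ms.length := ⟨_, rfl⟩
  obtain ⟨X, hX⟩ : ∃ X, X = maxContexts n k ms.length := ⟨_, rfl⟩
  have hVdef : V = 4 + ms.length * maxLen n k := hV
  have hVq : V ≤ 5 * (n + 1) * q := by
    have := Nat.mul_le_mul hq hD
    nlinarith
  have hXV : X ≤ V := by
    rw [hX, maxContexts]; split_ifs <;> omega
  have hXW : X ≤ W := by
    rcases hW with ⟨h1, h2⟩ | h1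
    · rw [hX, maxContexts, if_pos h1, h2]
    · omega
  have hW4 : 4 ≤ W := by
    rcases hW with ⟨h1, h2⟩ | h1
    · omega
    · omega
  have hVX : (n + 1) * V * X ≤ 5 * (n + 1) ^ 2 * q * W := by
    calc (n + 1) * V * X ≤ (n + 1) * (5 * (n + 1) * q) * W :=
          Nat.mul_le_mul (Nat.mul_le_mul_left _ hVq) hXW
      _ = _ := by ring
  have hV3 : 3 * V ≤ 5 * (n + 1) ^ 2 * q * W := by
    calc 3 * V ≤ W * (5 * (n + 1) * q) := Nat.mul_le_mul (by omega) hVq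
      _ ≤ (n + 1) * (W * (5 * (n + 1) * q)) := Nat.le_mul_of_pos_left _ (by omega)
      _ = _ := by ring
  have hnA : n + 12 < 5 * (n + 1) ^ 2 * q * W := by
    have h1 : 5 * (n + 1) ^ 2 * 1 * 4 ≤ 5 * (n + 1) ^ 2 * q * W :=
      Nat.mul_le_mul (Nat.mul_le_mul_left _ hq1) hW4
    have h2 : (n + 1) ^ 2 = n * n + 2 * n + 1 := by ring
    omega
  have hy7 : ∀ i ≤ 7, y ^ i ≤ y ^ 7 := fun i hi => Nat.pow_le_pow_right (by omega) hi
  have hVy : V ≤ 5 * y ^ 3 := by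
    have h1 : ms.length * maxLen n k ≤ (y * y) * y :=
      Nat.mul_le_mul (hc3.trans (Nat.mul_le_mul_right _ hny)) (hD.trans hny)
    have h2 : 1 ≤ y ^ 3 := Nat.one_le_pow _ _ (by omega)
    have h3 : y ^ 3 = y * y * y := by ring
    omega
  have h3 := hy7 3 (by norm_num)
  have h70 : 1 ≤ y ^ 7 := hy7 0 (by norm_num)
  have hVXy : (n + 1) * V * X ≤ 25 * y ^ 7 := by
    calc (n + 1) * V * X ≤ y * (5 * y ^ 3) * (5 * y ^ 3) :=
          Nat.mul_le_mul (Nat.mul_le_mul hny hVy) (hXV.trans hVy)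
      _ = _ := by ring
  have hpre : (encPre n k ms).length < maxVal n := by
    have h1 := length_flatMap_le (l := ms) (f := encStr) (c := n + 1) fun t ht => by
      have := hlen t ht
      simp [encStr]; omega
    have h2 : ms.length * (n + 1) ≤ (y * y) * y :=
      Nat.mul_le_mul (hc3.trans (Nat.mul_le_mul_right _ hny)) hny
    have h4 : y ^ 3 = y * y * y := by ring
    simp only [encPre, List.length_cons]
    omega
  have hpow : 3 ^ (n + 7) ≤ maxVal n := Nat.pow_le_pow_right (by norm_num) (by omega)
  have h16 : 16 ≤ maxVal n := by omega
  have hN : n + 4 < maxIter n := by unfold maxIter; nlinarith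
  obtain ⟨τ, t, hexec, ht, hbd, P, V2, hR, hF⟩ := preProg_runs
    (M := ⟨w, A, maxIter n, maxVal n, encPre n k ms, h16, maxVal_pow_le hw⟩) hk hkw rfl hlen
    (fun t ht => (hms t).2 ht) (hnA.trans_le hA) hN (by rw [← hV]; exact hV3.trans hA)
    (by rw [← hV, ← hX]; exact hVX.trans hA) hpow
    (by rw [← hV, ← hX]; change _ < maxVal n; omega) hpre (by rfl)
    ⟨fun _ => by change 0 < maxVal n; omega, fun _ _ => by change 0 < maxVal n; omega⟩
  refine ⟨τ, t, hexec, ht.trans (le_trans ?_ hT), ?_⟩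
  · rw [← hV, ← hX]
    exact Nat.add_le_add_right (Nat.add_le_add (Nat.mul_le_mul_right _ hq)
      (Nat.mul_le_mul_right _ hVX)) _
  intro S hS bs hbnd hbs
  have hval : ∀ b ∈ bs, b.Valid n := fun b hb => hS b ((hbs b).1 hb)
  have hbl : bs.length < maxVal n := by
    have h1 := length_le_of_batches hbnd hval
    rw [← hy] at h1
    have h2 : (n + 1) * ((n + 2) * ((n + 1) * y)) ≤ y * ((2 * y) * (y * y)) := by
      gcongr; omega
    have h4 : y * ((2 * y) * (y * y)) = 2 * y ^ 4 := by ring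
    have h5 := hy7 4 (by norm_num)
    omega
  have hql : bs.length ≤ (n + 1) * (n + 1) → (encQuery n k bs).length + 16 < maxVal n := by
    intro h
    have h1 := length_flatMap_le (l := bs) (f := encBatch) (c := n + 4) fun b hb => by
      obtain ⟨h1, h2, h3, -⟩ := hval b hb
      simp [encBatch, encStr]; omega
    have h2 : bs.length * (n + 4) ≤ (y * y) * (4 * y) :=
      Nat.mul_le_mul (h.trans (Nat.mul_le_mul hny hny)) (by omega)
    have h4 : (y * y) * (4 * y) = 4 * y ^ 3 := by ring
    simp only [encQuery, List.length_cons]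
    omega
  -- the query runs on the same contents, on a machine with another input and larger arrays
  let M : Machine := ⟨w, 2 ^ w, maxIter n, maxVal n, encQuery n k bs, h16, maxVal_pow_le hw⟩
  have hMA : M.B ≤ M.A := M.B_le
  have hBA : maxVal n ≤ 2 ^ w := M.B_le
  have hp := hR.tables.powers
  have hlt : 27 * (n + 4) + 27 ≤ maxVal n := hp.lt
  have hbound : (n + 1) * P.length * V2 + 3 * P.length + 3 < maxVal n := hF.bound
  have hR' : Ready M n k V2 P τ := by
    refine ⟨⟨hR.tables.hn, hR.tables.hm, hR.tables.hV2, ⟨hp.eq, ?_, hp.hN, hp.hB⟩,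
      hR.tables.dict, hR.tables.table⟩, hR.contexts, hR.zero⟩
    change n + 4 < 2 ^ w
    omega
  have hF' : Fits M n (n / k) V2 P := by
    refine ⟨hF.m_le, hF.len, hF.V2_pos, hF.V2_le, ?_, ?_, hF.bound, hF.covers⟩
    · change 3 * P.length ≤ 2 ^ w
      omega
    · change (n + 1) * P.length * V2 ≤ 2 ^ w
      omega
  obtain ⟨ρ, u, hexec', hu, -, hres⟩ := queryProg_does hR' hF' hMA
    (by change _ ≤ maxIter n; unfold maxIter; omega) rfl hS hbnd hbs hbl hql (by rfl) hbd
  exact ⟨ρ, u, hexec', hu.trans hQ, hres⟩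

/-- A common bound for the polynomial factors of all resources. -/
def resource (n : ℕ) : ℕ :=
  25 * ((n + 1) * ((n + 1) * (n + 1))) * (wordProg.tb (maxIter n) + cellProg.tb (maxIter n) +
    powProg.tb (maxIter n) + initProg.tb (maxIter n) + 125) + queryProg.tb (maxIter n) +
    336 * (n + 1)

lemma resource_polyBdd : PolyBdd resource := by
  have h1 : PolyBdd fun n => n + 1 := PolyBdd.id.add (.const 1)
  have hN : PolyBdd maxIter := (h1.mul h1).add (.const 5)
  exact ((((PolyBdd.const 25).mul (h1.mul (h1.mul h1))).mul
    (((((hN.tb wordProg).add (hN.tb cellProg)).add (hN.tb powProg)).add (hN.tb initProg)).add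
      (.const 125))).add (hN.tb queryProg)).add ((PolyBdd.const 336).mul h1)

lemma resource_bounds (n : ℕ) {q Z : ℕ} (hq : 1 ≤ q) (hqZ : q ≤ Z) :
    25 * (n + 1) ^ 3 * Z ≤ resource n * Z ∧
    q * (wordProg.tb (maxIter n) + 10) + 25 * (n + 1) ^ 3 * Z * (cellProg.tb (maxIter n) + 15) +
      (powProg.tb (maxIter n) + initProg.tb (maxIter n) + 100) ≤ resource n * Z ∧
    queryProg.tb (maxIter n) ≤ resource n ∧ 336 * (n + 1) ≤ resource n := by
  unfold resource
  generalize wordProg.tb (maxIter n) = a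
  generalize cellProg.tb (maxIter n) = b
  generalize powProg.tb (maxIter n) = c
  generalize initProg.tb (maxIter n) = d
  generalize queryProg.tb (maxIter n) = e
  obtain ⟨p, hp⟩ : ∃ p, p = 25 * (n + 1) ^ 3 := ⟨_, rfl⟩
  have hp' : 25 * ((n + 1) * ((n + 1) * (n + 1))) = p := by rw [hp]; ring
  have hp1 : 1 ≤ p := by rw [hp]; exact Nat.mul_pos (by norm_num) (by positivity)
  rw [hp', ← hp]
  have main : q * (a + 10) + p * Z * (b + 15) + (c + d + 100) ≤ p * (a + b + c + d + 125) * Z := by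
    have h1 : q * (a + 10) ≤ p * Z * (a + 10) := Nat.mul_le_mul_right _
      (hqZ.trans (Nat.le_mul_of_pos_left _ hp1))
    have h2 : 1 * (c + d + 100) ≤ p * Z * (c + d + 100) := Nat.mul_le_mul_right _
      (Nat.mul_pos hp1 (hq.trans hqZ))
    calc _ ≤ p * Z * (a + 10) + p * Z * (b + 15) + p * Z * (c + d + 100) := by omega
      _ = _ := by ring
  refine ⟨?_, main.trans (Nat.mul_le_mul_right _ (by omega)), by omega, by omega⟩
  refine Nat.mul_le_mul_right _ ?_
  have := Nat.le_mul_of_pos_right p (show 0 < a + b + c + d + 125 by omega)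
  omega

end SquareCount

theorem lemma4 :
    (∃ (C : ℕ) (pre query : Com), ∀ n k : ℕ, 4 ≤ k →
      Computes pre query n k (poly C n + Nat.size k)
        (poly C n * numMin (n / k) ^ 3) (poly C n * numMin (n / k) ^ 2)
        (poly C n * 2 ^ (C * k))) ∧
    (∃ (C : ℕ) (pre query : Com), ∀ n : ℕ,
      Computes pre query n 4 (poly C n + Nat.size 4)
        (poly C n * numMin (n / 4)) (poly C n * numMin (n / 4))
        (poly C n)) := by
  obtain ⟨C, hC⟩ := resource_polyBdd
  have hkw : ∀ n k, k < 2 ^ (poly C n + Nat.size k) := fun n k =>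
    (Nat.lt_size_self k).trans_le (Nat.pow_le_pow_right (by norm_num) (by omega))
  refine ⟨⟨C, preProg, queryProg, fun n k hk => ?_⟩, ⟨C, preProg, queryProg, fun n => ?_⟩⟩
  · have hq : 1 ≤ numMin (n / k) := le_max_left _ _
    obtain ⟨h1, h2, h3, h4⟩ := resource_bounds n hq (Nat.le_self_pow (n := 2) (by norm_num) _)
    have hres := hC n
    have hA : 5 * (n + 1) ^ 2 * numMin (n / k) * (5 * (n + 1) * numMin (n / k)) =
        25 * (n + 1) ^ 3 * numMin (n / k) ^ 2 := by ring
    have hZ := Nat.mul_le_mul_right (numMin (n / k) ^ 2) hres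
    refine computes (W := 5 * (n + 1) * numMin (n / k)) hk (by omega) (hkw n k) (Or.inr rfl) ?_ ?_ ?_
    · rw [hA]; exact h1.trans hZ
    · rw [hA]
      exact (h2.trans hZ).trans (Nat.mul_le_mul_left _ (Nat.pow_le_pow_right hq (by norm_num)))
    · exact (h3.trans hres).trans (Nat.le_mul_of_pos_right _ (by positivity))
  · have hq : 1 ≤ numMin (n / 4) := le_max_left _ _
    obtain ⟨h1, h2, h3, h4⟩ := resource_bounds n hq le_rfl
    have hres := hC n
    have hA : 5 * (n + 1) ^ 2 * numMin (n / 4) * 4 ≤ 25 * (n + 1) ^ 3 * numMin (n / 4) := by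
      calc _ = 20 * (n + 1) ^ 2 * numMin (n / 4) := by ring
        _ ≤ _ := by gcongr <;> omega
    have hZ := Nat.mul_le_mul_right (numMin (n / 4)) hres
    refine computes (W := 4) le_rfl (by omega) (hkw n 4) (Or.inl ⟨rfl, rfl⟩) ?_ ?_ (h3.trans hres)
    · exact hA.trans (h1.trans hZ)
    · exact le_trans (by gcongr) (h2.trans hZ)
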